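/- Let $d\in\mathbb N$ and $\delta<0$. Let $a\in C^\infty(\mathbb R^d\times\mathbb R^d;\mathbb C)$ be a symbol of order $\delta$, i.e. for all multi-indices $\alpha,\beta\in\mathbb N^d$ $$\sup_{x,\xi\in\mathbb R^d}|\partial_x^\alpha\partial_\xi^\beta a(x,\xi)|\,(1+|\xi|)^{-\delta+|\beta|}<\infty ,$$ and let $A=\mathrm{Op}(a)$ be the associated pseudodifferential operator on the tempered distributions $\mathcal S'(\mathbb R^d)$, $$Au(x)=\frac1{(2\pi)^d}\int\!\!\int e^{i(x-y)\cdot\xi}a(x,\xi)u(y)\,dy\,d\xi ,$$ understood by duality: $\langle Au,\varphi\rangle=\langle u,A^{t}\varphi\rangle$ for all Schwartz functions $\varphi$, where $A^{t}\varphi(y)=(2\pi)^{-d}\int e^{-iy\cdot\xi}\big(\int e^{ix\cdot\xi}a(x,\xi)\varphi(x)\,dx\big)d\xi$. Let $\mathcal M_0(\mathbb R^d)$ be the space of finite complex Radon measures on $\mathbb R^d$ with the total variation norm. Then: 1. $A$ maps $\mathcal M_0(\mathbb R^d)$ continuously into $L^1(\mathbb R^d)$: there is a constant $C$ such that $A\mu\in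 L^1(\mathbb R^d)$ and $\|A\mu\|_{L^1}\le C\|\mu\|_{\mathcal M_0}$ for all $\mu\in\mathcal M_0(\mathbb R^d)$. 2. For every $\varepsilon>0$, $A$ maps $\mathcal M_0(\mathbb R^d)$ continuously into $W^{-\delta-\varepsilon,1}(\mathbb R^d)$: there is a constant $C$ such that $A\mu\in W^{-\delta-\varepsilon,1}(\mathbb R^d)$ and $\|A\mu\|_{W^{-\delta-\varepsilon,1}}\le C\|\mu\|_{\mathcal M_0}$ for all $\mu\in\mathcal M_0(\mathbb R^d)$. In 2, for $s\in\mathbb R$, $W^{s,1}(\mathbb R^d)$ is the Bessel potential space of the $u\in\mathcal S'(\mathbb R^d)$ for which the Fourier multiplier $J^su=\mathcal F^{-1}\big[(1+|\xi/2\pi|^2)^{s/2}\,\mathcal Fu\big]$ (where $\mathcal Fu(\xi)=\int e^{-ix\cdot\xi}u(x)\,dx$) is in $L^1$, with norm $\|J^su\|_{L^1}$. When $s=-\delta-\varepsilon\ge0$, the same statement also holds with $W^{s,1}(\mathbb R^d)$ the Sobolev–Slobodeckij space, with norm $$\sum_{|\alpha|\le\lfloor s\rfloor}\|\partial^\alpha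 u\|_{L^1}+\sum_{|\alpha|=\lfloor s\rfloor}\iint\frac{|\partial^\alpha u(x)-\partial^\alpha u(y)|}{|x-y|^{d+s-\lfloor s\rfloor}}\,dx\,dy ,$$ where the second sum is omitted if $s$ is an integer. -/

import Mathlib

open MeasureTheory FourierTransform
open scoped ContDiff SchwartzMap

namespace PsiDO

/-- The Euclidean space `ℝᵈ`. -/
abbrev Eu (d : ℕ) : Type := EuclideanSpace ℝ (Fin d)

section Aux

variable {d : ℕ} {F G H : Type*} [NormedAddCommGroup F] [NormedSpace ℂ F]
  [NormedAddCommGroup G] [NormedSpace ℂ G] [NormedAddCommGroup H] [NormedSpace ℂ H]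

/-- Smooth functions on `ℝᵈ × ℝᵈ` whose derivatives all have growth of order at most `m` in the first
variable, and polynomial growth in the second. (An auxiliary notion.) -/
def Tame {d : ℕ} {F : Type*} [NormedAddCommGroup F] [NormedSpace ℝ F] (m : ℕ)
    (g : Eu d × Eu d → F) : Prop :=
  ContDiff ℝ ∞ g ∧ ∀ n : ℕ, ∃ (C : ℝ) (k : ℕ), 0 ≤ C ∧ ∀ p : Eu d × Eu d,
    ‖iteratedFDeriv ℝ n g p‖ ≤ C * (1 + ‖p.1‖) ^ m * (1 + ‖p.2‖) ^ k

theorem Tame.uniform {d : ℕ} {F : Type*} [NormedAddCommGroup F] [NormedSpace ℝ F] {m : ℕ}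
    {g : Eu d × Eu d → F} (hg : Tame m g) (N : ℕ) : ∃ (C : ℝ) (k : ℕ), 0 ≤ C ∧ ∀ n ≤ N,
    ∀ p : Eu d × Eu d, ‖iteratedFDeriv ℝ n g p‖ ≤ C * (1 + ‖p.1‖) ^ m * (1 + ‖p.2‖) ^ k := by
  choose C k hC h using hg.2
  refine ⟨∑ n ∈ Finset.range (N + 1), C n, ∑ n ∈ Finset.range (N + 1), k n,
    Finset.sum_nonneg fun n _ => hC n, fun n hn p => (h n p).trans ?_⟩
  have hn' : n ∈ Finset.range (N + 1) := by simp; omega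
  have h1 : C n ≤ ∑ n ∈ Finset.range (N + 1), C n :=
    Finset.single_le_sum (fun n _ => hC n) hn'
  have h2 : k n ≤ ∑ n ∈ Finset.range (N + 1), k n :=
    Finset.single_le_sum (fun n _ => Nat.zero_le _) hn'
  have h3 : (1 + ‖p.2‖) ^ k n ≤ (1 + ‖p.2‖) ^ (∑ n ∈ Finset.range (N + 1), k n) :=
    pow_le_pow_right₀ (by simp) h2
  have h4 : 0 ≤ ∑ n ∈ Finset.range (N + 1), C n := (hC n).trans h1
  gcongr

theorem Tame.add {m : ℕ} {g h : Eu d × Eu d → F} (hg : Tame m g) (hh : Tame m h) :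
    Tame m (g + h) := by
  refine ⟨hg.1.add hh.1, fun n => ?_⟩
  obtain ⟨C, k, hC, H1⟩ := hg.2 n
  obtain ⟨C', k', hC', H2⟩ := hh.2 n
  refine ⟨C + C', k + k', by positivity, fun p => ?_⟩
  rw [iteratedFDeriv_add_apply (hg.1.contDiffAt.of_le (mod_cast le_top))
    (hh.1.contDiffAt.of_le (mod_cast le_top))]
  refine (norm_add_le _ _).trans ((add_le_add (H1 p) (H2 p)).trans ?_)
  have e1 : (1 + ‖p.2‖) ^ k ≤ (1 + ‖p.2‖) ^ (k + k') := pow_le_pow_right₀ (by simp) (by omega)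
  have e2 : (1 + ‖p.2‖) ^ k' ≤ (1 + ‖p.2‖) ^ (k + k') := pow_le_pow_right₀ (by simp) (by omega)
  calc _ ≤ C * (1 + ‖p.1‖) ^ m * (1 + ‖p.2‖) ^ (k + k') +
        C' * (1 + ‖p.1‖) ^ m * (1 + ‖p.2‖) ^ (k + k') := by gcongr
    _ = _ := by ring

theorem Tame.clm {m : ℕ} {g : Eu d × Eu d → F} (hg : Tame m g) (B : F →L[ℝ] G) :
    Tame m (B ∘ g) := by
  refine ⟨B.contDiff.comp hg.1, fun n => ?_⟩
  obtain ⟨C, k, hC, H1⟩ := hg.2 n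
  refine ⟨‖B‖ * C, k, by positivity, fun p => ?_⟩
  refine (B.norm_iteratedFDeriv_comp_left (N := ∞) hg.1.contDiffAt (mod_cast le_top)).trans ?_
  calc _ ≤ ‖B‖ * (C * (1 + ‖p.1‖) ^ m * (1 + ‖p.2‖) ^ k) := by gcongr; exact H1 p
    _ = _ := by ring

theorem Tame.snd : Tame 0 (fun p : Eu d × Eu d => p.2) := by
  refine ⟨contDiff_snd, fun n => ?_⟩
  obtain ⟨k, C, h⟩ := (ContinuousLinearMap.id ℝ (Eu d)).hasTemperateGrowth.2 n
  refine ⟨|C|, k, abs_nonneg _, fun p => ?_⟩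
  have := (ContinuousLinearMap.snd ℝ (Eu d) (Eu d)).iteratedFDeriv_comp_right
    (f := fun x : Eu d => x) (n := ∞) contDiff_id p (i := n) (mod_cast le_top)
  have e : (fun p : Eu d × Eu d => p.2) = (fun x : Eu d => x) ∘ ContinuousLinearMap.snd ℝ (Eu d) (Eu d) := rfl
  rw [e, this]
  refine (ContinuousMultilinearMap.norm_compContinuousLinearMap_le _ _).trans ?_
  have e2 : ‖ContinuousLinearMap.snd ℝ (Eu d) (Eu d)‖ ≤ 1 := ContinuousLinearMap.norm_snd_le ..
  have h3 := h p.2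
  simp only [Finset.prod_const, Finset.card_univ, Fintype.card_fin, pow_zero, mul_one]
  have e4 : ‖ContinuousLinearMap.snd ℝ (Eu d) (Eu d)‖ ^ n ≤ 1 := pow_le_one₀ (norm_nonneg _) e2
  calc _ ≤ (C * (1 + ‖p.2‖) ^ k) * 1 := by
        refine mul_le_mul h3 e4 (by positivity) ((norm_nonneg _).trans h3)
    _ ≤ |C| * (1 + ‖p.2‖) ^ k := by
        rw [mul_one]; gcongr; exact le_abs_self C

theorem Tame.bilin {K : Type*} [NormedAddCommGroup K] [NormedSpace ℝ K]
    {m : ℕ} {g : Eu d × Eu d → F} {h : Eu d × Eu d → K} (hg : Tame m g) (hh : Tame 0 h)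
    (B : F →L[ℝ] K →L[ℝ] G) : Tame m (fun p => B (g p) (h p)) := by
  refine ⟨B.isBoundedBilinearMap.contDiff.comp (hg.1.prodMk hh.1), fun n => ?_⟩
  obtain ⟨C, k, hC, H1⟩ := hg.uniform n
  obtain ⟨C', k', hC', H2⟩ := hh.uniform n
  refine ⟨‖B‖ * ∑ i ∈ Finset.range (n + 1), (n.choose i : ℝ) * C * C', k + k', by positivity,
    fun p => ?_⟩
  refine (B.norm_iteratedFDeriv_le_of_bilinear hg.1 hh.1 p (n := n) (mod_cast le_top)).trans ?_
  rw [mul_assoc, mul_assoc, Finset.sum_mul]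
  refine mul_le_mul_of_nonneg_left (Finset.sum_le_sum fun i hi => ?_) (norm_nonneg B)
  have hi' : i ≤ n := by
    simp at hi
    omega
  have a1 := H1 i hi' p
  have a2 := H2 (n - i) (by omega) p
  calc _ ≤ (n.choose i : ℝ) * (C * (1 + ‖p.1‖) ^ m * (1 + ‖p.2‖) ^ k) *
        (C' * (1 + ‖p.1‖) ^ 0 * (1 + ‖p.2‖) ^ k') := by
        refine mul_le_mul (mul_le_mul_of_nonneg_left a1 (by positivity)) a2 (norm_nonneg _)
          (by positivity)
    _ = _ := by ring

theorem Tame.fderiv_tame {m : ℕ} {g : Eu d × Eu d → F} (hg : Tame m g) :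
    Tame m (fderiv ℝ g) := by
  refine ⟨hg.1.fderiv_right (by simp), fun n => ?_⟩
  obtain ⟨C, k, hC, H1⟩ := hg.2 (n + 1)
  exact ⟨C, k, hC, fun p => by rw [norm_iteratedFDeriv_fderiv]; exact H1 p⟩

/-- The oscillatory integral `ξ ↦ ∫ e^{-2πi x·ξ} f(x) g(ξ, x) dx`. -/
noncomputable def osc (g : Eu d × Eu d → F) (f : 𝓢(Eu d, ℂ)) (ξ : Eu d) : F :=
  𝓕 (fun x => f x • g (ξ, x)) ξ

/-- The amplitude of the derivative of `osc g f`. -/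
noncomputable def oscD (g : Eu d × Eu d → F) (p : Eu d × Eu d) : Eu d →L[ℝ] F :=
  (fderiv ℝ g p).comp (ContinuousLinearMap.inl ℝ (Eu d) (Eu d)) +
    (innerSL ℝ p.2).smulRight (-(2 * Real.pi * Complex.I) • g p)

theorem Tame.oscD_tame {m : ℕ} {g : Eu d × Eu d → F} (hg : Tame m g) : Tame m (oscD g) := by
  have h1 := hg.fderiv_tame.clm
    ((ContinuousLinearMap.compL ℝ (Eu d) (Eu d × Eu d) F).flip
      (ContinuousLinearMap.inl ℝ (Eu d) (Eu d)))
  have h2 := (hg.clm ((-(2 * Real.pi * Complex.I)) • ContinuousLinearMap.id ℝ F)).bilin Tame.snd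
    ((ContinuousLinearMap.smulRightL ℝ (Eu d) F).flip.bilinearComp (ContinuousLinearMap.id ℝ F)
      (innerSL ℝ))
  exact h1.add h2

theorem Tame.slice_contDiff {m : ℕ} {g : Eu d × Eu d → F} (hg : Tame m g) (f : 𝓢(Eu d, ℂ))
    (ξ : Eu d) : ContDiff ℝ ∞ (fun x => f x • g (ξ, x)) :=
  (f.smooth ⊤).smul (hg.1.comp (contDiff_const.prodMk contDiff_id))

theorem Tame.slice_bound {m : ℕ} {g : Eu d × Eu d → F} (hg : Tame m g) (l n : ℕ) :
    ∃ (s : Finset (ℕ × ℕ)) (C : ℝ), 0 ≤ C ∧ ∀ (f : 𝓢(Eu d, ℂ)) (ξ x : Eu d),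
      (1 + ‖x‖) ^ l * ‖iteratedFDeriv ℝ n (fun x => f x • g (ξ, x)) x‖ ≤
        C * (1 + ‖ξ‖) ^ m * s.sup (schwartzSeminormFamily ℂ (Eu d) ℂ) f := by
  obtain ⟨C, k, hC, H⟩ := hg.uniform n
  refine ⟨Finset.Iic (l + k, n), ∑ i ∈ Finset.range (n + 1), (n.choose i : ℝ) * 2 ^ (l + k) * C,
    by positivity, fun f ξ x => ?_⟩
  have hs : ∀ i, ‖iteratedFDeriv ℝ i (fun x => g (ξ, x)) x‖ ≤ ‖iteratedFDeriv ℝ i g (ξ, x)‖ := by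
    intro i
    have e : (fun x => g (ξ, x)) = (fun p => g ((ξ, 0) + p)) ∘ ContinuousLinearMap.inr ℝ (Eu d) (Eu d) := by
      ext x; simp
    rw [e, ContinuousLinearMap.iteratedFDeriv_comp_right (n := ∞) _
      (show ContDiff ℝ ∞ (fun p => g ((ξ, 0) + p)) from
        hg.1.comp (contDiff_const.add contDiff_id)) x (mod_cast le_top)]
    rw [iteratedFDeriv_comp_add_left]
    refine (ContinuousMultilinearMap.norm_compContinuousLinearMap_le _ _).trans ?_
    simp only [Finset.prod_const, Finset.card_univ, Fintype.card_fin]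
    have e2 : ‖ContinuousLinearMap.inr ℝ (Eu d) (Eu d)‖ ≤ 1 := ContinuousLinearMap.norm_inr_le_one ..
    have : (ξ, (0 : Eu d)) + ContinuousLinearMap.inr ℝ (Eu d) (Eu d) x = (ξ, x) := by simp
    rw [this]
    exact mul_le_of_le_one_right (norm_nonneg _) (pow_le_one₀ (norm_nonneg _) e2)
  have hS : 0 ≤ (Finset.Iic (l + k, n)).sup (schwartzSeminormFamily ℂ (Eu d) ℂ) f := apply_nonneg _ _
  have h0 := norm_iteratedFDeriv_smul_le (𝕜 := ℝ) (N := ∞) (f.smooth ⊤)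
    (hg.1.comp (contDiff_const.prodMk contDiff_id) : ContDiff ℝ ∞ (fun x => g (ξ, x))) x (n := n)
    (mod_cast le_top)
  calc _ ≤ (1 + ‖x‖) ^ l * ∑ i ∈ Finset.range (n + 1), (n.choose i : ℝ) *
        ‖iteratedFDeriv ℝ i f x‖ * (C * (1 + ‖ξ‖) ^ m * (1 + ‖x‖) ^ k) := by
        refine mul_le_mul_of_nonneg_left (h0.trans ?_) (by positivity)
        refine Finset.sum_le_sum fun i hi => ?_
        exact mul_le_mul_of_nonneg_left ((hs _).trans (H _ (by omega) _)) (by positivity)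
    _ = ∑ i ∈ Finset.range (n + 1), (n.choose i : ℝ) *
        ((1 + ‖x‖) ^ (l + k) * ‖iteratedFDeriv ℝ i f x‖) * (C * (1 + ‖ξ‖) ^ m) := by
        rw [Finset.mul_sum]; congr 1; ext i; ring
    _ ≤ ∑ i ∈ Finset.range (n + 1), (n.choose i : ℝ) *
        (2 ^ (l + k) * (Finset.Iic (l + k, n)).sup (schwartzSeminormFamily ℂ (Eu d) ℂ) f) *
          (C * (1 + ‖ξ‖) ^ m) := by
        refine Finset.sum_le_sum fun i hi => ?_
        have hi' : i ≤ n := by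
          simp at hi
          omega
        have := SchwartzMap.one_add_le_sup_seminorm_apply (𝕜 := ℂ) (m := (l + k, n)) le_rfl
          hi' f x
        exact mul_le_mul_of_nonneg_right (mul_le_mul_of_nonneg_left this (by positivity))
          (by positivity)
    _ = _ := by
        rw [Finset.sum_mul, Finset.sum_mul]; congr 1; ext i; ring

theorem Tame.osc_decay {m : ℕ} {g : Eu d × Eu d → F} (hg : Tame m g) (k : ℕ) :
    ∃ (s : Finset (ℕ × ℕ)) (C : ℝ), 0 ≤ C ∧ ∀ (f : 𝓢(Eu d, ℂ)) (ξ : Eu d),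
      ‖ξ‖ ^ k * ‖osc g f ξ‖ ≤ C * s.sup (schwartzSeminormFamily ℂ (Eu d) ℂ) f := by
  let r : ℕ := (volume : Measure (Eu d)).integrablePower
  have hI := Measure.integrable_pow_neg_integrablePower (volume : Measure (Eu d))
  choose s C hC H using fun n => hg.slice_bound r n
  have hint : ∀ (n : ℕ) (f : 𝓢(Eu d, ℂ)) (ξ x : Eu d),
      ‖iteratedFDeriv ℝ n (fun x => f x • g (ξ, x)) x‖ ≤
        (C n * (1 + ‖ξ‖) ^ m * (s n).sup (schwartzSeminormFamily ℂ (Eu d) ℂ) f) *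
          (1 + ‖x‖) ^ (-(r : ℝ)) := by
    intro n f ξ x
    rw [Real.rpow_neg (by positivity), Real.rpow_natCast, ← div_eq_mul_inv,
      le_div_iff₀ (by positivity), mul_comm]
    exact H n f ξ x
  have hIn : ∀ (n : ℕ) (f : 𝓢(Eu d, ℂ)) (ξ : Eu d),
      Integrable (fun x => iteratedFDeriv ℝ n (fun x => f x • g (ξ, x)) x) := by
    intro n f ξ
    refine (hI.const_mul _).mono' ?_ (Filter.Eventually.of_forall (hint n f ξ))
    exact ((hg.slice_contDiff f ξ).continuous_iteratedFDeriv
      (mod_cast le_top)).aestronglyMeasurable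
  let I : ℝ := ∫ x : Eu d, (1 + ‖x‖) ^ (-(r : ℝ))
  have hI0 : 0 ≤ I := integral_nonneg fun x => by positivity
  -- a bound for each power of `‖ξ‖`, with the loss `(1 + ‖ξ‖) ^ m`
  have key : ∀ j : ℕ, ∃ D : ℝ, ∃ S : Finset (ℕ × ℕ), 0 ≤ D ∧ ∀ (f : 𝓢(Eu d, ℂ)) (ξ : Eu d),
      ‖ξ‖ ^ j * ‖osc g f ξ‖ ≤ D * (1 + ‖ξ‖) ^ m *
        S.sup (schwartzSeminormFamily ℂ (Eu d) ℂ) f := by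
    intro j
    refine ⟨2 ^ j * ∑ n ∈ Finset.range (j + 1), C n * I, (Finset.range (j + 1)).biUnion s,
      mul_nonneg (by positivity) (Finset.sum_nonneg fun n _ => mul_nonneg (hC n) hI0),
      fun f ξ => ?_⟩
    have h0 := Real.pow_mul_norm_iteratedFDeriv_fourier_le (K := 0) (N := ⊤)
      (f := fun x => f x • g (ξ, x)) (hg.slice_contDiff f ξ) (fun k n hk _ => by
        have : k = 0 := by simpa using hk
        subst this
        simpa using (hIn n f ξ).norm) (k := 0) (n := j) (by simp) le_top ξ
    rw [norm_iteratedFDeriv_zero] at h0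
    refine h0.trans ?_
    simp only [pow_zero, one_mul, zero_add, Finset.range_one, CharP.cast_eq_zero, mul_zero]
    rw [mul_assoc, mul_assoc]
    refine mul_le_mul_of_nonneg_left ?_ (by positivity)
    rw [Finset.sum_product, Finset.sum_singleton, Finset.sum_mul]
    refine Finset.sum_le_sum fun n hn => ?_
    have hsup : (s n).sup (schwartzSeminormFamily ℂ (Eu d) ℂ) f ≤
        ((Finset.range (j + 1)).biUnion s).sup (schwartzSeminormFamily ℂ (Eu d) ℂ) f :=
      Finset.sup_mono (f := schwartzSeminormFamily ℂ (Eu d) ℂ)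
        (Finset.subset_biUnion_of_mem s hn) f
    have hCn := hC n
    calc _ ≤ ∫ x, (C n * (1 + ‖ξ‖) ^ m * (s n).sup (schwartzSeminormFamily ℂ (Eu d) ℂ) f) *
          (1 + ‖x‖) ^ (-(r : ℝ)) := by
          refine integral_mono (by simpa using (hIn n f ξ).norm) (hI.const_mul _) fun x => ?_
          simpa using hint n f ξ x
      _ = C n * I * ((1 + ‖ξ‖) ^ m * (s n).sup (schwartzSeminormFamily ℂ (Eu d) ℂ) f) := by
          rw [integral_const_mul]
          ring
      _ ≤ _ := by gcongr
  obtain ⟨D, S, hD, h1⟩ := key k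
  obtain ⟨D', S', hD', h2⟩ := key (k + m)
  refine ⟨S ∪ S', (D + D') * 2 ^ m, by positivity, fun f ξ => ?_⟩
  have b1 : S.sup (schwartzSeminormFamily ℂ (Eu d) ℂ) f ≤
      (S ∪ S').sup (schwartzSeminormFamily ℂ (Eu d) ℂ) f :=
    Finset.sup_mono (f := schwartzSeminormFamily ℂ (Eu d) ℂ) Finset.subset_union_left f
  have b2 : S'.sup (schwartzSeminormFamily ℂ (Eu d) ℂ) f ≤
      (S ∪ S').sup (schwartzSeminormFamily ℂ (Eu d) ℂ) f :=
    Finset.sup_mono (f := schwartzSeminormFamily ℂ (Eu d) ℂ) Finset.subset_union_right f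
  set T := (S ∪ S').sup (schwartzSeminormFamily ℂ (Eu d) ℂ) f
  have hT : 0 ≤ T := apply_nonneg _ _
  rcases le_total ‖ξ‖ 1 with h | h
  · calc _ ≤ D * (1 + ‖ξ‖) ^ m * S.sup (schwartzSeminormFamily ℂ (Eu d) ℂ) f := h1 f ξ
      _ ≤ (D + D') * (1 + 1) ^ m * T := by
          gcongr
          linarith
      _ = _ := by norm_num
  · have hp : 0 < ‖ξ‖ ^ m := by positivity
    refine le_of_mul_le_mul_left ?_ hp
    calc ‖ξ‖ ^ m * (‖ξ‖ ^ k * ‖osc g f ξ‖) = ‖ξ‖ ^ (k + m) * ‖osc g f ξ‖ := by ring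
      _ ≤ D' * (1 + ‖ξ‖) ^ m * S'.sup (schwartzSeminormFamily ℂ (Eu d) ℂ) f := h2 f ξ
      _ ≤ (D + D') * (‖ξ‖ + ‖ξ‖) ^ m * T := by
          gcongr
          linarith
      _ = _ := by
          rw [← two_mul, mul_pow]
          ring

theorem Tame.osc_hasFDerivAt {m : ℕ} {g : Eu d × Eu d → F} (hg : Tame m g) (f : 𝓢(Eu d, ℂ))
    (ξ₀ : Eu d) : HasFDerivAt (osc g f) (osc (oscD g) f ξ₀) ξ₀ := by
  let r : ℕ := (volume : Measure (Eu d)).integrablePower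
  have hI := Measure.integrable_pow_neg_integrablePower (volume : Measure (Eu d))
  have bound : ∀ {K : Type _} [NormedAddCommGroup K] [NormedSpace ℂ K] (h : Eu d × Eu d → K),
      Tame m h → ∃ D : ℝ, ∀ ξ x : Eu d, ξ ∈ Metric.ball ξ₀ 1 →
        ‖f x • h (ξ, x)‖ ≤ D * (1 + ‖x‖) ^ (-(r : ℝ)) := by
    intro K _ _ h hh
    obtain ⟨s, C, hC, H⟩ := hh.slice_bound r 0
    refine ⟨C * (1 + (‖ξ₀‖ + 1)) ^ m * s.sup (schwartzSeminormFamily ℂ (Eu d) ℂ) f,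
      fun ξ x hξ => ?_⟩
    have hξ' : ‖ξ‖ ≤ ‖ξ₀‖ + 1 := by
      have := norm_le_norm_add_norm_sub' ξ ξ₀
      have h2 : ‖ξ - ξ₀‖ < 1 := by simpa [dist_eq_norm] using hξ
      linarith
    have hS : 0 ≤ s.sup (schwartzSeminormFamily ℂ (Eu d) ℂ) f := apply_nonneg _ _
    rw [Real.rpow_neg (by positivity), Real.rpow_natCast, ← div_eq_mul_inv,
      le_div_iff₀ (by positivity), mul_comm]
    refine le_trans (by simpa using H f ξ x) ?_
    gcongr
  obtain ⟨D, hD⟩ := bound g hg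
  obtain ⟨D', hD'⟩ := bound _ hg.oscD_tame
  have hcont : ∀ {K : Type _} [NormedAddCommGroup K] [NormedSpace ℂ K] (h : Eu d × Eu d → K),
      Tame m h → ∀ ξ, Continuous (fun x => Real.fourierChar (-(inner ℝ x ξ)) • f x • h (ξ, x)) := by
    intro K _ _ h hh ξ
    exact (Real.continuous_fourierChar.comp (by fun_prop)).smul (hh.slice_contDiff f ξ).continuous
  have := hasFDerivAt_integral_of_dominated_of_fderiv_le (𝕜 := ℝ) (μ := (volume : Measure (Eu d)))
    (F := fun ξ x => Real.fourierChar (-(inner ℝ x ξ)) • f x • g (ξ, x))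
    (F' := fun ξ x => Real.fourierChar (-(inner ℝ x ξ)) • f x • oscD g (ξ, x))
    (bound := fun x => D' * (1 + ‖x‖) ^ (-(r : ℝ))) (x₀ := ξ₀)
    (Metric.ball_mem_nhds ξ₀ one_pos)
    (Filter.Eventually.of_forall fun ξ => (hcont g hg ξ).aestronglyMeasurable)
    ((hI.const_mul D).mono' (hcont g hg ξ₀).aestronglyMeasurable
      (Filter.Eventually.of_forall fun x => by
        simpa using hD ξ₀ x (Metric.mem_ball_self one_pos)))
    (hcont _ hg.oscD_tame ξ₀).aestronglyMeasurable
    (Filter.Eventually.of_forall fun x ξ hξ => (Circle.norm_smul _ _).trans_le (hD' ξ x hξ))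
    (hI.const_mul D')
    (Filter.Eventually.of_forall fun x ξ hξ => ?_)
  · exact this
  have e1 : HasFDerivAt (fun ξ : Eu d => g (ξ, x))
      ((fderiv ℝ g (ξ, x)).comp (ContinuousLinearMap.inl ℝ (Eu d) (Eu d))) ξ :=
    HasFDerivAt.comp (g := g) (f := fun e => (e, x)) ξ
      ((hg.1.differentiable (by simp)) (ξ, x)).hasFDerivAt (hasFDerivAt_prodMk_left ξ x)
  have e2 : HasFDerivAt (fun ξ : Eu d => (Real.fourierChar (-(inner ℝ x ξ)) : ℂ))
      ((innerSL ℝ x).smulRight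
        (-(2 * Real.pi * Complex.I) * (Real.fourierChar (-(inner ℝ x ξ)) : ℂ))) ξ := by
    have h3 : HasFDerivAt (fun ξ : Eu d => -(inner ℝ x ξ)) (-(innerSL ℝ x)) ξ :=
      (innerSL ℝ x).hasFDerivAt.neg
    have h4 := (Real.hasDerivAt_fourierChar (-(inner ℝ x ξ))).hasFDerivAt.comp ξ h3
    refine h4.congr_fderiv ?_
    ext v
    simp
  have e3 := e2.smul (e1.const_smul (f x))
  refine (e3.congr_fderiv ?_)
  ext v
  simp [oscD, Circle.smul_def, smul_smul]
  module

theorem Tame.osc_bound (k n : ℕ) : ∀ {F : Type} [NormedAddCommGroup F] [NormedSpace ℂ F] {m : ℕ}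
    {g : Eu d × Eu d → F}, Tame m g →
    ∃ (s : Finset (ℕ × ℕ)) (C : ℝ), 0 ≤ C ∧ ∀ (f : 𝓢(Eu d, ℂ)) (ξ : Eu d),
      ‖ξ‖ ^ k * ‖iteratedFDeriv ℝ n (osc g f) ξ‖ ≤
        C * s.sup (schwartzSeminormFamily ℂ (Eu d) ℂ) f := by
  induction n with
  | zero =>
    intro F _ _ m g hg
    simpa using hg.osc_decay k
  | succ n ih =>
    intro F _ _ m g hg
    obtain ⟨s, C, hC, h⟩ := ih hg.oscD_tame
    refine ⟨s, C, hC, fun f ξ => ?_⟩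
    have e : fderiv ℝ (osc g f) = osc (oscD g) f :=
      funext fun η => (hg.osc_hasFDerivAt f η).fderiv
    rw [← norm_iteratedFDeriv_fderiv, e]
    exact h f ξ

theorem Tame.osc_contDiff_nat (n : ℕ) : ∀ {F : Type} [NormedAddCommGroup F] [NormedSpace ℂ F]
    {m : ℕ} {g : Eu d × Eu d → F}, Tame m g → ∀ f : 𝓢(Eu d, ℂ), ContDiff ℝ n (osc g f) := by
  induction n with
  | zero =>
    intro F _ _ m g hg f
    exact contDiff_zero.2 (Differentiable.continuous (𝕜 := ℝ)
      fun ξ => (hg.osc_hasFDerivAt f ξ).differentiableAt)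
  | succ n ih =>
    intro F _ _ m g hg f
    have e : fderiv ℝ (osc g f) = osc (oscD g) f :=
      funext fun η => (hg.osc_hasFDerivAt f η).fderiv
    push_cast
    refine contDiff_succ_iff_fderiv.2
      ⟨fun ξ => (hg.osc_hasFDerivAt f ξ).differentiableAt, by simp, ?_⟩
    rw [e]
    exact ih hg.oscD_tame f

end Aux
section Symbols

open Complex

/-- The coordinate directions of `ℝᵈ × ℝᵈ`: `inl i` is the `i`-th coordinate of `x` and `inr j` is
the `j`-th coordinate of `ξ`. -/
noncomputable def dir {d : ℕ} : Fin d ⊕ Fin d → Eu d × Eu d :=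
  Sum.elim (fun i => (EuclideanSpace.single i 1, 0)) (fun j => (0, EuclideanSpace.single j 1))

/-- The class `S^δ` of symbols of order `δ`: smooth functions `a(x, ξ)` on `ℝᵈ × ℝᵈ` such that
each `|∂_x^α ∂_ξ^β a(x, ξ)| (1 + |ξ|)^(-δ + |β|)` is bounded. A partial derivative of order `n` is
given by the word `w` of the `n` coordinates in which one differentiates, and `|β|` is the number
of those that are coordinates of `ξ`. -/
structure Symbol (d : ℕ) (δ : ℝ) where
  toFun : Eu d → Eu d → ℂ
  smooth : ContDiff ℝ ∞ (Function.uncurry toFun)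
  bound : ∀ (n : ℕ) (w : Fin n → Fin d ⊕ Fin d), ∃ C : ℝ, ∀ x ξ : Eu d,
    ‖iteratedFDeriv ℝ n (Function.uncurry toFun) (x, ξ) (fun i => dir (w i))‖ ≤
      C * (1 + ‖ξ‖) ^ (δ - (Finset.univ.filter fun i => (w i).isRight).card)

variable {d : ℕ} {δ : ℝ}

instance : CoeFun (Symbol d δ) (fun _ => Eu d → Eu d → ℂ) := ⟨Symbol.toFun⟩

theorem exists_dir_coords (d : ℕ) : ∀ v : Eu d × Eu d, ∃ c : Fin d ⊕ Fin d → ℝ,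
    (∀ j, |c j| ≤ ‖v‖) ∧ v = ∑ j, c j • dir j := by
  intro v
  refine ⟨Sum.elim (fun i => v.1 i) (fun i => v.2 i), ?_, ?_⟩
  · rintro (i | i)
    · exact (PiLp.norm_apply_le v.1 i).trans (norm_fst_le v)
    · exact (PiLp.norm_apply_le v.2 i).trans (norm_snd_le v)
  · have h : ∀ x : Eu d, x = ∑ i, x i • EuclideanSpace.single i (1 : ℝ) := by
      intro x
      ext k
      simp [Pi.single_apply]
    rw [Fintype.sum_sum_type]
    ext1
    · simp [dir, Prod.fst_sum, ← h]
    · simp [dir, Prod.snd_sum, ← h]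

theorem norm_le_of_dir {n : ℕ} (f : ContinuousMultilinearMap ℝ (fun _ : Fin n => Eu d × Eu d) ℂ)
    (b : (Fin n → Fin d ⊕ Fin d) → ℝ) (hb : ∀ w, ‖f (fun i => dir (w i))‖ ≤ b w) :
    ‖f‖ ≤ ∑ w, b w := by
  refine f.opNorm_le_bound (Finset.sum_nonneg fun w _ => (norm_nonneg _).trans (hb w)) fun v => ?_
  choose c hc hv using exists_dir_coords d
  have e : f v = ∑ w : Fin n → Fin d ⊕ Fin d, (∏ i, c (v i) (w i)) • f (fun i => dir (w i)) := by
    conv_lhs => rw [show v = fun i => ∑ j, c (v i) j • dir j from funext fun i => hv (v i)]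
    rw [ContinuousMultilinearMap.map_sum]
    refine Finset.sum_congr rfl fun w _ => ?_
    rw [ContinuousMultilinearMap.map_smul_univ]
  rw [e, Finset.sum_mul]
  refine (norm_sum_le _ _).trans (Finset.sum_le_sum fun w _ => ?_)
  rw [norm_smul, mul_comm, norm_prod]
  refine mul_le_mul (hb w) ?_ (Finset.prod_nonneg fun i _ => norm_nonneg _)
    ((norm_nonneg _).trans (hb w))
  exact Finset.prod_le_prod (fun i _ => norm_nonneg _) fun i _ => hc (v i) (w i)

theorem Symbol.joint_bound (a : Symbol d δ) (n : ℕ) : ∃ C : ℝ, 0 ≤ C ∧ ∀ x ξ : Eu d,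
    ‖iteratedFDeriv ℝ n (Function.uncurry a) (x, ξ)‖ ≤ C * (1 + ‖ξ‖) ^ ⌈|δ|⌉₊ := by
  choose C hC using a.bound n
  refine ⟨∑ w, |C w|, Finset.sum_nonneg fun w _ => abs_nonneg _, fun x ξ => ?_⟩
  rw [Finset.sum_mul]
  refine norm_le_of_dir _ _ fun w => (hC w x ξ).trans ?_
  rw [← Real.rpow_natCast]
  have h1 : (1 : ℝ) ≤ 1 + ‖ξ‖ := by simp
  refine mul_le_mul (le_abs_self _) (Real.rpow_le_rpow_of_exponent_le h1 ?_) (by positivity)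
    (abs_nonneg _)
  have := Nat.le_ceil |δ|
  have := le_abs_self δ
  have : (0 : ℝ) ≤ (Finset.univ.filter fun i => (w i).isRight).card := Nat.cast_nonneg _
  linarith

theorem Symbol.tame (a : Symbol d δ) :
    Tame ⌈|δ|⌉₊ (fun p : Eu d × Eu d => a p.2 (-((2 * Real.pi) • p.1))) := by
  let L : Eu d × Eu d →L[ℝ] Eu d × Eu d :=
    (ContinuousLinearMap.snd ℝ (Eu d) (Eu d)).prod
      (-((2 * Real.pi) • ContinuousLinearMap.fst ℝ (Eu d) (Eu d)))
  have e : (fun p : Eu d × Eu d => a p.2 (-((2 * Real.pi) • p.1))) =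
      Function.uncurry a ∘ L := by
    ext p
    simp [L]
  rw [e]
  refine ⟨a.smooth.comp L.contDiff, fun n => ?_⟩
  obtain ⟨C, hC, H⟩ := a.joint_bound n
  refine ⟨‖L‖ ^ n * C * (2 * Real.pi) ^ ⌈|δ|⌉₊, 0, by positivity, fun p => ?_⟩
  rw [L.iteratedFDeriv_comp_right a.smooth p (mod_cast le_top)]
  refine (ContinuousMultilinearMap.norm_compContinuousLinearMap_le _ _).trans ?_
  simp only [Finset.prod_const, Finset.card_univ, Fintype.card_fin, pow_zero, mul_one]
  have h1 := H (L p).1 (L p).2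
  have h2 : 1 + ‖(L p).2‖ ≤ 2 * Real.pi * (1 + ‖p.1‖) := by
    have e1 : ‖(L p).2‖ = 2 * Real.pi * ‖p.1‖ := by
      simp [L, norm_smul, abs_of_pos Real.pi_pos]
    have := Real.pi_gt_three
    rw [e1]
    linarith
  calc _ ≤ C * (1 + ‖(L p).2‖) ^ ⌈|δ|⌉₊ * ‖L‖ ^ n := by
        gcongr
    _ ≤ C * (2 * Real.pi * (1 + ‖p.1‖)) ^ ⌈|δ|⌉₊ * ‖L‖ ^ n := by gcongr
    _ = _ := by
        rw [mul_pow]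
        ring

/-- For a test function `φ`, the function `ξ ↦ ∫ e^{2πi x·ξ} a(x, 2πξ) φ(x) dx`. -/
noncomputable def Symbol.pairing (a : Symbol d δ) (φ : 𝓢(Eu d, ℂ)) (ξ : Eu d) : ℂ :=
  ∫ x : Eu d, exp (2 * Real.pi * I * (inner ℝ x ξ : ℝ)) * a x ((2 * Real.pi) • ξ) * φ x

theorem Symbol.pairing_eq (a : Symbol d δ) (φ : 𝓢(Eu d, ℂ)) :
    a.pairing φ =
      fun ξ => osc (fun p : Eu d × Eu d => a p.2 (-((2 * Real.pi) • p.1))) φ (-ξ) := by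
  ext ξ
  simp only [Symbol.pairing, osc, Real.fourier_eq, Circle.smul_def, Real.fourierChar_apply]
  congr 1
  ext x
  simp
  ring_nf

theorem Symbol.pairing_integrable (a : Symbol d δ) (φ : 𝓢(Eu d, ℂ)) (ξ : Eu d) :
    Integrable fun x : Eu d =>
      exp (2 * Real.pi * I * (inner ℝ x ξ : ℝ)) * a x ((2 * Real.pi) • ξ) * φ x := by
  obtain ⟨C, hC, H⟩ := a.joint_bound 0
  refine ((φ.integrable (μ := volume)).norm.const_mul
    (C * (1 + ‖(2 * Real.pi) • ξ‖) ^ ⌈|δ|⌉₊)).mono' ?_ (Filter.Eventually.of_forall fun x => ?_)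
  · have h1 : Continuous fun x : Eu d => a x ((2 * Real.pi) • ξ) :=
      a.smooth.continuous.comp (by fun_prop : Continuous fun x : Eu d => (x, (2 * Real.pi) • ξ))
    have h2 : Continuous fun x : Eu d => (inner ℝ x ξ : ℝ) := by fun_prop
    have h3 : Continuous φ := φ.continuous
    exact (((by fun_prop : Continuous fun x : Eu d =>
      exp (2 * Real.pi * I * (inner ℝ x ξ : ℝ))).mul h1).mul h3).aestronglyMeasurable
  · have h := H x ((2 * Real.pi) • ξ)
    rw [norm_iteratedFDeriv_zero] at h
    have e : ‖exp (2 * Real.pi * I * (inner ℝ x ξ : ℝ))‖ = 1 := by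
      rw [show (2 * Real.pi * I * (inner ℝ x ξ : ℝ) : ℂ) =
        ((2 * Real.pi * (inner ℝ x ξ : ℝ) : ℝ) : ℂ) * I by push_cast; ring, norm_exp_ofReal_mul_I]
    rw [norm_mul, norm_mul, e, one_mul]
    gcongr
    exact h

/-- `Symbol.pairing` as a continuous linear map on Schwartz functions. -/
noncomputable def Symbol.pairingCLM (a : Symbol d δ) : 𝓢(Eu d, ℂ) →L[ℂ] 𝓢(Eu d, ℂ) :=
  SchwartzMap.mkCLM (𝕜 := ℂ) (σ := RingHom.id ℂ) a.pairing
    (fun φ ψ ξ => by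
      simp only [Symbol.pairing, add_apply, mul_add]
      exact integral_add (a.pairing_integrable φ ξ) (a.pairing_integrable ψ ξ))
    (fun c φ ξ => by
      simp only [Symbol.pairing, smul_apply, smul_eq_mul, RingHom.id_apply]
      rw [← integral_const_mul]
      congr 1
      ext x
      ring)
    (fun φ => by
      rw [a.pairing_eq]
      exact (contDiff_infty.2 fun n => Tame.osc_contDiff_nat n a.tame φ).comp contDiff_neg)
    (fun kn => by
      obtain ⟨s, C, hC, h⟩ := Tame.osc_bound kn.1 kn.2 a.tame
      refine ⟨s, C, hC, fun φ ξ => ?_⟩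
      have e := (-(ContinuousLinearMap.id ℝ (Eu d))).iteratedFDeriv_comp_right
        (contDiff_infty.2 fun n => Tame.osc_contDiff_nat n a.tame φ) ξ (i := kn.2)
        (mod_cast le_top)
      have e2 : a.pairing φ = osc (fun p : Eu d × Eu d => a p.2 (-((2 * Real.pi) • p.1))) φ ∘
          (-(ContinuousLinearMap.id ℝ (Eu d)) : Eu d →L[ℝ] Eu d) := by
        rw [a.pairing_eq]
        rfl
      rw [e2, e]
      refine le_trans ?_ (h φ (-ξ))
      rw [norm_neg]
      refine mul_le_mul_of_nonneg_left ?_ (by positivity)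
      refine (ContinuousMultilinearMap.norm_compContinuousLinearMap_le _ _).trans ?_
      rw [Finset.prod_const]
      refine mul_le_of_le_one_right (norm_nonneg _) (pow_le_one₀ (norm_nonneg _) ?_)
      rw [norm_neg]
      exact ContinuousLinearMap.norm_id_le)

/-- The transpose of `Op(a)` on Schwartz functions,
`y ↦ ∫ e^{-2πi y·ξ} (∫ e^{2πi x·ξ} a(x, 2πξ) φ(x) dx) dξ`, which is
`y ↦ (2π)^{-d} ∫ (∫ e^{i(x-y)·ξ} a(x, ξ) φ(x) dx) dξ`. -/
noncomputable def Symbol.transpose (a : Symbol d δ) : 𝓢(Eu d, ℂ) →L[ℂ] 𝓢(Eu d, ℂ) :=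
  fourierCLM ℂ 𝓢(Eu d, ℂ) ∘L a.pairingCLM

/-- The pseudodifferential operator `Op(a)` on tempered distributions,
`⟨Op(a) u, φ⟩ = ⟨u, Op(a)ᵗ φ⟩`. -/
noncomputable def Symbol.op (a : Symbol d δ) : 𝓢'(Eu d, ℂ) →L[ℂ] 𝓢'(Eu d, ℂ) :=
  PointwiseConvergenceCLM.precomp ℂ a.transpose

/-- On a Schwartz function `u`, `Op(a) u` is the function
`x ↦ (2π)^{-d} ∫ e^{i x·ξ} a(x, ξ) (∫ e^{-i y·ξ} u(y) dy) dξ`. -/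
theorem Symbol.op_schwartz (a : Symbol d δ) (u φ : 𝓢(Eu d, ℂ)) :
    a.op (u : 𝓢'(Eu d, ℂ)) φ = ∫ x : Eu d, φ x *
      ((2 * Real.pi : ℂ) ^ (-(d : ℤ)) * ∫ ξ : Eu d, exp (I * (inner ℝ x ξ : ℝ)) * a x ξ *
        ∫ y : Eu d, exp (-(I * (inner ℝ y ξ : ℝ))) * u y) := by
  have hF : ∀ ξ : Eu d, ∫ y : Eu d, exp (-(I * (inner ℝ y ((2 * Real.pi) • ξ) : ℝ))) * u y =
      𝓕 u ξ := by
    intro ξ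
    rw [SchwartzMap.fourier_coe, Real.fourier_eq]
    congr 1
    ext y
    rw [Circle.smul_def, Real.fourierChar_apply, inner_smul_right, smul_eq_mul]
    congr 2
    push_cast
    ring
  have hin : ∀ x : Eu d, ((2 * Real.pi : ℂ) ^ (-(d : ℤ)) * ∫ ξ : Eu d, exp (I * (inner ℝ x ξ : ℝ)) *
      a x ξ * ∫ y : Eu d, exp (-(I * (inner ℝ y ξ : ℝ))) * u y) =
      ∫ ξ : Eu d, exp (2 * Real.pi * I * (inner ℝ x ξ : ℝ)) * a x ((2 * Real.pi) • ξ) * 𝓕 u ξ := by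
    intro x
    have h := Measure.integral_comp_smul (volume : Measure (Eu d)) (fun ξ : Eu d =>
      exp (I * (inner ℝ x ξ : ℝ)) * a x ξ * ∫ y : Eu d, exp (-(I * (inner ℝ y ξ : ℝ))) * u y)
      (2 * Real.pi)
    rw [finrank_euclideanSpace_fin, abs_of_pos (by positivity)] at h
    simp only [hF] at h
    rw [Complex.real_smul] at h
    push_cast at h
    rw [zpow_neg, zpow_natCast, ← h]
    congr 1
    ext ξ
    congr 3
    rw [inner_smul_right]
    push_cast
    ring
  simp_rw [hin]
  have h1 : a.op (u : 𝓢'(Eu d, ℂ)) φ = ∫ ξ, a.pairing φ ξ * 𝓕 u ξ := by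
    change (u : 𝓢'(Eu d, ℂ)) (𝓕 (a.pairingCLM φ)) = _
    refine (SchwartzMap.toTemperedDistributionCLM_apply_apply volume u _).trans ?_
    exact SchwartzMap.integral_fourier_smul_eq (a.pairingCLM φ) u
  rw [h1]
  have h2 : Integrable (Function.uncurry fun (ξ x : Eu d) =>
      (exp (2 * Real.pi * I * (inner ℝ x ξ : ℝ)) * a x ((2 * Real.pi) • ξ) * φ x) * 𝓕 u ξ)
      ((volume : Measure (Eu d)).prod volume) := by
    obtain ⟨C, hC, H⟩ := a.joint_bound 0
    have hb : Integrable (fun ξ : Eu d => (1 + ‖ξ‖) ^ ⌈|δ|⌉₊ * ‖𝓕 u ξ‖) := by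
      have : ∀ N : ℕ, Integrable (fun ξ : Eu d => ‖ξ‖ ^ N * ‖𝓕 u ξ‖) :=
        fun N => (𝓕 u).integrable_pow_mul volume N
      simp_rw [add_comm (1 : ℝ), add_pow, one_pow, mul_one, Finset.sum_mul]
      refine integrable_finsetSum _ fun N _ => ?_
      refine ((this N).mul_const (((⌈|δ|⌉₊).choose N : ℕ) : ℝ)).congr
        (Filter.Eventually.of_forall fun ξ => ?_)
      ring
    refine ((hb.mul_prod (φ.integrable (μ := volume)).norm).const_mul
      (C * (2 * Real.pi) ^ ⌈|δ|⌉₊)).mono' ?_ (Filter.Eventually.of_forall fun p => ?_)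
    · have c1 : Continuous fun p : Eu d × Eu d => a p.2 ((2 * Real.pi) • p.1) :=
        a.smooth.continuous.comp
          (by fun_prop : Continuous fun p : Eu d × Eu d => (p.2, (2 * Real.pi) • p.1))
      have c2 : Continuous fun p : Eu d × Eu d =>
        exp (2 * Real.pi * I * (inner ℝ p.2 p.1 : ℝ)) := by fun_prop
      have c3 : Continuous fun p : Eu d × Eu d => φ p.2 := φ.continuous.comp continuous_snd
      have c4 : Continuous fun p : Eu d × Eu d => 𝓕 u p.1 := (𝓕 u).continuous.comp continuous_fst
      exact (((c2.mul c1).mul c3).mul c4).aestronglyMeasurable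
    · obtain ⟨ξ, x⟩ := p
      have h := H x ((2 * Real.pi) • ξ)
      rw [norm_iteratedFDeriv_zero] at h
      have e : ‖exp (2 * Real.pi * I * (inner ℝ x ξ : ℝ))‖ = 1 := by
        rw [show (2 * Real.pi * I * (inner ℝ x ξ : ℝ) : ℂ) =
          ((2 * Real.pi * (inner ℝ x ξ : ℝ) : ℝ) : ℂ) * I by push_cast; ring, norm_exp_ofReal_mul_I]
      have h5 : 1 + ‖(2 * Real.pi) • ξ‖ ≤ 2 * Real.pi * (1 + ‖ξ‖) := by
        rw [norm_smul, Real.norm_of_nonneg (by positivity)]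
        have := Real.pi_gt_three
        linarith
      simp only [Function.uncurry_apply_pair, norm_mul, e, one_mul]
      calc _ ≤ (C * (2 * Real.pi * (1 + ‖ξ‖)) ^ ⌈|δ|⌉₊) * ‖φ x‖ * ‖𝓕 u ξ‖ := by
            gcongr
            exact h.trans (by gcongr)
        _ = _ := by
            rw [mul_pow]
            ring
  calc _ = ∫ ξ : Eu d, ∫ x : Eu d,
        (exp (2 * Real.pi * I * (inner ℝ x ξ : ℝ)) * a x ((2 * Real.pi) • ξ) * φ x) * 𝓕 u ξ := by
        simp_rw [integral_mul_const]
        rfl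
    _ = _ := by
        rw [integral_integral_swap h2]
        congr 1
        ext x
        rw [← integral_const_mul]
        congr 1
        ext ξ
        ring

end Symbols

section Spaces

open scoped ENNReal LineDeriv

variable {d : ℕ}

/-- A finite complex Radon measure as the tempered distribution `φ ↦ ∫ φ dμ`, where the integral is
that against the Jordan decompositions of the real and the imaginary part of `μ`. (Each complex
Borel measure on `ℝᵈ` is finite and Radon.) -/
noncomputable def measureDistribution (μ : ComplexMeasure (Eu d)) : 𝓢'(Eu d, ℂ) :=
  ((ComplexMeasure.re μ).toJordanDecomposition.posPart.toTemperedDistribution -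
      (ComplexMeasure.re μ).toJordanDecomposition.negPart.toTemperedDistribution) +
    Complex.I • ((ComplexMeasure.im μ).toJordanDecomposition.posPart.toTemperedDistribution -
      (ComplexMeasure.im μ).toJordanDecomposition.negPart.toTemperedDistribution)

/-- The norm of `M₀`, the total mass of the variation of the measure. -/
noncomputable def totalVariationNorm (μ : ComplexMeasure (Eu d)) : ℝ≥0∞ := μ.variation Set.univ

/-- The `L¹` norm of a tempered distribution, which is `⊤` if the distribution is not given by an
integrable function. -/
noncomputable def l1Norm (u : 𝓢'(Eu d, ℂ)) : ℝ≥0∞ :=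
  ⨅ (f : Lp ℂ 1 (volume : Measure (Eu d))) (_ : u = (f : 𝓢'(Eu d, ℂ))), ‖f‖ₑ

/-- The norm of the Bessel potential space of order `s : ℝ` and exponent `1`; it is `⊤` outside of
the space. -/
noncomputable def besselNorm (s : ℝ) (u : 𝓢'(Eu d, ℂ)) : ℝ≥0∞ :=
  l1Norm (TemperedDistribution.besselPotential (Eu d) ℂ s u)

/-- The Gagliardo seminorm `∬ |f(x) - f(y)| / |x - y|^(d + σ) dx dy` of an integrable function,
as a function on tempered distributions (`⊤` if the distribution is not an integrable function). -/
noncomputable def gagliardoSeminorm (σ : ℝ) (u : 𝓢'(Eu d, ℂ)) : ℝ≥0∞ :=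
  ⨅ (f : Lp ℂ 1 (volume : Measure (Eu d))) (_ : u = (f : 𝓢'(Eu d, ℂ))),
    ∫⁻ x : Eu d, ∫⁻ y : Eu d, ‖f x - f y‖ₑ / ‖x - y‖ₑ ^ ((d : ℝ) + σ)

/-- The distributional partial derivative `∂_{w 0} ⋯ ∂_{w (n - 1)} u`. -/
noncomputable def partialDeriv {n : ℕ} (w : Fin n → Fin d) (u : 𝓢'(Eu d, ℂ)) : 𝓢'(Eu d, ℂ) :=
  ∂^{fun i => (EuclideanSpace.single (w i) 1 : Eu d)} u

/-- The Sobolev–Slobodeckij norm of order `s ≥ 0` and exponent `1`: the sum of the `L¹` norms of the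
partial derivatives of order at most `⌊s⌋` and, when `s` is not an integer, of the Gagliardo
seminorms of exponent `s - ⌊s⌋` of the partial derivatives of order `⌊s⌋`. It is `⊤` outside of
the space. -/
noncomputable def slobodeckijNorm (s : ℝ) (u : 𝓢'(Eu d, ℂ)) : ℝ≥0∞ :=
  (∑ n ∈ Finset.range (⌊s⌋₊ + 1), ∑ w : Fin n → Fin d, l1Norm (partialDeriv w u)) +
    if s = ⌊s⌋₊ then 0
    else ∑ w : Fin ⌊s⌋₊ → Fin d, gagliardoSeminorm (s - ⌊s⌋₊) (partialDeriv w u)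

/-- The `L¹` norm of the distribution given by `f` is the `L¹` norm of `f`. -/
theorem l1Norm_coe (f : Lp ℂ 1 (volume : Measure (Eu d))) :
    l1Norm (f : 𝓢'(Eu d, ℂ)) = ‖f‖ₑ := by
  refine le_antisymm (iInf_le_of_le f (iInf_le_of_le rfl le_rfl)) (le_iInf₂ fun g hg => ?_)
  have h : Function.Injective (Lp.toTemperedDistributionCLM ℂ (volume : Measure (Eu d)) 1) :=
    LinearMap.ker_eq_bot.1 (Lp.ker_toTemperedDistributionCLM_eq_bot (F := ℂ))
  rw [show f = g from h hg]

/-- The total variation of a complex measure is finite. -/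
theorem totalVariationNorm_lt_top (μ : ComplexMeasure (Eu d)) : totalVariationNorm μ < ⊤ := by
  have hs : ∀ ν : SignedMeasure (Eu d), ν.variation Set.univ < ⊤ := by
    intro ν
    rw [← SignedMeasure.totalVariation_eq_variation]
    exact measure_lt_top _ _
  refine lt_of_le_of_lt (VectorMeasure.variation_le_of_forall_enorm_le
    (m := (ComplexMeasure.re μ).variation + (ComplexMeasure.im μ).variation)
    (fun E hE => ?_) Set.univ) (ENNReal.add_lt_top.2 ⟨hs _, hs _⟩)
  have e : μ E = (((μ E).re : ℝ) : ℂ) + (((μ E).im : ℝ) : ℂ) * Complex.I :=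
    (Complex.re_add_im _).symm
  rw [e, Measure.add_apply]
  refine (enorm_add_le _ _).trans (add_le_add ?_ ?_)
  · refine le_trans (le_of_eq ?_)
      (VectorMeasure.enorm_measure_le_variation (ComplexMeasure.re μ) E)
    rw [← ofReal_norm, Complex.norm_real, ofReal_norm]
    rfl
  · refine le_trans (le_of_eq ?_)
      (VectorMeasure.enorm_measure_le_variation (ComplexMeasure.im μ) E)
    rw [← ofReal_norm, norm_mul, Complex.norm_I, mul_one, Complex.norm_real, ofReal_norm]
    rfl

end Spaces

end PsiDO

/-!
The proof is a Littlewood–Paley decomposition. The symbol `a` of order `m` is the sum of pieces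
`a_j(x, ξ) = a(x, ξ) lpPart j ξ`, which live where `1 + |ξ| ≈ 2 ^ j` and have size `2 ^ (j m)`.
Integration by parts in `ξ` shows that the kernel of `Op(a_j)` is at most
`C 2 ^ (j m) 2 ^ (j d) (1 + 2 ^ j |x - y|) ^ (-(d + 1))` (`DyadicFamily.ker_decay`), so that its
integral in `x` is `O(2 ^ (j m))` uniformly in `y`. By Schur's test `Op(a_j)` maps finite measures
to integrable functions with norm `O(2 ^ (j m))` (`Symbol.exists_piece`). The pieces of `Op(a) u`
sum to it weakly (`Symbol.tendsto_sum_piece`), and for `m < 0` they sum absolutely in `L¹`: this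
is the first claim (`Symbol.exists_integrable`).

The other claims measure what a derivative costs on each piece. Since
`∂_i Op(a) = Op(i ξ_i a + ∂_{x_i} a)` (`Symbol.lineDeriv_op`), derivatives of `Op(a) u` of order
`n` are operators of order `m + n`, and they are covered by the first claim as long as
`m + n < 0`.

* For the Bessel potentials `J^s`, the even powers are differential operators, so that `J^(2n)`
  takes `Op(a_j) u` to a function of norm `O(2 ^ (j (m + 2 n)))`. As `J^s` is itself an operator
  with a symbol of order `s`, its own decomposition gives an interpolation inequality
  `‖J^s f‖ ≤ C (2 ^ (j s) ‖f‖ + 2 ^ (j (s - 2 n)) ‖J^(2n) f‖)`, where the frequencies below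
  `2 ^ j` are estimated by `f` and the others by `J^(2n) f`
  (`exists_besselPotential_interpolation`). For `f = Op(a_j) u` the right side is
  `O(2 ^ (j (m + s)))`, which is summable if `s < -m` (`Symbol.exists_besselPotential`).
* For the Gagliardo seminorm, a translation by `z` moves `Op(a_j) u` by
  `O(2 ^ (j m) min(1, 2 ^ j |z|))` in `L¹`. The sum over `j` is `O(|z| ^ θ)` for each `θ ≤ 1` with
  `θ < -m` (`Symbol.exists_translate_bound`), and a `θ > σ` makes the integral of
  `|z| ^ (θ - d - σ)` over small `z` finite (`Symbol.exists_gagliardo`).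

Finite complex measures enter through `HasDensity`: a complex measure has an integrable density
with respect to a finite positive measure (`exists_hasDensity`), and integrable functions, on
which Bessel potentials of `Op(a) u` are computed, are covered by the same notion.
-/

namespace PsiDO

/-! ### Bounded families of symbols -/

section SymbolClasses

variable {d : ℕ} {ι : Type*}

/-- The partial derivative of a function on `ℝᵈ × ℝᵈ` in the `k`-th coordinate. -/
noncomputable def pd (k : Fin d ⊕ Fin d) (f : Eu d × Eu d → ℂ) : Eu d × Eu d → ℂ :=
  fun p => fderiv ℝ f p (dir k)

/-- The gain in the order of a symbol by a derivative in the `k`-th coordinate: `0` for the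
coordinates of `x` and `1` for those of `ξ`. -/
noncomputable def gain (k : Fin d ⊕ Fin d) : ℝ := Sum.elim (fun _ => 0) (fun _ => 1) k

/-- The symbol estimates of order `m`, for at most `n` derivatives, with constants that are uniform
over a family of functions. -/
def SymbolBound : ℕ → ℝ → (ι → Eu d × Eu d → ℂ) → Prop
  | 0, m, f => ∃ C : ℝ, ∀ i p, ‖f i p‖ ≤ C * (1 + ‖p.2‖) ^ m
  | n + 1, m, f => (∃ C : ℝ, ∀ i p, ‖f i p‖ ≤ C * (1 + ‖p.2‖) ^ m) ∧
      ∀ k, SymbolBound n (m - gain k) fun i => pd k (f i)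

/-- A family of functions that is bounded in the class of symbols of order `m`. -/
structure SymbolFamily (m : ℝ) (f : ι → Eu d × Eu d → ℂ) : Prop where
  smooth : ∀ i, ContDiff ℝ ∞ (f i)
  estimate : ∀ n, SymbolBound n m f

theorem pd_contDiff {f : Eu d × Eu d → ℂ} (hf : ContDiff ℝ ∞ f) (k : Fin d ⊕ Fin d) :
    ContDiff ℝ ∞ (pd k f) :=
  (hf.fderiv_right (m := ∞) (by simp)).clm_apply contDiff_const

theorem pd_add {f g : Eu d × Eu d → ℂ} (hf : ContDiff ℝ ∞ f) (hg : ContDiff ℝ ∞ g)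
    (k : Fin d ⊕ Fin d) : pd k (fun p => f p + g p) = fun p => pd k f p + pd k g p := by
  ext p
  simp only [pd]
  rw [fderiv_fun_add (hf.differentiable (by simp) p) (hg.differentiable (by simp) p)]
  rfl

theorem pd_mul {f g : Eu d × Eu d → ℂ} (hf : ContDiff ℝ ∞ f) (hg : ContDiff ℝ ∞ g)
    (k : Fin d ⊕ Fin d) :
    pd k (fun p => f p * g p) = fun p => pd k f p * g p + f p * pd k g p := by
  ext p
  simp only [pd]
  rw [fderiv_fun_mul (hf.differentiable (by simp) p) (hg.differentiable (by simp) p)]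
  simp
  ring

theorem pd_const (c : ℂ) (k : Fin d ⊕ Fin d) : pd k (fun _ => c) = fun _ => 0 := by
  ext p
  simp [pd]

theorem pd_inl_comp_snd {g : Eu d → ℂ} (hg : Differentiable ℝ g) (i : Fin d) :
    pd (Sum.inl i) (fun p => g p.2) = fun _ => 0 := by
  ext p
  have h : HasFDerivAt (fun p : Eu d × Eu d => g p.2) _ p :=
    (hg p.2).hasFDerivAt.comp p hasFDerivAt_snd
  simp [pd, h.fderiv, dir]

theorem pd_inr_comp_snd {g : Eu d → ℂ} (hg : Differentiable ℝ g) (i : Fin d) :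
    pd (Sum.inr i) (fun p => g p.2) =
      fun p => fderiv ℝ g p.2 (EuclideanSpace.single i 1) := by
  ext p
  have h : HasFDerivAt (fun p : Eu d × Eu d => g p.2) _ p :=
    (hg p.2).hasFDerivAt.comp p hasFDerivAt_snd
  simp [pd, h.fderiv, dir]

/-- The constant in the estimate without derivatives can be taken nonnegative. -/
theorem SymbolBound.bound {n : ℕ} {m : ℝ} {f : ι → Eu d × Eu d → ℂ} (h : SymbolBound n m f) :
    ∃ C : ℝ, 0 ≤ C ∧ ∀ i p, ‖f i p‖ ≤ C * (1 + ‖p.2‖) ^ m := by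
  have h' : ∃ C : ℝ, ∀ i p, ‖f i p‖ ≤ C * (1 + ‖p.2‖) ^ m := by
    cases n with
    | zero => exact h
    | succ n => exact h.1
  obtain ⟨C, hC⟩ := h'
  refine ⟨|C|, abs_nonneg C, fun i p => (hC i p).trans ?_⟩
  gcongr
  exact le_abs_self C

theorem SymbolBound.of_succ {n : ℕ} : ∀ {m : ℝ} {f : ι → Eu d × Eu d → ℂ},
    SymbolBound (n + 1) m f → SymbolBound n m f := by
  induction n with
  | zero => exact fun h => h.1
  | succ n ih => exact fun h => ⟨h.1, fun k => ih (h.2 k)⟩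

theorem SymbolBound.mono {n : ℕ} : ∀ {m m' : ℝ} {f : ι → Eu d × Eu d → ℂ}, m ≤ m' →
    SymbolBound n m f → SymbolBound n m' f := by
  have key : ∀ {m m' : ℝ} {f : ι → Eu d × Eu d → ℂ}, m ≤ m' → SymbolBound 0 m f →
      SymbolBound 0 m' f := by
    intro m m' f hm h
    obtain ⟨C, hC, h⟩ := h.bound
    refine ⟨C, fun i p => (h i p).trans ?_⟩
    gcongr
    simp
  induction n with
  | zero => exact key
  | succ n ih => exact fun hm h => ⟨key hm h.1, fun k => ih (by linarith) (h.2 k)⟩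

theorem SymbolBound.add {n : ℕ} : ∀ {m : ℝ} {f g : ι → Eu d × Eu d → ℂ},
    (∀ i, ContDiff ℝ ∞ (f i)) → (∀ i, ContDiff ℝ ∞ (g i)) →
    SymbolBound n m f → SymbolBound n m g → SymbolBound n m fun i p => f i p + g i p := by
  have key : ∀ {m : ℝ} {f g : ι → Eu d × Eu d → ℂ}, SymbolBound 0 m f → SymbolBound 0 m g →
      SymbolBound 0 m fun i p => f i p + g i p := by
    rintro m f g ⟨C, hC⟩ ⟨C', hC'⟩
    refine ⟨C + C', fun i p => (norm_add_le _ _).trans ?_⟩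
    rw [add_mul]
    exact add_le_add (hC i p) (hC' i p)
  induction n with
  | zero => exact fun _ _ => key
  | succ n ih =>
    intro m f g sf sg hf hg
    refine ⟨key hf.1 hg.1, fun k => ?_⟩
    simp_rw [pd_add (sf _) (sg _)]
    exact ih (fun i => pd_contDiff (sf i) k) (fun i => pd_contDiff (sg i) k) (hf.2 k) (hg.2 k)

/-- The Leibniz rule: the product of symbols of orders `m` and `m'` is one of order `m + m'`. -/
theorem SymbolBound.mul {n : ℕ} : ∀ {m m' : ℝ} {f g : ι → Eu d × Eu d → ℂ},
    (∀ i, ContDiff ℝ ∞ (f i)) → (∀ i, ContDiff ℝ ∞ (g i)) →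
    SymbolBound n m f → SymbolBound n m' g →
    SymbolBound n (m + m') fun i p => f i p * g i p := by
  have key : ∀ {n : ℕ} {m m' : ℝ} {f g : ι → Eu d × Eu d → ℂ}, SymbolBound n m f →
      SymbolBound n m' g → SymbolBound 0 (m + m') fun i p => f i p * g i p := by
    intro n m m' f g hf hg
    obtain ⟨C, hC, hf⟩ := hf.bound
    obtain ⟨C', hC', hg⟩ := hg.bound
    refine ⟨C * C', fun i p => ?_⟩
    rw [norm_mul, Real.rpow_add (by positivity)]
    calc _ ≤ (C * (1 + ‖p.2‖) ^ m) * (C' * (1 + ‖p.2‖) ^ m') := by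
          gcongr
          exacts [hf i p, hg i p]
      _ = _ := by ring
  induction n with
  | zero => exact fun _ _ => key
  | succ n ih =>
    intro m m' f g sf sg hf hg
    refine ⟨key hf hg, fun k => ?_⟩
    simp_rw [pd_mul (sf _) (sg _)]
    refine SymbolBound.add (fun i => (pd_contDiff (sf i) k).mul (sg i))
      (fun i => (sf i).mul (pd_contDiff (sg i) k)) ?_ ?_
    · have := ih (fun i => pd_contDiff (sf i) k) sg (hf.2 k) hg.of_succ
      rwa [show m - gain k + m' = m + m' - gain k by ring] at this
    · have := ih sf (fun i => pd_contDiff (sg i) k) hf.of_succ (hg.2 k)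
      rwa [show m + (m' - gain k) = m + m' - gain k by ring] at this

/-- The zero function is a symbol of each order; this is what the derivatives of a constant use. -/
theorem SymbolBound.const {n : ℕ} : ∀ {m : ℝ} (c : ℂ), (m = 0 ∨ c = 0) →
    SymbolBound n m (fun (_ : ι) (_ : Eu d × Eu d) => c) := by
  have key : ∀ {m : ℝ} (c : ℂ), (m = 0 ∨ c = 0) →
      SymbolBound 0 m (fun (_ : ι) (_ : Eu d × Eu d) => c) := by
    rintro m c h
    refine ⟨‖c‖, fun i p => ?_⟩
    rcases h with rfl | rfl <;> simp
  induction n with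
  | zero => exact key
  | succ n ih =>
    intro m c h
    refine ⟨key c h, fun k => ?_⟩
    simp_rw [pd_const]
    exact ih 0 (Or.inr rfl)

namespace SymbolFamily

variable {m m' : ℝ} {f g : ι → Eu d × Eu d → ℂ}

theorem pd (hf : SymbolFamily m f) (k : Fin d ⊕ Fin d) :
    SymbolFamily (m - gain k) fun i => pd k (f i) :=
  ⟨fun i => pd_contDiff (hf.smooth i) k, fun n => (hf.estimate (n + 1)).2 k⟩

theorem mono (hm : m ≤ m') (hf : SymbolFamily m f) : SymbolFamily m' f :=
  ⟨hf.smooth, fun n => (hf.estimate n).mono hm⟩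

theorem add (hf : SymbolFamily m f) (hg : SymbolFamily m g) :
    SymbolFamily m fun i p => f i p + g i p :=
  ⟨fun i => (hf.smooth i).add (hg.smooth i),
    fun n => (hf.estimate n).add hf.smooth hg.smooth (hg.estimate n)⟩

theorem mul (hf : SymbolFamily m f) (hg : SymbolFamily m' g) :
    SymbolFamily (m + m') fun i p => f i p * g i p :=
  ⟨fun i => (hf.smooth i).mul (hg.smooth i),
    fun n => (hf.estimate n).mul hf.smooth hg.smooth (hg.estimate n)⟩

theorem const (c : ℂ) : SymbolFamily 0 (fun (_ : ι) (_ : Eu d × Eu d) => c) :=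
  ⟨fun _ => contDiff_const, fun _ => SymbolBound.const c (Or.inl rfl)⟩

theorem const_mul (c : ℂ) (hf : SymbolFamily m f) : SymbolFamily m fun i p => c * f i p := by
  simpa using (const (ι := ι) c).mul hf

theorem comp_index {κ : Type*} (hf : SymbolFamily m f) (e : κ → ι) :
    SymbolFamily m fun i => f (e i) := by
  refine ⟨fun i => hf.smooth _, fun n => ?_⟩
  have key : ∀ (n : ℕ) (m : ℝ) (f : ι → Eu d × Eu d → ℂ), SymbolBound n m f →
      SymbolBound n m fun i => f (e i) := by
    intro n
    induction n with
    | zero =>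
      rintro m f ⟨C, hC⟩
      exact ⟨C, fun i p => hC _ p⟩
    | succ n ih =>
      rintro m f ⟨⟨C, hC⟩, h⟩
      exact ⟨⟨C, fun i p => hC _ p⟩, fun k => ih _ _ (h k)⟩
  exact key n m f (hf.estimate n)

/-- The coordinate functions `ξ_j` are symbols of order `1`. -/
theorem coord (j : Fin d) :
    SymbolFamily 1 (fun (_ : ι) (p : Eu d × Eu d) => ((p.2 j : ℝ) : ℂ)) := by
  have hs : ContDiff ℝ ∞ fun x : Eu d => ((x j : ℝ) : ℂ) :=
    (Complex.ofRealCLM.comp (EuclideanSpace.proj j : Eu d →L[ℝ] ℝ)).contDiff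
  have hz : ∃ C : ℝ, ∀ (i : ι) (p : Eu d × Eu d),
      ‖((p.2 j : ℝ) : ℂ)‖ ≤ C * (1 + ‖p.2‖) ^ (1 : ℝ) := by
    refine ⟨1, fun _ p => ?_⟩
    rw [Complex.norm_real, Real.rpow_one]
    have := PiLp.norm_apply_le p.2 j
    linarith
  refine ⟨fun _ => hs.comp contDiff_snd, fun n => ?_⟩
  cases n with
  | zero => exact hz
  | succ n =>
    refine ⟨hz, ?_⟩
    rintro (i | i)
    · simp_rw [pd_inl_comp_snd (hs.differentiable (by simp))]
      exact SymbolBound.const 0 (Or.inr rfl)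
    · have h : ∀ x : Eu d, fderiv ℝ (fun x : Eu d => ((x j : ℝ) : ℂ)) x =
          Complex.ofRealCLM.comp (EuclideanSpace.proj j : Eu d →L[ℝ] ℝ) := fun x =>
        (Complex.ofRealCLM.comp (EuclideanSpace.proj j : Eu d →L[ℝ] ℝ)).fderiv
      simp_rw [pd_inr_comp_snd (hs.differentiable (by simp)), h]
      exact SymbolBound.const _ (Or.inl (by simp [gain]))

end SymbolFamily

end SymbolClasses

/-! ### Symbols as families, dilates and Bessel symbols -/

section SymbolClasses

variable {d : ℕ} {ι : Type*}

theorem iteratedFDeriv_dir_succ {n : ℕ} {f : Eu d × Eu d → ℂ} (hf : ContDiff ℝ ∞ f)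
    (w : Fin (n + 1) → Fin d ⊕ Fin d) (p : Eu d × Eu d) :
    iteratedFDeriv ℝ (n + 1) f p (fun i => dir (w i)) =
      iteratedFDeriv ℝ n (pd (w (Fin.last n)) f) p (fun i => dir (w i.castSucc)) := by
  rw [iteratedFDeriv_succ_apply_right]
  exact (iteratedFDeriv_clm_apply_const_apply (n := ∞) (hf.fderiv_right (m := ∞) (by simp))
    (mod_cast le_top)).symm

theorem card_isRight_succ {n : ℕ} (w : Fin (n + 1) → Fin d ⊕ Fin d) :
    (((Finset.univ.filter fun i => (w i).isRight).card : ℕ) : ℝ) =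
      (Finset.univ.filter fun i : Fin n => (w i.castSucc).isRight).card +
        gain (w (Fin.last n)) := by
  rw [Finset.card_filter, Finset.card_filter, Fin.sum_univ_castSucc, Nat.cast_add]
  congr 1
  rcases w (Fin.last n) with i | i <;> simp [gain]

/-- The recursive estimates give those for words `w` of directions, where each `ξ`-direction in the
word lowers the order by `1`. -/
theorem SymbolBound.word {n : ℕ} : ∀ {m : ℝ} {f : ι → Eu d × Eu d → ℂ},
    (∀ i, ContDiff ℝ ∞ (f i)) → SymbolBound n m f → ∀ w : Fin n → Fin d ⊕ Fin d,
    ∃ C : ℝ, ∀ i p, ‖iteratedFDeriv ℝ n (f i) p (fun l => dir (w l))‖ ≤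
      C * (1 + ‖p.2‖) ^ (m - (Finset.univ.filter fun l => (w l).isRight).card) := by
  induction n with
  | zero =>
    rintro m f - ⟨C, hC⟩ w
    exact ⟨C, fun i p => by simpa using hC i p⟩
  | succ n ih =>
    intro m f sf h w
    obtain ⟨C, hC⟩ := ih (fun i => pd_contDiff (sf i) _) (h.2 (w (Fin.last n)))
      (fun l => w l.castSucc)
    refine ⟨C, fun i p => ?_⟩
    rw [iteratedFDeriv_dir_succ (sf i), card_isRight_succ]
    convert hC i p using 3
    ring

/-- The converse of `SymbolBound.word`. -/
theorem SymbolBound.of_word {n : ℕ} : ∀ {m : ℝ} {f : ι → Eu d × Eu d → ℂ},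
    (∀ i, ContDiff ℝ ∞ (f i)) →
    (∀ n' ≤ n, ∀ w : Fin n' → Fin d ⊕ Fin d,
      ∃ C : ℝ, ∀ i p, ‖iteratedFDeriv ℝ n' (f i) p (fun l => dir (w l))‖ ≤
        C * (1 + ‖p.2‖) ^ (m - (Finset.univ.filter fun l => (w l).isRight).card)) →
    SymbolBound n m f := by
  have key : ∀ {m : ℝ} {f : ι → Eu d × Eu d → ℂ}, (∀ w : Fin 0 → Fin d ⊕ Fin d,
      ∃ C : ℝ, ∀ i p, ‖iteratedFDeriv ℝ 0 (f i) p (fun l => dir (w l))‖ ≤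
        C * (1 + ‖p.2‖) ^ (m - (Finset.univ.filter fun l => (w l).isRight).card)) →
      ∃ C : ℝ, ∀ i p, ‖f i p‖ ≤ C * (1 + ‖p.2‖) ^ m := by
    intro m f h
    obtain ⟨C, hC⟩ := h finZeroElim
    exact ⟨C, fun i p => by simpa using hC i p⟩
  induction n with
  | zero => exact fun _ h => key (h 0 le_rfl)
  | succ n ih =>
    intro m f sf h
    refine ⟨key (h 0 (by simp)), fun k => ih (fun i => pd_contDiff (sf i) k) fun n' hn w => ?_⟩
    obtain ⟨C, hC⟩ := h (n' + 1) (by omega) (Fin.snoc (α := fun _ => Fin d ⊕ Fin d) w k)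
    refine ⟨C, fun i p => ?_⟩
    have := hC i p
    rw [iteratedFDeriv_dir_succ (sf i), card_isRight_succ] at this
    simp only [Fin.snoc_last, Fin.snoc_castSucc] at this
    convert this using 3
    ring

/-- A symbol, as a constant family. -/
theorem Symbol.family {δ : ℝ} (a : Symbol d δ) :
    SymbolFamily δ fun _ : ι => Function.uncurry a := by
  refine ⟨fun _ => a.smooth, fun n => SymbolBound.of_word (fun _ => a.smooth) fun n' _ w => ?_⟩
  obtain ⟨C, hC⟩ := a.bound n' w
  exact ⟨C, fun _ p => hC p.1 p.2⟩

/-- A member of a bounded family of symbols, as a symbol. -/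
noncomputable def SymbolFamily.toSymbol {m : ℝ} {f : ι → Eu d × Eu d → ℂ} (hf : SymbolFamily m f)
    (i : ι) : Symbol d m where
  toFun x ξ := f i (x, ξ)
  smooth := hf.smooth i
  bound n w := by
    obtain ⟨C, hC⟩ := (hf.estimate n).word hf.smooth w
    exact ⟨C, fun x ξ => hC i (x, ξ)⟩

@[ext]
theorem Symbol.ext {δ : ℝ} {a b : Symbol d δ} (h : ∀ x ξ, a x ξ = b x ξ) : a = b := by
  cases a
  cases b
  congr
  ext x ξ
  exact h x ξ

/-- Dilates `η(t ξ)` of a Schwartz function with `0 < t ≤ 1` are bounded in the class of symbols of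
order `0`, although each of them is of order `-∞`. -/
theorem SymbolFamily.dilates (η : 𝓢(Eu d, ℂ)) {t : ι → ℝ} (ht : ∀ i, 0 < t i)
    (ht' : ∀ i, t i ≤ 1) :
    SymbolFamily 0 fun i (p : Eu d × Eu d) => η (t i • p.2) := by
  have smooth : ∀ (η : 𝓢(Eu d, ℂ)) (t : ℝ), ContDiff ℝ ∞ fun x : Eu d => η (t • x) := fun η t =>
    (η.smooth ⊤).comp (contDiff_const_smul t)
  have zero : ∀ (k : ℕ) (η : 𝓢(Eu d, ℂ)), ∃ C : ℝ, ∀ (i : ι) (p : Eu d × Eu d),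
      ‖(t i : ℂ) ^ k * η (t i • p.2)‖ ≤ C * (1 + ‖p.2‖) ^ (-k : ℝ) := by
    intro k η
    refine ⟨2 ^ k * (Finset.Iic (k, 0)).sup (schwartzSeminormFamily ℂ (Eu d) ℂ) η,
      fun i p => ?_⟩
    have h := SchwartzMap.one_add_le_sup_seminorm_apply (𝕜 := ℂ) (m := (k, 0)) le_rfl
        le_rfl η (t i • p.2)
    rw [norm_iteratedFDeriv_zero] at h
    rw [Real.rpow_neg (by positivity), Real.rpow_natCast, ← div_eq_mul_inv,
      le_div_iff₀ (by positivity)]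
    refine le_trans ?_ h
    have h1 : t i * (1 + ‖p.2‖) ≤ 1 + ‖t i • p.2‖ := by
      rw [norm_smul, Real.norm_of_nonneg (ht i).le]
      linarith [ht' i]
    have h2 := ht i
    rw [norm_mul, norm_pow, Complex.norm_real, Real.norm_of_nonneg (ht i).le]
    calc _ = (t i * (1 + ‖p.2‖)) ^ k * ‖η (t i • p.2)‖ := by
          rw [mul_pow]
          ring
      _ ≤ _ := by gcongr
  -- each derivative in `ξ` gives a factor `t`, so the induction runs over `t ^ k * η (t ξ)`
  have key : ∀ (n k : ℕ) (η : 𝓢(Eu d, ℂ)),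
      SymbolBound n (-k : ℝ) fun i (p : Eu d × Eu d) => (t i : ℂ) ^ k * η (t i • p.2) := by
    intro n
    induction n with
    | zero => exact zero
    | succ n ih =>
      refine fun k η => ⟨zero k η, ?_⟩
      have hd : ∀ i, Differentiable ℝ fun x : Eu d => (t i : ℂ) ^ k * η (t i • x) := fun i =>
        (contDiff_const.mul (smooth η (t i))).differentiable (by simp)
      rintro (l | l)
      · simp_rw [pd_inl_comp_snd (hd _)]
        exact SymbolBound.const 0 (Or.inr rfl)
      · simp_rw [pd_inr_comp_snd (hd _)]
        have e : ∀ (i : ι) (x : Eu d), fderiv ℝ (fun x : Eu d => (t i : ℂ) ^ k * η (t i • x)) x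
            (EuclideanSpace.single l 1) = (t i : ℂ) ^ (k + 1) *
              (LineDeriv.lineDerivOp (EuclideanSpace.single l 1 : Eu d) η) (t i • x) := by
          intro i x
          have h1 : HasFDerivAt (fun x : Eu d => η (t i • x)) _ x :=
            (η.differentiableAt (x := t i • x)).hasFDerivAt.comp x
              ((hasFDerivAt_id x).const_smul (t i))
          rw [(h1.const_mul ((t i : ℂ) ^ k)).fderiv, SchwartzMap.lineDerivOp_apply_eq_fderiv]
          simp
          ring
        simp_rw [e]
        have := ih (k + 1) (LineDeriv.lineDerivOp (EuclideanSpace.single l 1 : Eu d) η)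
        convert this using 2
        simp [gain]
        ring
  refine ⟨fun i => (smooth η (t i)).comp contDiff_snd, fun n => ?_⟩
  simpa using key n 0 η

/-- Powers with any real exponent preserve comparability. -/
theorem rpow_le_of_comparable {x y a b : ℝ} (hx : 0 < x) (hy : 0 < y) (ha : 0 < a) (hb : 0 < b)
    (h1 : a * x ≤ y) (h2 : y ≤ b * x) (r : ℝ) : y ^ r ≤ (a ^ r + b ^ r) * x ^ r := by
  rw [add_mul, ← Real.mul_rpow ha.le hx.le, ← Real.mul_rpow hb.le hx.le]
  have ha' : 0 ≤ (a * x) ^ r := by positivity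
  have hb' : 0 ≤ (b * x) ^ r := by positivity
  rcases le_total 0 r with h | h
  · have := Real.rpow_le_rpow hy.le h2 h
    linarith
  · have := Real.rpow_le_rpow_of_nonpos (by positivity) h1 h
    linarith

/-- The symbol `(1 + |ξ/2π|²)^(s/2)` of the Bessel potential of order `s`. -/
noncomputable def besselFun (s : ℝ) (ξ : Eu d) : ℂ :=
  (((1 + ‖(2 * Real.pi)⁻¹ • ξ‖ ^ 2) ^ (s / 2) : ℝ) : ℂ)

theorem besselFun_contDiff (s : ℝ) : ContDiff ℝ ∞ (besselFun s : Eu d → ℂ) := by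
  refine Complex.ofRealCLM.contDiff.comp (ContDiff.rpow_const_of_ne ?_ fun x => by positivity)
  exact contDiff_const.add ((contDiff_const_smul _).norm_sq ℝ)

/-- The induction on the number of derivatives rests on
`∂_l ⟨ξ⟩ ^ s = (s / 4π²) ξ_l ⟨ξ⟩ ^ (s - 2)`, where `⟨ξ⟩² = 1 + |ξ / 2π|²`. -/
theorem SymbolFamily.bessel (s : ℝ) :
    SymbolFamily s fun (_ : ι) (p : Eu d × Eu d) => besselFun s p.2 := by
  have zero : ∀ s : ℝ, ∃ C : ℝ, ∀ (_ : ι) (p : Eu d × Eu d),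
      ‖besselFun s p.2‖ ≤ C * (1 + ‖p.2‖) ^ s := by
    intro s
    refine ⟨((8 * Real.pi ^ 2)⁻¹) ^ (s / 2) + 1 ^ (s / 2), fun _ p => ?_⟩
    have hpi := Real.pi_gt_three
    have e : (1 + ‖p.2‖) ^ s = ((1 + ‖p.2‖) ^ 2) ^ (s / 2) := by
      rw [← Real.rpow_natCast, ← Real.rpow_mul (by positivity)]
      congr 1
      push_cast
      ring
    have h0 : ‖(2 * Real.pi)⁻¹ • p.2‖ ^ 2 = ‖p.2‖ ^ 2 / (4 * Real.pi ^ 2) := by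
      rw [norm_smul, Real.norm_of_nonneg (by positivity)]
      field_simp
      ring
    rw [besselFun, Complex.norm_real, Real.norm_of_nonneg (by positivity), e]
    refine rpow_le_of_comparable (by positivity) (by positivity) (by positivity) one_pos ?_ ?_ _
    · rw [h0, inv_mul_le_iff₀ (by positivity)]
      have : 8 * Real.pi ^ 2 * (1 + ‖p.2‖ ^ 2 / (4 * Real.pi ^ 2)) =
        8 * Real.pi ^ 2 + 2 * ‖p.2‖ ^ 2 := by
        field_simp
        ring
      rw [this]
      nlinarith [sq_nonneg (‖p.2‖ - 1)]
    · rw [h0, one_mul]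
      have : ‖p.2‖ ^ 2 / (4 * Real.pi ^ 2) ≤ ‖p.2‖ ^ 2 :=
        div_le_self (by positivity) (by nlinarith)
      nlinarith [norm_nonneg p.2]
  refine ⟨fun _ => (besselFun_contDiff s).comp contDiff_snd, fun n => ?_⟩
  induction n generalizing s with
  | zero => exact zero s
  | succ n ih =>
    refine ⟨zero s, ?_⟩
    have hd : Differentiable ℝ (besselFun s : Eu d → ℂ) :=
      (besselFun_contDiff s).differentiable (by simp)
    rintro (l | l)
    · simp_rw [pd_inl_comp_snd hd]
      exact SymbolBound.const 0 (Or.inr rfl)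
    · have e : ∀ ξ : Eu d, fderiv ℝ (besselFun s) ξ (EuclideanSpace.single l 1) =
          (((s * (2 * Real.pi)⁻¹ ^ 2 : ℝ) : ℂ) * ((ξ l : ℝ) : ℂ)) * besselFun (s - 2) ξ := by
        intro ξ
        have h1 : HasFDerivAt (fun ξ : Eu d => 1 + ‖(2 * Real.pi)⁻¹ • ξ‖ ^ 2) _ ξ :=
          (((hasFDerivAt_id ξ).const_smul ((2 * Real.pi)⁻¹)).norm_sq).const_add 1
        have h2 := (h1.rpow_const (p := s / 2) (Or.inl (by positivity)))
        have h3 : HasFDerivAt (besselFun s) _ ξ := Complex.ofRealCLM.hasFDerivAt.comp ξ h2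
        rw [h3.fderiv]
        have e1 : (s - 2) / 2 = s / 2 - 1 := by ring
        simp [besselFun, EuclideanSpace.inner_single_right, e1]
        ring
      simp_rw [pd_inr_comp_snd hd, e]
      have h1 := SymbolBound.mul (n := n) (m := 1) (m' := s - 2) (fun _ => ?_)
        (fun _ => (besselFun_contDiff (s - 2)).comp contDiff_snd)
        (((SymbolFamily.coord (ι := ι) l).const_mul ((s * (2 * Real.pi)⁻¹ ^ 2 : ℝ) : ℂ)).estimate n)
        (ih (s - 2))
      · rwa [show 1 + (s - 2) = s - gain (Sum.inr l : Fin d ⊕ Fin d) by simp [gain]; ring] at h1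
      · exact ((SymbolFamily.coord (ι := Unit) l).const_mul _).smooth ()

end SymbolClasses

/-! ### The Littlewood–Paley partition of unity -/

section LittlewoodPaley

variable {d : ℕ}

/-- A smooth bump on `ℝᵈ` that is `1` for `|ξ| ≤ 1` and vanishes for `|ξ| ≥ 2`. -/
noncomputable def bump (d : ℕ) : ContDiffBump (0 : Eu d) := ⟨1, 2, one_pos, one_lt_two⟩

/-- The bump dilated to the ball of radius `2 ^ j`. -/
noncomputable def cutoff (j : ℕ) (ξ : Eu d) : ℂ := ((bump d (((2 : ℝ) ^ j)⁻¹ • ξ) : ℝ) : ℂ)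

/-- The Littlewood–Paley partition of unity, by functions that live where `|ξ| ≈ 2 ^ j`. -/
noncomputable def lpPart : ℕ → Eu d → ℂ
  | 0 => cutoff 0
  | j + 1 => fun ξ => cutoff (j + 1) ξ - cutoff j ξ

/-- The region `1 + |ξ| ≈ 2 ^ j`, which contains the support of `lpPart j`. -/
def shell (d j : ℕ) : Set (Eu d) := {ξ | (2 : ℝ) ^ j ≤ 2 * (1 + ‖ξ‖) ∧ 1 + ‖ξ‖ ≤ 3 * 2 ^ j}

theorem isClosed_shell (d j : ℕ) : IsClosed (shell d j) := by
  rw [shell, Set.ofPred_and]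
  exact (isClosed_le (by fun_prop) (by fun_prop)).inter (isClosed_le (by fun_prop) (by fun_prop))

theorem sum_lpPart (J : ℕ) (ξ : Eu d) :
    ∑ j ∈ Finset.range (J + 1), lpPart j ξ = cutoff J ξ := by
  induction J with
  | zero => simp [lpPart]
  | succ J ih =>
    rw [Finset.sum_range_succ, ih]
    simp [lpPart]

theorem cutoff_contDiff (j : ℕ) : ContDiff ℝ ∞ (cutoff j : Eu d → ℂ) :=
  Complex.ofRealCLM.contDiff.comp ((bump d).contDiff.comp (contDiff_const_smul _))

theorem norm_cutoff_le (j : ℕ) (ξ : Eu d) : ‖cutoff j ξ‖ ≤ 1 := by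
  rw [cutoff, Complex.norm_real, Real.norm_of_nonneg (bump d).nonneg]
  exact (bump d).le_one

theorem cutoff_eq_one {j : ℕ} {ξ : Eu d} (h : ‖ξ‖ ≤ 2 ^ j) : cutoff j ξ = 1 := by
  rw [cutoff, (bump d).one_of_mem_closedBall, Complex.ofReal_one]
  rw [mem_closedBall_zero_iff, norm_smul, norm_inv, norm_pow, Real.norm_ofNat,
    inv_mul_le_iff₀ (by positivity)]
  simpa [bump] using h

theorem cutoff_eq_zero {j : ℕ} {ξ : Eu d} (h : 2 * 2 ^ j ≤ ‖ξ‖) : cutoff j ξ = 0 := by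
  rw [cutoff, (bump d).zero_of_le_dist, Complex.ofReal_zero]
  rw [dist_zero_right, norm_smul, norm_inv, norm_pow, Real.norm_ofNat,
    le_inv_mul_iff₀ (by positivity), mul_comm]
  simpa [bump] using h

theorem tendsto_cutoff (ξ : Eu d) :
    Filter.Tendsto (fun J => cutoff J ξ) Filter.atTop (nhds 1) := by
  obtain ⟨N, hN⟩ := pow_unbounded_of_one_lt ‖ξ‖ (one_lt_two (α := ℝ))
  refine tendsto_const_nhds.congr' ?_
  filter_upwards [Filter.eventually_ge_atTop N] with J hJ
  exact (cutoff_eq_one (hN.le.trans (pow_le_pow_right₀ one_le_two hJ))).symm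

theorem lpPart_eq_zero {j : ℕ} {ξ : Eu d} (h : ξ ∉ shell d j) : lpPart j ξ = 0 := by
  contrapose! h
  have hξ := norm_nonneg ξ
  cases j with
  | zero =>
    have h1 : ‖ξ‖ < 2 * 2 ^ 0 := by
      contrapose! h
      exact cutoff_eq_zero h
    constructor <;> norm_num at h1 ⊢ <;> linarith
  | succ j =>
    have hp : (1 : ℝ) ≤ 2 ^ j := one_le_pow₀ one_le_two
    have h1 : ‖ξ‖ < 2 * 2 ^ (j + 1) := by
      contrapose! h
      have h2 : 2 * 2 ^ j ≤ ‖ξ‖ := by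
        rw [pow_succ] at h
        linarith
      simp [lpPart, cutoff_eq_zero h, cutoff_eq_zero h2]
    have h2 : 2 ^ j < ‖ξ‖ := by
      contrapose! h
      have h3 : ‖ξ‖ ≤ 2 ^ (j + 1) := by
        rw [pow_succ]
        linarith
      simp [lpPart, cutoff_eq_one h, cutoff_eq_one h3]
    rw [pow_succ] at h1
    constructor <;> rw [pow_succ] <;> linarith

/-- A sequence of symbols is bounded if it is so without its first term. -/
theorem SymbolFamily.of_nat {m : ℝ} {f : ℕ → Eu d × Eu d → ℂ}
    (h0 : SymbolFamily m fun _ : Unit => f 0) (h1 : SymbolFamily m fun j => f (j + 1)) :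
    SymbolFamily m f := by
  have zero : ∀ (n : ℕ) (m : ℝ) (f : ℕ → Eu d × Eu d → ℂ), SymbolBound n m (fun _ : Unit => f 0) →
      SymbolBound n m (fun j => f (j + 1)) → ∃ C : ℝ, ∀ i p, ‖f i p‖ ≤ C * (1 + ‖p.2‖) ^ m := by
    intro n m f h0 h1
    obtain ⟨C, hC, h0⟩ := h0.bound
    obtain ⟨C', hC', h1⟩ := h1.bound
    refine ⟨C + C', fun i p => ?_⟩
    have hp : 0 ≤ (1 + ‖p.2‖) ^ m := by positivity
    rw [add_mul]
    rcases i with - | i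
    · exact (h0 () p).trans (le_add_of_nonneg_right (by positivity))
    · exact (h1 i p).trans (le_add_of_nonneg_left (by positivity))
  have key : ∀ (n : ℕ) (m : ℝ) (f : ℕ → Eu d × Eu d → ℂ), SymbolBound n m (fun _ : Unit => f 0) →
      SymbolBound n m (fun j => f (j + 1)) → SymbolBound n m f := by
    intro n
    induction n with
    | zero => exact zero 0
    | succ n ih =>
      exact fun m f h0 h1 => ⟨zero _ m f h0 h1, fun k => ih _ _ (h0.2 k) (h1.2 k)⟩
  refine ⟨fun i => ?_, fun n => key n m f (h0.estimate n) (h1.estimate n)⟩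
  rcases i with - | i
  exacts [h0.smooth (), h1.smooth i]

theorem SymbolFamily.lpPart :
    SymbolFamily 0 fun j (p : Eu d × Eu d) => PsiDO.lpPart j p.2 := by
  have hc : HasCompactSupport fun ξ : Eu d => ((bump d ξ : ℝ) : ℂ) :=
    (bump d).hasCompactSupport.comp_left Complex.ofReal_zero
  let η : 𝓢(Eu d, ℂ) := hc.toSchwartzMap (Complex.ofRealCLM.contDiff.comp (bump d).contDiff)
  have h : SymbolFamily 0 fun j (p : Eu d × Eu d) => cutoff j p.2 :=
    SymbolFamily.dilates (ι := ℕ) η (t := fun j => ((2 : ℝ) ^ j)⁻¹) (fun j => by positivity)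
      (fun j => inv_le_one_of_one_le₀ (one_le_pow₀ one_le_two))
  refine SymbolFamily.of_nat (h.comp_index fun _ : Unit => 0) ?_
  have := (h.comp_index Nat.succ).add (h.const_mul (-1))
  simpa [PsiDO.lpPart, sub_eq_add_neg] using this

/-- A bounded family of symbols of order `m`, of which the `j`-th one lives where
`1 + |ξ| ≈ 2 ^ j`. -/
structure DyadicFamily (m : ℝ) (c : ℕ → Eu d × Eu d → ℂ) : Prop extends SymbolFamily m c where
  support : ∀ j p, p.2 ∉ shell d j → c j p = 0

namespace DyadicFamily

variable {m : ℝ} {c : ℕ → Eu d × Eu d → ℂ}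

theorem pd (hc : DyadicFamily m c) (k : Fin d ⊕ Fin d) :
    DyadicFamily (m - gain k) fun j => pd k (c j) := by
  refine ⟨hc.toSymbolFamily.pd k, fun j p hp => ?_⟩
  have : c j =ᶠ[nhds p] fun _ => 0 := by
    filter_upwards [continuous_snd.continuousAt.preimage_mem_nhds
      ((isClosed_shell d j).isOpen_compl.mem_nhds hp)] with q hq
    exact hc.support j q hq
  rw [PsiDO.pd, this.fderiv_eq]
  simp

theorem of_symbol {b : Eu d × Eu d → ℂ} (hb : SymbolFamily m fun _ : ℕ => b) :
    DyadicFamily m fun j p => b p * lpPart j p.2 := by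
  refine ⟨by simpa using hb.mul SymbolFamily.lpPart, fun j p hp => ?_⟩
  simp [lpPart_eq_zero hp]

/-- On its shell `1 + |ξ|` is comparable to `2 ^ j`, so the weight `(1 + |ξ|) ^ m` may be replaced
by `2 ^ (j m)`, whatever the sign of `m`. -/
theorem bound (hc : DyadicFamily m c) :
    ∃ C : ℝ, 0 ≤ C ∧ ∀ j p, ‖c j p‖ ≤ C * ((2 : ℝ) ^ j) ^ m := by
  obtain ⟨C, hC, h⟩ := (hc.estimate 0).bound
  refine ⟨C * ((1 / 2) ^ m + 3 ^ m), by positivity, fun j p => ?_⟩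
  by_cases hp : p.2 ∈ shell d j
  · refine (h j p).trans ?_
    rw [mul_assoc]
    refine mul_le_mul_of_nonneg_left ?_ hC
    exact rpow_le_of_comparable (by positivity) (by positivity) (by norm_num) (by norm_num)
      (by linarith [hp.1]) hp.2 m
  · rw [hc.support j p hp, norm_zero]
    positivity

end DyadicFamily

end LittlewoodPaley

/-! ### Kernels of the dyadic pieces -/

section Kernels

open Complex

variable {d : ℕ}

/-- The Schwartz kernel `∫ e^{2πi (x-y)·ξ} c(x, 2πξ) dξ` of the operator with symbol `c`, where `c`
has compact support in `ξ`. -/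
noncomputable def ker (c : Eu d × Eu d → ℂ) (x y : Eu d) : ℂ :=
  ∫ ξ : Eu d, exp (2 * Real.pi * I * (inner ℝ (x - y) ξ : ℝ)) * c (x, (2 * Real.pi) • ξ)

theorem norm_exp_two_pi_inner (z ξ : Eu d) : ‖exp (2 * Real.pi * I * (inner ℝ z ξ : ℝ))‖ = 1 := by
  rw [show (2 * Real.pi * I * (inner ℝ z ξ : ℝ) : ℂ) =
    ((2 * Real.pi * (inner ℝ z ξ : ℝ) : ℝ) : ℂ) * I by push_cast; ring, norm_exp_ofReal_mul_I]

theorem norm_le_norm_two_pi_smul (ξ : Eu d) : ‖ξ‖ ≤ ‖(2 * Real.pi) • ξ‖ := by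
  rw [norm_smul, Real.norm_of_nonneg (by positivity)]
  have := Real.pi_gt_three
  nlinarith [norm_nonneg ξ]

theorem ker_eq_setIntegral {c : Eu d × Eu d → ℂ} {R : ℝ} (hR : ∀ p, R < ‖p.2‖ → c p = 0)
    (x y : Eu d) : ker c x y = ∫ ξ in Metric.closedBall (0 : Eu d) R,
      exp (2 * Real.pi * I * (inner ℝ (x - y) ξ : ℝ)) * c (x, (2 * Real.pi) • ξ) := by
  refine (setIntegral_eq_integral_of_forall_compl_eq_zero fun ξ hξ => ?_).symm
  rw [mem_closedBall_zero_iff, not_le] at hξ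
  rw [hR (x, (2 * Real.pi) • ξ) (hξ.trans_le (norm_le_norm_two_pi_smul ξ)), mul_zero]

theorem norm_ker_le {c : Eu d × Eu d → ℂ} {R B : ℝ} (hR0 : 0 ≤ R)
    (hR : ∀ p, R < ‖p.2‖ → c p = 0) (hB : ∀ p, ‖c p‖ ≤ B) (x y : Eu d) :
    ‖ker c x y‖ ≤ B * (R ^ d * volume.real (Metric.ball (0 : Eu d) 1)) := by
  have h : volume.real (Metric.closedBall (0 : Eu d) R) =
      R ^ d * volume.real (Metric.ball (0 : Eu d) 1) := by
    rw [Measure.addHaar_real_closedBall _ _ hR0, finrank_euclideanSpace_fin]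
  rw [ker_eq_setIntegral hR, ← h]
  refine norm_setIntegral_le_of_norm_le_const measure_closedBall_lt_top fun ξ _ => ?_
  rw [norm_mul, norm_exp_two_pi_inner, one_mul]
  exact hB _

theorem continuous_ker_integrand {c : Eu d × Eu d → ℂ} (hc : Continuous c) :
    Continuous fun q : (Eu d × Eu d) × Eu d =>
      exp (2 * Real.pi * I * (inner ℝ (q.1.1 - q.1.2) q.2 : ℝ)) *
        c (q.1.1, (2 * Real.pi) • q.2) := by
  have h1 : Continuous fun q : (Eu d × Eu d) × Eu d => c (q.1.1, (2 * Real.pi) • q.2) :=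
    hc.comp (by fun_prop)
  have h2 : Continuous fun q : (Eu d × Eu d) × Eu d => (inner ℝ (q.1.1 - q.1.2) q.2 : ℝ) := by
    fun_prop
  fun_prop

theorem continuous_ker {c : Eu d × Eu d → ℂ} (hc : Continuous c) {R : ℝ}
    (hR : ∀ p, R < ‖p.2‖ → c p = 0) : Continuous fun p : Eu d × Eu d => ker c p.1 p.2 := by
  simp_rw [ker_eq_setIntegral hR]
  exact continuous_parametric_integral_of_continuous (μ := volume)
    (f := fun (p : Eu d × Eu d) ξ => exp (2 * Real.pi * I * (inner ℝ (p.1 - p.2) ξ : ℝ)) *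
      c (p.1, (2 * Real.pi) • ξ)) (continuous_ker_integrand hc) (isCompact_closedBall 0 R)

theorem integrable_of_zero_of_norm_lt {g : Eu d → ℂ} (hg : Continuous g) {R : ℝ}
    (hR : ∀ ξ, R < ‖ξ‖ → g ξ = 0) : Integrable g := by
  refine hg.integrable_of_hasCompactSupport (HasCompactSupport.of_support_subset_isCompact
    (isCompact_closedBall 0 R) fun ξ hξ => ?_)
  rw [mem_closedBall_zero_iff]
  by_contra! h
  exact hξ (hR ξ h)

theorem integrable_ker_integrand {c : Eu d × Eu d → ℂ} (hc : Continuous c) {R : ℝ}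
    (hR : ∀ p, R < ‖p.2‖ → c p = 0) (x y : Eu d) : Integrable fun ξ : Eu d =>
      exp (2 * Real.pi * I * (inner ℝ (x - y) ξ : ℝ)) * c (x, (2 * Real.pi) • ξ) := by
  refine integrable_of_zero_of_norm_lt (R := R) ?_ fun ξ hξ => ?_
  · have h1 : Continuous fun ξ : Eu d => c (x, (2 * Real.pi) • ξ) := hc.comp (by fun_prop)
    fun_prop
  rw [hR (x, (2 * Real.pi) • ξ) (hξ.trans_le (norm_le_norm_two_pi_smul ξ)), mul_zero]

theorem pd_eq_zero_of_norm_lt {c : Eu d × Eu d → ℂ} {R : ℝ} (hR : ∀ p, R < ‖p.2‖ → c p = 0)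
    (k : Fin d ⊕ Fin d) (p : Eu d × Eu d) (hp : R < ‖p.2‖) : pd k c p = 0 := by
  have : c =ᶠ[nhds p] fun _ => 0 := by
    filter_upwards [(isOpen_lt continuous_const continuous_snd.norm).mem_nhds hp] with q hq
    exact hR q hq
  rw [pd, this.fderiv_eq]
  simp

/-- Integration by parts: a derivative of the symbol in `ξ` multiplies the kernel by a component of
`x - y`. -/
theorem ker_pd_inr {c : Eu d × Eu d → ℂ} (hc : ContDiff ℝ ∞ c) {R : ℝ}
    (hR : ∀ p, R < ‖p.2‖ → c p = 0) (i : Fin d) (x y : Eu d) :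
    ker (pd (Sum.inr i) c) x y = -(I * ((x - y) i : ℝ)) * ker c x y := by
  let f : Eu d → ℂ := fun ξ => exp (2 * Real.pi * I * (inner ℝ (x - y) ξ : ℝ))
  let g : Eu d → ℂ := fun ξ => c (x, (2 * Real.pi) • ξ)
  let e : Eu d := EuclideanSpace.single i 1
  have hf : ∀ ξ, HasFDerivAt f
      ((2 * Real.pi * I * f ξ) • (ofRealCLM.comp (innerSL ℝ (x - y)))) ξ := by
    intro ξ
    have h1 : HasFDerivAt (fun ξ : Eu d => ((inner ℝ (x - y) ξ : ℝ) : ℂ))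
        (ofRealCLM.comp (innerSL ℝ (x - y))) ξ :=
      (ofRealCLM.comp (innerSL ℝ (x - y))).hasFDerivAt
    refine (h1.const_mul (2 * Real.pi * I)).cexp.congr_fderiv ?_
    ext v
    simp [f]
    ring
  have hf' : ∀ ξ, fderiv ℝ f ξ e = 2 * Real.pi * I * ((x - y) i : ℝ) * f ξ := by
    intro ξ
    rw [(hf ξ).fderiv]
    simp [e, EuclideanSpace.inner_single_right]
    ring
  have hg : ∀ ξ, HasFDerivAt g ((fderiv ℝ c (x, (2 * Real.pi) • ξ)).comp
      ((ContinuousLinearMap.inr ℝ (Eu d) (Eu d)).comp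
        ((2 * Real.pi) • ContinuousLinearMap.id ℝ (Eu d)))) ξ := by
    intro ξ
    have h1 : HasFDerivAt (fun ξ : Eu d => (2 * Real.pi) • ξ)
        ((2 * Real.pi) • ContinuousLinearMap.id ℝ (Eu d)) ξ :=
      (hasFDerivAt_id ξ).const_smul (2 * Real.pi)
    exact HasFDerivAt.comp (f := fun ξ : Eu d => (x, (2 * Real.pi) • ξ)) ξ
      (hc.differentiable (by simp) _).hasFDerivAt
      ((hasFDerivAt_prodMk_right x ((2 * Real.pi) • ξ)).comp ξ h1)
  have hg' : ∀ ξ, fderiv ℝ g ξ e = 2 * Real.pi * pd (Sum.inr i) c (x, (2 * Real.pi) • ξ) := by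
    intro ξ
    rw [(hg ξ).fderiv]
    simp [pd, dir, e]
  have i1 := integrable_ker_integrand hc.continuous hR x y
  have i2 := integrable_ker_integrand (pd_contDiff hc (Sum.inr i)).continuous
    (pd_eq_zero_of_norm_lt hR (Sum.inr i)) x y
  have h := integral_mul_fderiv_eq_neg_fderiv_mul_of_integrable (μ := volume)
    (f := f) (g := g) (v := e) ?_ ?_ i1 (fun ξ _ => (hf ξ).differentiableAt)
    (fun ξ _ => (hg ξ).differentiableAt)
  · simp_rw [hf', hg'] at h
    have e1 : ∀ ξ, f ξ * (2 * Real.pi * pd (Sum.inr i) c (x, (2 * Real.pi) • ξ)) =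
        2 * Real.pi * (f ξ * pd (Sum.inr i) c (x, (2 * Real.pi) • ξ)) := fun ξ => by ring
    have e2 : ∀ ξ, 2 * Real.pi * I * ((x - y) i : ℝ) * f ξ * g ξ =
        2 * Real.pi * I * ((x - y) i : ℝ) * (f ξ * g ξ) := fun ξ => by ring
    simp_rw [e1, e2, integral_const_mul] at h
    have hpi : (2 * Real.pi : ℂ) ≠ 0 := by simp [Real.pi_ne_zero]
    refine mul_left_cancel₀ hpi (h.trans ?_)
    simp only [ker, f, g]
    ring
  · simp_rw [hf', mul_assoc _ (f _)]
    exact i1.const_mul _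
  · simp_rw [hg']
    refine (i2.const_mul (2 * Real.pi)).congr (Filter.Eventually.of_forall fun ξ => ?_)
    simp only [f]
    ring

theorem sum_smul_single (z : Eu d) : z = ∑ i, z i • EuclideanSpace.single i (1 : ℝ) := by
  ext k
  simp [Pi.single_apply]

theorem norm_pow_succ_le_sum (N : ℕ) (z : Eu d) :
    ‖z‖ ^ (N + 1) ≤ d ^ N * ∑ i, |z i| ^ (N + 1) := by
  have h1 : ‖z‖ ≤ ∑ i, |z i| := by
    conv_lhs => rw [sum_smul_single z]
    refine (norm_sum_le _ _).trans (Finset.sum_le_sum fun i _ => ?_)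
    simp [norm_smul]
  rcases Nat.eq_zero_or_pos d with rfl | hd
  · have : z = 0 := Subsingleton.elim _ _
    simp [this]
  have h3 := pow_sum_div_card_le_sum_pow (s := Finset.univ) (f := fun i => |z i|)
    (fun i _ => abs_nonneg _) N
  rw [Finset.card_univ, Fintype.card_fin, div_le_iff₀ (by positivity)] at h3
  calc _ ≤ (∑ i, |z i|) ^ (N + 1) := by gcongr
    _ ≤ _ := by rw [mul_comm]; exact h3

namespace DyadicFamily

variable {m : ℝ} {c : ℕ → Eu d × Eu d → ℂ}

theorem eq_zero_of_norm_lt (hc : DyadicFamily m c) (j : ℕ) (p : Eu d × Eu d)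
    (hp : 3 * 2 ^ j < ‖p.2‖) : c j p = 0 :=
  hc.support j p fun h => by linarith [h.2]

theorem continuous_ker (hc : DyadicFamily m c) (j : ℕ) :
    Continuous fun p : Eu d × Eu d => ker (c j) p.1 p.2 :=
  PsiDO.continuous_ker (hc.smooth j).continuous (hc.eq_zero_of_norm_lt j)

theorem ker_bound (hc : DyadicFamily m c) :
    ∃ C : ℝ, 0 ≤ C ∧ ∀ j x y, ‖ker (c j) x y‖ ≤ C * ((2 : ℝ) ^ j) ^ m * (2 ^ j) ^ d := by
  obtain ⟨C, hC, h⟩ := hc.bound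
  refine ⟨C * (3 ^ d * volume.real (Metric.ball (0 : Eu d) 1)), by positivity, fun j x y => ?_⟩
  refine (norm_ker_le (by positivity) (hc.eq_zero_of_norm_lt j) (h j) x y).trans (le_of_eq ?_)
  rw [mul_pow]
  ring

/-- `N` derivatives in `ξ_i` multiply the kernel by `(x - y)_i ^ N` and lower the order of the
family by `N`. -/
theorem ker_coord_bound (N : ℕ) (i : Fin d) : ∀ {m : ℝ} {c : ℕ → Eu d × Eu d → ℂ},
    DyadicFamily m c → ∃ C : ℝ, 0 ≤ C ∧ ∀ j x y,
      (2 ^ j * |(x - y) i|) ^ N * ‖ker (c j) x y‖ ≤ C * ((2 : ℝ) ^ j) ^ m * (2 ^ j) ^ d := by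
  induction N with
  | zero =>
    intro m c hc
    simpa using hc.ker_bound
  | succ N ih =>
    intro m c hc
    obtain ⟨C, hC, h⟩ := ih (hc.pd (Sum.inr i))
    refine ⟨C, hC, fun j x y => ?_⟩
    have h1 := h j x y
    rw [ker_pd_inr (hc.smooth j) (hc.eq_zero_of_norm_lt j), norm_mul, norm_neg, norm_mul, norm_I,
      one_mul, norm_real, Real.norm_eq_abs, show gain (Sum.inr i : Fin d ⊕ Fin d) = 1 from rfl,
      Real.rpow_sub_one (by positivity)] at h1
    calc _ = 2 ^ j * ((2 ^ j * |(x - y) i|) ^ N * (|(x - y) i| * ‖ker (c j) x y‖)) := by ring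
      _ ≤ 2 ^ j * (C * (((2 : ℝ) ^ j) ^ m / 2 ^ j) * (2 ^ j) ^ d) := by gcongr
      _ = _ := by field_simp

/-- The kernel at frequency `2 ^ j` is concentrated at the scale `2 ^ (-j)` about the diagonal. The
exponent `d + 1` is the least integer for which the majorant is integrable. -/
theorem ker_decay (hc : DyadicFamily m c) :
    ∃ C : ℝ, 0 ≤ C ∧ ∀ j x y, ‖ker (c j) x y‖ ≤
      C * ((2 : ℝ) ^ j) ^ m * (2 ^ j) ^ d * (1 + ‖(2 : ℝ) ^ j • (x - y)‖) ^ (-(d + 1 : ℝ)) := by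
  obtain ⟨C, hC, h⟩ := hc.ker_bound
  choose C' hC' h' using fun i => ker_coord_bound (d + 1) i hc
  have hS : 0 ≤ ∑ i, C' i := Finset.sum_nonneg fun i _ => hC' i
  refine ⟨2 ^ d * (C + d ^ d * ∑ i, C' i), by positivity, fun j x y => ?_⟩
  rw [Real.rpow_neg (by positivity), ← div_eq_mul_inv, le_div_iff₀ (by positivity)]
  have e : (1 + ‖(2 : ℝ) ^ j • (x - y)‖) ^ ((d : ℝ) + 1) =
      (1 + ‖(2 : ℝ) ^ j • (x - y)‖) ^ (d + 1) :=
    mod_cast Real.rpow_natCast (1 + ‖(2 : ℝ) ^ j • (x - y)‖) (d + 1)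
  rw [e]
  have h1 : (1 + ‖(2 : ℝ) ^ j • (x - y)‖) ^ (d + 1) ≤
      2 ^ d * (1 + d ^ d * ∑ i, (2 ^ j * |(x - y) i|) ^ (d + 1)) := by
    refine (add_pow_le (by norm_num) (norm_nonneg _) (d + 1)).trans ?_
    simp only [add_tsub_cancel_right, one_pow]
    gcongr
    refine (norm_pow_succ_le_sum d _).trans (le_of_eq ?_)
    simp [abs_mul]
  calc _ ≤ ‖ker (c j) x y‖ * (2 ^ d * (1 + d ^ d * ∑ i, (2 ^ j * |(x - y) i|) ^ (d + 1))) := by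
        gcongr
    _ = 2 ^ d * (‖ker (c j) x y‖ +
        d ^ d * ∑ i, (2 ^ j * |(x - y) i|) ^ (d + 1) * ‖ker (c j) x y‖) := by
        rw [← Finset.sum_mul]
        ring
    _ ≤ 2 ^ d * (C * ((2 : ℝ) ^ j) ^ m * (2 ^ j) ^ d +
        d ^ d * ∑ i, C' i * ((2 : ℝ) ^ j) ^ m * (2 ^ j) ^ d) := by
        gcongr ?_ * (?_ + ?_ * ?_)
        · exact h j x y
        · exact Finset.sum_le_sum fun i _ => h' i j x y
    _ = _ := by
        rw [← Finset.sum_mul, ← Finset.sum_mul]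
        ring

/-- The Schur bound for the kernel at frequency `2 ^ j`. -/
theorem lintegral_ker (hc : DyadicFamily m c) :
    ∃ C : ℝ, 0 ≤ C ∧ ∀ j y,
      ∫⁻ x, ‖ker (c j) x y‖ₑ ≤ ENNReal.ofReal (C * ((2 : ℝ) ^ j) ^ m) := by
  obtain ⟨C, hC, h⟩ := hc.ker_decay
  have hi : Integrable fun z : Eu d => (1 + ‖z‖) ^ (-(d + 1 : ℝ)) :=
    integrable_one_add_norm (by rw [finrank_euclideanSpace_fin]; simp)
  refine ⟨C * ∫ z : Eu d, (1 + ‖z‖) ^ (-(d + 1 : ℝ)),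
    mul_nonneg hC (integral_nonneg fun z => by positivity), fun j y => ?_⟩
  have e1 : ∀ x, ‖ker (c j) x y‖ₑ ≤ ENNReal.ofReal (C * ((2 : ℝ) ^ j) ^ m * (2 ^ j) ^ d *
      (1 + ‖(2 : ℝ) ^ j • (x - y)‖) ^ (-(d + 1 : ℝ))) := fun x => by
    rw [← ofReal_norm]
    exact ENNReal.ofReal_le_ofReal (h j x y)
  refine (lintegral_mono e1).trans ?_
  rw [lintegral_sub_right_eq_self (fun z : Eu d =>
      ENNReal.ofReal (C * ((2 : ℝ) ^ j) ^ m * (2 ^ j) ^ d *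
      (1 + ‖(2 : ℝ) ^ j • z‖) ^ (-(d + 1 : ℝ)))) y,
    ← ofReal_integral_eq_lintegral_ofReal
      ((hi.comp_smul (by positivity : (2 : ℝ) ^ j ≠ 0)).const_mul _)
      (Filter.Eventually.of_forall fun z => by positivity), integral_const_mul,
    Measure.integral_comp_smul volume (fun z : Eu d => (1 + ‖z‖) ^ (-(d + 1 : ℝ))),
    finrank_euclideanSpace_fin, abs_of_nonneg (by positivity), smul_eq_mul]
  refine ENNReal.ofReal_le_ofReal (le_of_eq ?_)
  field_simp

end DyadicFamily

end Kernels

/-! ### Translates of the kernels -/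

section Translation

open Complex

variable {d : ℕ}

/-- The symbol `i ξ_i c + ∂_{x_i} c` of the composition of `∂_i` with the operator of symbol `c`. -/
noncomputable def covD (i : Fin d) (c : Eu d × Eu d → ℂ) (p : Eu d × Eu d) : ℂ :=
  I * (((p.2 i : ℝ) : ℂ) * c p) + pd (Sum.inl i) c p

theorem SymbolFamily.covD {ι : Type*} {m : ℝ} {c : ι → Eu d × Eu d → ℂ} (hc : SymbolFamily m c)
    (i : Fin d) : SymbolFamily (m + 1) fun j => covD i (c j) := by
  have h1 := ((SymbolFamily.coord (ι := ι) i).mul hc).const_mul I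
  have h2 := hc.pd (Sum.inl i)
  rw [add_comm] at h1
  exact h1.add (h2.mono (by simp [gain]))

theorem DyadicFamily.covD {m : ℝ} {c : ℕ → Eu d × Eu d → ℂ} (hc : DyadicFamily m c) (i : Fin d) :
    DyadicFamily (m + 1) fun j => covD i (c j) := by
  refine ⟨hc.toSymbolFamily.covD i, fun j p hp => ?_⟩
  rw [PsiDO.covD, hc.support j p hp, (hc.pd (Sum.inl i)).support j p hp]
  simp

theorem covD_contDiff {c : Eu d × Eu d → ℂ} (hc : ContDiff ℝ ∞ c) (i : Fin d) :
    ContDiff ℝ ∞ (covD i c) := by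
  have h : ContDiff ℝ ∞ fun p : Eu d × Eu d => ((p.2 i : ℝ) : ℂ) :=
    (SymbolFamily.coord (ι := Unit) i).smooth ()
  exact (contDiff_const.mul (h.mul hc)).add (pd_contDiff hc _)

theorem covD_eq_zero_of_norm_lt {c : Eu d × Eu d → ℂ} {R : ℝ} (hR : ∀ p, R < ‖p.2‖ → c p = 0)
    (i : Fin d) (p : Eu d × Eu d) (hp : R < ‖p.2‖) : covD i c p = 0 := by
  rw [covD, hR p hp, pd_eq_zero_of_norm_lt hR _ p hp]
  simp

theorem hasDerivAt_ker_integrand {c : Eu d × Eu d → ℂ} (hc : ContDiff ℝ ∞ c) (x y z ξ : Eu d)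
    (t : ℝ) :
    HasDerivAt (fun t : ℝ => exp (2 * Real.pi * I * (inner ℝ (x + t • z - y) ξ : ℝ)) *
        c (x + t • z, (2 * Real.pi) • ξ))
      (∑ i, (z i : ℂ) * (exp (2 * Real.pi * I * (inner ℝ (x + t • z - y) ξ : ℝ)) *
        covD i c (x + t • z, (2 * Real.pi) • ξ))) t := by
  have h0 : HasDerivAt (fun t : ℝ => x + t • z) z t := by
    simpa using ((hasDerivAt_id t).smul_const z).const_add x
  have h1 : HasDerivAt (fun t : ℝ => ((inner ℝ (x + t • z - y) ξ : ℝ) : ℂ))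
      ((inner ℝ z ξ : ℝ) : ℂ) t := by
    have := (h0.sub_const y).inner ℝ (hasDerivAt_const t ξ)
    simpa using this.ofReal_comp
  have h2 := (h1.const_mul (2 * Real.pi * I)).cexp
  have h3 : HasDerivAt (fun t : ℝ => c (x + t • z, (2 * Real.pi) • ξ))
      (fderiv ℝ c (x + t • z, (2 * Real.pi) • ξ) (z, 0)) t :=
    HasFDerivAt.comp_hasDerivAt (f := fun t : ℝ => (x + t • z, (2 * Real.pi) • ξ)) t
      (hc.differentiable (by simp) _).hasFDerivAt (h0.prodMk (hasDerivAt_const t _))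
  refine (h2.mul h3).congr_deriv ?_
  have e1 : fderiv ℝ c (x + t • z, (2 * Real.pi) • ξ) (z, 0) =
      ∑ i, (z i : ℂ) * pd (Sum.inl i) c (x + t • z, (2 * Real.pi) • ξ) := by
    have : ((z, 0) : Eu d × Eu d) = ∑ i, z i • dir (Sum.inl i) := by
      ext1
      · simpa [dir, Prod.fst_sum] using sum_smul_single z
      · simp [dir, Prod.snd_sum]
    rw [this, map_sum]
    simp [pd]
  have e2 : ((inner ℝ z ξ : ℝ) : ℂ) = ∑ i, (z i : ℂ) * (ξ i : ℂ) := by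
    rw [PiLp.inner_apply]
    push_cast
    refine Finset.sum_congr rfl fun i _ => ?_
    simp [mul_comm]
  rw [e1, e2]
  simp only [covD, Finset.mul_sum, Finset.sum_mul, ← Finset.sum_add_distrib]
  refine Finset.sum_congr rfl fun i _ => ?_
  simp
  ring

/-- The derivative of the kernel in `x` along `z` is a combination of kernels of the symbols
`covD i c`. -/
theorem hasDerivAt_ker {c : Eu d × Eu d → ℂ} (hc : ContDiff ℝ ∞ c) {R B : ℝ}
    (hR : ∀ p, R < ‖p.2‖ → c p = 0) (hB : ∀ i p, ‖covD i c p‖ ≤ B) (x y z : Eu d) (t : ℝ) :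
    HasDerivAt (fun t : ℝ => ker c (x + t • z) y)
      (∑ i, (z i : ℂ) * ker (covD i c) (x + t • z) y) t := by
  have hint : ∀ i, Integrable fun ξ => (z i : ℂ) *
      (exp (2 * Real.pi * I * (inner ℝ (x + t • z - y) ξ : ℝ)) *
        covD i c (x + t • z, (2 * Real.pi) • ξ)) := fun i =>
    (integrable_ker_integrand (covD_contDiff hc i).continuous (covD_eq_zero_of_norm_lt hR i)
      (x + t • z) y).const_mul _
  have h := hasDerivAt_integral_of_dominated_loc_of_deriv_le (μ := (volume : Measure (Eu d)))
    (F := fun (t : ℝ) ξ => exp (2 * Real.pi * I * (inner ℝ (x + t • z - y) ξ : ℝ)) *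
        c (x + t • z, (2 * Real.pi) • ξ))
    (F' := fun (t : ℝ) ξ => ∑ i, (z i : ℂ) *
      (exp (2 * Real.pi * I * (inner ℝ (x + t • z - y) ξ : ℝ)) *
        covD i c (x + t • z, (2 * Real.pi) • ξ)))
    (bound := (Metric.closedBall (0 : Eu d) R).indicator fun _ => ∑ i, ‖(z i : ℂ)‖ * B)
    (x₀ := t) (s := Set.univ) Filter.univ_mem
    (Filter.Eventually.of_forall fun t =>
      (integrable_ker_integrand hc.continuous hR (x + t • z) y).aestronglyMeasurable)
    (integrable_ker_integrand hc.continuous hR (x + t • z) y)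
    (integrable_finsetSum _ fun i _ => hint i).aestronglyMeasurable
    (Filter.Eventually.of_forall fun ξ t _ => ?_)
    ((integrable_indicator_iff Metric.isClosed_closedBall.measurableSet).2
      (integrableOn_const measure_closedBall_lt_top.ne))
    (Filter.Eventually.of_forall fun ξ t _ => hasDerivAt_ker_integrand hc x y z ξ t)
  · refine h.2.congr_deriv ?_
    rw [integral_finsetSum _ fun i _ => hint i]
    simp_rw [integral_const_mul]
    rfl
  · by_cases hξ : ξ ∈ Metric.closedBall (0 : Eu d) R
    · rw [Set.indicator_of_mem hξ]
      refine (norm_sum_le _ _).trans (Finset.sum_le_sum fun i _ => ?_)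
      rw [norm_mul, norm_mul, norm_exp_two_pi_inner, one_mul]
      gcongr
      exact hB i _
    · rw [Set.indicator_of_notMem hξ]
      rw [mem_closedBall_zero_iff, not_le] at hξ
      have h0 : ∀ i, covD i c (x + t • z, (2 * Real.pi) • ξ) = 0 := fun i =>
        covD_eq_zero_of_norm_lt hR i (x + t • z, (2 * Real.pi) • ξ)
          (hξ.trans_le (norm_le_norm_two_pi_smul ξ))
      simp [h0]

/-- The mean value inequality in `L¹`, for the function `x ↦ ker c x y`. -/
theorem lintegral_ker_translate_le {c : Eu d × Eu d → ℂ} (hc : ContDiff ℝ ∞ c) {R B : ℝ}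
    (hR : ∀ p, R < ‖p.2‖ → c p = 0) (hB : ∀ i p, ‖covD i c p‖ ≤ B) (y z : Eu d) :
    ∫⁻ x, ‖ker c (x + z) y - ker c x y‖ₑ ≤ ‖z‖ₑ * ∑ i, ∫⁻ x, ‖ker (covD i c) x y‖ₑ := by
  have hk : ∀ i, Continuous fun x : Eu d => ker (covD i c) x y := fun i =>
    Continuous.comp (f := fun x : Eu d => (x, y))
      (g := fun p : Eu d × Eu d => ker (covD i c) p.1 p.2)
      (continuous_ker (covD_contDiff hc i).continuous (covD_eq_zero_of_norm_lt hR i)) (by fun_prop)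
  have hk' : ∀ i (x : Eu d), Continuous fun t : ℝ => ker (covD i c) (x + t • z) y := fun i x =>
    (hk i).comp (by fun_prop : Continuous fun t : ℝ => x + t • z)
  have hk'' : ∀ i, Continuous fun p : Eu d × ℝ => ker (covD i c) (p.1 + p.2 • z) y := fun i =>
    (hk i).comp (by fun_prop : Continuous fun p : Eu d × ℝ => p.1 + p.2 • z)
  have h1 : ∀ x : Eu d, ‖ker c (x + z) y - ker c x y‖ₑ ≤
      ∫⁻ t in Set.Ioc (0 : ℝ) 1, ‖z‖ₑ * ∑ i, ‖ker (covD i c) (x + t • z) y‖ₑ := by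
    intro x
    have hFTC := intervalIntegral.integral_eq_sub_of_hasDerivAt (a := 0) (b := 1)
      (fun t _ => hasDerivAt_ker hc hR hB x y z t)
      ((continuous_finsetSum _ fun i _ =>
        continuous_const.mul (hk' i x)).intervalIntegrable _ _)
    simp only [one_smul, zero_smul, add_zero] at hFTC
    rw [← hFTC, intervalIntegral.integral_of_le zero_le_one]
    refine (enorm_integral_le_lintegral_enorm _).trans (lintegral_mono fun t => ?_)
    rw [Finset.mul_sum]
    refine (enorm_sum_le _ _).trans (Finset.sum_le_sum fun i _ => ?_)
    rw [enorm_mul]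
    gcongr
    rw [← ofReal_norm, ← ofReal_norm, norm_real]
    exact ENNReal.ofReal_le_ofReal (PiLp.norm_apply_le z i)
  calc _ ≤ ∫⁻ x : Eu d, ∫⁻ t in Set.Ioc (0 : ℝ) 1, ‖z‖ₑ * ∑ i, ‖ker (covD i c) (x + t • z) y‖ₑ :=
        lintegral_mono h1
    _ = ∫⁻ t in Set.Ioc (0 : ℝ) 1, ∫⁻ x : Eu d, ‖z‖ₑ * ∑ i, ‖ker (covD i c) (x + t • z) y‖ₑ := by
        refine lintegral_lintegral_swap (Measurable.aemeasurable ?_)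
        exact (Finset.measurable_sum _ fun i _ => (hk'' i).measurable.enorm).const_mul _
    _ = ∫⁻ t in Set.Ioc (0 : ℝ) 1, ‖z‖ₑ * ∑ i, ∫⁻ x : Eu d, ‖ker (covD i c) x y‖ₑ := by
        refine lintegral_congr fun t => ?_
        have hm : ∀ i, Measurable fun x : Eu d => ‖ker (covD i c) (x + t • z) y‖ₑ := fun i =>
          ((hk i).comp (by fun_prop : Continuous fun x : Eu d => x + t • z)).measurable.enorm
        rw [lintegral_const_mul _ (Finset.measurable_sum _ fun i _ => hm i),
          lintegral_finsetSum _ fun i _ => hm i]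
        congr 1
        refine Finset.sum_congr rfl fun i _ => ?_
        exact lintegral_add_right_eq_self (fun x => ‖ker (covD i c) x y‖ₑ) (t • z)
    _ = _ := by simp

/-- A translation by `z` costs a factor `2 ^ j |z|` in the Schur bound. -/
theorem DyadicFamily.lintegral_ker_translate {m : ℝ} {c : ℕ → Eu d × Eu d → ℂ}
    (hc : DyadicFamily m c) :
    ∃ C : ℝ, 0 ≤ C ∧ ∀ j y z, ∫⁻ x, ‖ker (c j) (x + z) y - ker (c j) x y‖ₑ ≤
      ENNReal.ofReal (C * ((2 : ℝ) ^ j) ^ (m + 1) * ‖z‖) := by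
  choose B hB hB' using fun i => (hc.covD i).bound
  choose C hC hC' using fun i => (hc.covD i).lintegral_ker
  refine ⟨∑ i, C i, Finset.sum_nonneg fun i _ => hC i, fun j y z => ?_⟩
  refine (lintegral_ker_translate_le (hc.smooth j) (hc.eq_zero_of_norm_lt j)
    (B := ∑ i, B i * ((2 : ℝ) ^ j) ^ (m + 1)) (fun i p => (hB' i j p).trans
      (Finset.single_le_sum (f := fun i => B i * ((2 : ℝ) ^ j) ^ (m + 1))
        (fun i _ => mul_nonneg (hB i) (by positivity)) (Finset.mem_univ i))) y z).trans ?_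
  rw [mul_comm (‖z‖ₑ), ENNReal.ofReal_mul
      (mul_nonneg (Finset.sum_nonneg fun i _ => hC i) (by positivity)),
    ofReal_norm, Finset.sum_mul (f := C),
    ENNReal.ofReal_sum_of_nonneg fun i _ => mul_nonneg (hC i) (by positivity)]
  gcongr with i
  exact hC' i j y

end Translation

/-! ### Schur's test and the Littlewood–Paley decomposition of an operator -/

section Layers

open Complex

variable {d : ℕ}

/-- The distribution `u` is the complex measure `h dν`. -/
structure HasDensity (u : 𝓢'(Eu d, ℂ)) (ν : Measure (Eu d)) (h : Eu d → ℂ) : Prop where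
  integrable : Integrable h ν
  apply_eq : ∀ φ : 𝓢(Eu d, ℂ), u φ = ∫ y, φ y * h y ∂ν

theorem hasDensity_coe (f : Lp ℂ 1 (volume : Measure (Eu d))) :
    HasDensity (f : 𝓢'(Eu d, ℂ)) volume f := by
  refine ⟨L1.integrable_coeFn f, fun φ => ?_⟩
  simp

section Schur

variable {ν : Measure (Eu d)} [SFinite ν] {h : Eu d → ℂ} {k : Eu d → Eu d → ℂ} {B : ℝ}

theorem integrable_prod_kernel (hk : Continuous (Function.uncurry k))
    (hB : ∀ y, ∫⁻ x, ‖k x y‖ₑ ≤ ENNReal.ofReal B)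
    (hh : Integrable h ν) :
    Integrable (Function.uncurry fun x y => k x y * h y) ((volume : Measure (Eu d)).prod ν) := by
  have hm : AEStronglyMeasurable (Function.uncurry fun x y => k x y * h y)
      ((volume : Measure (Eu d)).prod ν) :=
    hk.aestronglyMeasurable.mul hh.aestronglyMeasurable.comp_snd
  refine ⟨hm, ?_⟩
  rw [hasFiniteIntegral_iff_enorm, lintegral_prod_symm _ hm.enorm]
  calc _ ≤ ∫⁻ y, ENNReal.ofReal B * ‖h y‖ₑ ∂ν := by
        refine lintegral_mono fun y => ?_
        simp only [Function.uncurry_apply_pair, enorm_mul]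
        have : Continuous fun x => k x y :=
          Continuous.comp (g := Function.uncurry k) (f := fun x => (x, y)) hk (by fun_prop)
        rw [lintegral_mul_const _ this.measurable.enorm]
        gcongr
        exact hB y
    _ < ⊤ := by
        rw [lintegral_const_mul' _ _ ENNReal.ofReal_ne_top]
        exact ENNReal.mul_lt_top ENNReal.ofReal_lt_top hh.2

/-- Schur's test on `L¹`. -/
theorem lintegral_kernel_le (hk : Continuous (Function.uncurry k))
    (hB : ∀ y, ∫⁻ x, ‖k x y‖ₑ ≤ ENNReal.ofReal B) (hB0 : 0 ≤ B) (hh : Integrable h ν) :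
    ∫⁻ x, ‖∫ y, k x y * h y ∂ν‖ₑ ≤ ENNReal.ofReal (B * ∫ y, ‖h y‖ ∂ν) := by
  have hm := (integrable_prod_kernel hk hB hh).aestronglyMeasurable
  calc _ ≤ ∫⁻ x, ∫⁻ y, ‖k x y * h y‖ₑ ∂ν := lintegral_mono fun x =>
      enorm_integral_le_lintegral_enorm _
    _ = ∫⁻ y, (∫⁻ x, ‖k x y * h y‖ₑ) ∂ν := lintegral_lintegral_swap hm.enorm
    _ ≤ ∫⁻ y, ENNReal.ofReal B * ‖h y‖ₑ ∂ν := by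
        refine lintegral_mono fun y => ?_
        simp only [enorm_mul]
        have : Continuous fun x => k x y :=
          Continuous.comp (g := Function.uncurry k) (f := fun x => (x, y)) hk (by fun_prop)
        rw [lintegral_mul_const _ this.measurable.enorm]
        gcongr
        exact hB y
    _ = _ := by
        rw [lintegral_const_mul' _ _ ENNReal.ofReal_ne_top, ENNReal.ofReal_mul hB0,
          ofReal_integral_norm_eq_lintegral_enorm hh]

end Schur

/-- The transpose of an operator whose symbol has compact support in `ξ` is an integral operator. -/
theorem Symbol.transpose_apply {m : ℝ} (a : Symbol d m) {R B : ℝ}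
    (hR : ∀ p, R < ‖p.2‖ → Function.uncurry a p = 0) (hB : ∀ p, ‖Function.uncurry a p‖ ≤ B)
    (φ : 𝓢(Eu d, ℂ)) (y : Eu d) :
    a.transpose φ y = ∫ x, φ x * ker (Function.uncurry a) x y := by
  have e1 : a.transpose φ y = ∫ ξ : Eu d, ∫ x : Eu d,
      exp (-(2 * Real.pi * I * (inner ℝ ξ y : ℝ))) *
        (exp (2 * Real.pi * I * (inner ℝ x ξ : ℝ)) * a x ((2 * Real.pi) • ξ) * φ x) := by
    change (𝓕 (a.pairingCLM φ) : 𝓢(Eu d, ℂ)) y = _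
    rw [SchwartzMap.fourier_coe, Real.fourier_eq]
    congr 1
    ext ξ
    rw [Circle.smul_def, Real.fourierChar_apply, smul_eq_mul]
    change _ * a.pairing φ ξ = _
    rw [Symbol.pairing, ← integral_const_mul]
    congr 1
    ext x
    congr 2
    push_cast
    ring
  have hi : Integrable (Function.uncurry fun ξ x : Eu d =>
      exp (-(2 * Real.pi * I * (inner ℝ ξ y : ℝ))) *
        (exp (2 * Real.pi * I * (inner ℝ x ξ : ℝ)) * a x ((2 * Real.pi) • ξ) * φ x))
      ((volume : Measure (Eu d)).prod volume) := by
    have hb : Integrable ((Metric.closedBall (0 : Eu d) R).indicator fun _ => B) :=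
      (integrable_indicator_iff Metric.isClosed_closedBall.measurableSet).2
        (integrableOn_const measure_closedBall_lt_top.ne)
    refine (hb.mul_prod (φ.integrable (μ := volume)).norm).mono' ?_
      (Filter.Eventually.of_forall fun p => ?_)
    · have c1 : Continuous fun p : Eu d × Eu d => a p.2 ((2 * Real.pi) • p.1) :=
        a.smooth.continuous.comp
          (by fun_prop : Continuous fun p : Eu d × Eu d => (p.2, (2 * Real.pi) • p.1))
      have c2 : Continuous fun p : Eu d × Eu d =>
        exp (2 * Real.pi * I * (inner ℝ p.2 p.1 : ℝ)) := by fun_prop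
      have c3 : Continuous fun p : Eu d × Eu d => φ p.2 := φ.continuous.comp continuous_snd
      have c4 : Continuous fun p : Eu d × Eu d =>
        exp (-(2 * Real.pi * I * (inner ℝ p.1 y : ℝ))) := by fun_prop
      exact (c4.mul ((c2.mul c1).mul c3)).aestronglyMeasurable
    · obtain ⟨ξ, x⟩ := p
      have e : ‖exp (-(2 * Real.pi * I * (inner ℝ ξ y : ℝ)))‖ = 1 := by
        rw [exp_neg, norm_inv, norm_exp_two_pi_inner, inv_one]
      simp only [Function.uncurry_apply_pair, norm_mul, e, norm_exp_two_pi_inner, one_mul]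
      gcongr
      by_cases hξ : ξ ∈ Metric.closedBall (0 : Eu d) R
      · rw [Set.indicator_of_mem hξ]
        exact hB (x, (2 * Real.pi) • ξ)
      · rw [Set.indicator_of_notMem hξ]
        rw [mem_closedBall_zero_iff, not_le] at hξ
        have := hR (x, (2 * Real.pi) • ξ) (hξ.trans_le (norm_le_norm_two_pi_smul ξ))
        simp only [Function.uncurry_apply_pair] at this
        simp [this]
  rw [e1, integral_integral_swap hi]
  congr 1
  ext x
  rw [ker, ← integral_const_mul]
  congr 1
  ext ξ
  have e : exp (2 * Real.pi * I * (inner ℝ (x - y) ξ : ℝ)) =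
      exp (-(2 * Real.pi * I * (inner ℝ ξ y : ℝ))) * exp (2 * Real.pi * I * (inner ℝ x ξ : ℝ)) := by
    rw [← exp_add, inner_sub_left, real_inner_comm y ξ]
    congr 1
    push_cast
    ring
  rw [e]
  simp only [Function.uncurry_apply_pair]
  ring

/-- The Littlewood–Paley piece `a(x, ξ) lpPart j ξ` of a symbol. -/
noncomputable def Symbol.piece {m : ℝ} (a : Symbol d m) (j : ℕ) : Symbol d m :=
  (DyadicFamily.of_symbol a.family).toSymbolFamily.toSymbol j

theorem Symbol.piece_apply {m : ℝ} (a : Symbol d m) (j : ℕ) (x ξ : Eu d) :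
    a.piece j x ξ = a x ξ * lpPart j ξ := rfl

theorem Symbol.dyadic {m : ℝ} (a : Symbol d m) :
    DyadicFamily m fun j => Function.uncurry (a.piece j) :=
  DyadicFamily.of_symbol a.family

/-- The operator of the `j`-th piece of a symbol of order `m` maps finite measures to integrable
functions, with a norm `O(2 ^ (j m))`, and with an `L¹` modulus of continuity
`O(2 ^ (j (m + 1)) |z|)`. -/
theorem Symbol.exists_piece {m : ℝ} (a : Symbol d m) :
    ∃ C : ℝ, 0 ≤ C ∧ ∀ (ν : Measure (Eu d)) [SFinite ν] (h : Eu d → ℂ) (u : 𝓢'(Eu d, ℂ)),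
      HasDensity u ν h → ∀ j, ∃ F : Lp ℂ 1 (volume : Measure (Eu d)),
        (a.piece j).op u = (F : 𝓢'(Eu d, ℂ)) ∧
        ‖F‖ ≤ C * ((2 : ℝ) ^ j) ^ m * ∫ y, ‖h y‖ ∂ν ∧
        ∀ z, ∫⁻ x, ‖F (x + z) - F x‖ₑ ≤
          ENNReal.ofReal (C * ((2 : ℝ) ^ j) ^ (m + 1) * ‖z‖ * ∫ y, ‖h y‖ ∂ν) := by
  obtain ⟨B, hB0, hB⟩ := a.dyadic.bound
  obtain ⟨B', hB0', hB'⟩ := a.dyadic.ker_bound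
  obtain ⟨C, hC, h1⟩ := a.dyadic.lintegral_ker
  obtain ⟨C', hC', h2⟩ := a.dyadic.lintegral_ker_translate
  refine ⟨C + C', by positivity, fun ν _ h u hu j => ?_⟩
  have hM : 0 ≤ ∫ y, ‖h y‖ ∂ν := integral_nonneg fun y => norm_nonneg _
  set k : Eu d → Eu d → ℂ := ker (Function.uncurry (a.piece j))
  have hk : Continuous (Function.uncurry k) := a.dyadic.continuous_ker j
  have hprod := integrable_prod_kernel hk (h1 j) hu.integrable
  have hF : Integrable fun x => ∫ y, k x y * h y ∂ν := hprod.integral_prod_left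
  have hx : ∀ x, Integrable (fun y => k x y * h y) ν := fun x =>
    hu.integrable.bdd_mul
      (Continuous.comp (g := Function.uncurry k) (f := fun y => (x, y)) hk
        (by fun_prop)).aestronglyMeasurable
      (Filter.Eventually.of_forall fun y => hB' j x y)
  have hae := hF.coeFn_toL1
  refine ⟨hF.toL1 _, ?_, ?_, fun z => ?_⟩
  · ext φ
    obtain ⟨Bφ, hBφ⟩ : ∃ Bφ, ∀ x, ‖φ x‖ ≤ Bφ := ⟨_, fun x => φ.norm_le_seminorm ℂ x⟩
    have h3 : Integrable (Function.uncurry fun x y => φ x * (k x y * h y))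
        ((volume : Measure (Eu d)).prod ν) :=
      hprod.bdd_mul (f := fun p : Eu d × Eu d => φ p.1)
        (φ.continuous.comp continuous_fst).aestronglyMeasurable
        (Filter.Eventually.of_forall fun p => hBφ p.1)
    have h4 : ∀ y, (a.piece j).transpose φ y * h y = ∫ x, φ x * (k x y * h y) := by
      intro y
      rw [Symbol.transpose_apply _ (a.dyadic.eq_zero_of_norm_lt j) (hB j), ← integral_mul_const]
      simp_rw [mul_assoc]
      rfl
    calc (a.piece j).op u φ = u ((a.piece j).transpose φ) := rfl
      _ = ∫ y, (∫ x, φ x * (k x y * h y)) ∂ν := by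
          rw [hu.apply_eq]
          simp_rw [h4]
      _ = ∫ x, φ x * ∫ y, k x y * h y ∂ν := by
          rw [← integral_integral_swap h3]
          simp_rw [integral_const_mul]
      _ = _ := by
          rw [Lp.toTemperedDistribution_apply]
          refine integral_congr_ae ?_
          filter_upwards [hae] with x hx
          rw [hx, smul_eq_mul]
  · rw [Integrable.norm_toL1_eq_lintegral_enorm]
    refine ENNReal.toReal_le_of_le_ofReal (by positivity) ?_
    refine (lintegral_kernel_le hk (h1 j) (by positivity) hu.integrable).trans ?_
    refine ENNReal.ofReal_le_ofReal ?_
    gcongr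
    linarith
  · have hae' := (measurePreserving_add_right (volume : Measure (Eu d)) z).quasiMeasurePreserving.ae
      hae
    have e : ∫⁻ x, ‖hF.toL1 _ (x + z) - hF.toL1 _ x‖ₑ =
        ∫⁻ x, ‖∫ y, (k (x + z) y - k x y) * h y ∂ν‖ₑ := by
      refine lintegral_congr_ae ?_
      filter_upwards [hae, hae'] with x h5 h6
      rw [h5, h6, ← integral_sub (hx _) (hx _)]
      simp_rw [sub_mul]
    rw [e]
    refine (lintegral_kernel_le (k := fun x y => k (x + z) y - k x y) ?_ (fun y => h2 j y z)
      (by positivity) hu.integrable).trans (ENNReal.ofReal_le_ofReal ?_)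
    · exact (Continuous.comp (g := Function.uncurry k) (f := fun p : Eu d × Eu d => (p.1 + z, p.2))
        hk (by fun_prop)).sub hk
    · gcongr
      linarith

theorem Symbol.pairing_piece {m : ℝ} (a : Symbol d m) (j : ℕ) (φ : 𝓢(Eu d, ℂ)) (ξ : Eu d) :
    (a.piece j).pairing φ ξ = lpPart j ((2 * Real.pi) • ξ) * a.pairing φ ξ := by
  rw [Symbol.pairing, Symbol.pairing, ← integral_const_mul]
  congr 1
  ext x
  rw [Symbol.piece_apply]
  ring

/-- The Littlewood–Paley decomposition of `Op(a) u` converges weakly. -/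
theorem Symbol.tendsto_sum_piece {m : ℝ} (a : Symbol d m) {ν : Measure (Eu d)}
    {h : Eu d → ℂ} {u : 𝓢'(Eu d, ℂ)} (hu : HasDensity u ν h) (φ : 𝓢(Eu d, ℂ)) :
    Filter.Tendsto (fun J => ∑ j ∈ Finset.range J, (a.piece j).op u φ) Filter.atTop
      (nhds (a.op u φ)) := by
  rw [← Filter.tendsto_add_atTop_iff_nat 1]
  let P : ℕ → 𝓢(Eu d, ℂ) := fun J => ∑ j ∈ Finset.range (J + 1), (a.piece j).pairingCLM φ
  have hP : ∀ J ξ, P J ξ = cutoff J ((2 * Real.pi) • ξ) * a.pairingCLM φ ξ := by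
    intro J ξ
    rw [sum_apply, ← sum_lpPart, Finset.sum_mul]
    exact Finset.sum_congr rfl fun j _ => a.pairing_piece j φ ξ
  have h1 : ∀ J, ∑ j ∈ Finset.range (J + 1), (a.piece j).op u φ = ∫ y, 𝓕 (P J) y * h y ∂ν := by
    intro J
    rw [← hu.apply_eq]
    have : (𝓕 (P J) : 𝓢(Eu d, ℂ)) = ∑ j ∈ Finset.range (J + 1), (a.piece j).transpose φ :=
      map_sum (fourierCLM ℂ 𝓢(Eu d, ℂ)) _ _
    rw [this, map_sum]
    rfl
  have h2 : a.op u φ = ∫ y, 𝓕 (a.pairingCLM φ) y * h y ∂ν := hu.apply_eq _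
  simp_rw [h1]
  rw [h2]
  have hint := (a.pairingCLM φ).integrable (μ := volume)
  have hle : ∀ J ξ, ‖P J ξ‖ ≤ ‖a.pairingCLM φ ξ‖ := by
    intro J ξ
    rw [hP, norm_mul]
    exact mul_le_of_le_one_left (norm_nonneg _) (norm_cutoff_le _ _)
  refine tendsto_integral_of_dominated_convergence
    (fun y => (∫ ξ, ‖a.pairingCLM φ ξ‖) * ‖h y‖)
    (fun J => (𝓕 (P J)).continuous.aestronglyMeasurable.mul hu.integrable.aestronglyMeasurable)
    (hu.integrable.norm.const_mul _)
    (fun J => Filter.Eventually.of_forall fun y => ?_)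
    (Filter.Eventually.of_forall fun y => ?_)
  · rw [norm_mul]
    gcongr
    rw [SchwartzMap.fourier_coe, Real.fourier_eq]
    refine (norm_integral_le_integral_norm _).trans (integral_mono_of_nonneg
      (Filter.Eventually.of_forall fun ξ => norm_nonneg _) hint.norm
      (Filter.Eventually.of_forall fun ξ => ?_))
    simpa using hle J ξ
  · refine Filter.Tendsto.mul_const _ ?_
    simp_rw [SchwartzMap.fourier_coe, Real.fourier_eq]
    refine tendsto_integral_of_dominated_convergence (fun ξ => ‖a.pairingCLM φ ξ‖)
      (fun J => ?_) hint.norm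
      (fun J => Filter.Eventually.of_forall fun ξ => by simpa using hle J ξ)
      (Filter.Eventually.of_forall fun ξ => ?_)
    · exact ((Real.continuous_fourierChar.comp (by fun_prop)).smul
        (P J).continuous).aestronglyMeasurable
    · simp_rw [hP]
      have := (tendsto_cutoff ((2 * Real.pi) • ξ)).mul_const (a.pairingCLM φ ξ)
      rw [one_mul] at this
      exact this.const_smul _

/-- A weakly convergent series of distributions with absolutely convergent `L¹` norms. -/
theorem exists_hasSum_of_tendsto {v : 𝓢'(Eu d, ℂ)} {F : ℕ → Lp ℂ 1 (volume : Measure (Eu d))}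
    {b : ℕ → ℝ} (hb : Summable b) (hF : ∀ j, ‖F j‖ ≤ b j)
    (hv : ∀ φ : 𝓢(Eu d, ℂ), Filter.Tendsto
      (fun J => ∑ j ∈ Finset.range J, (F j : 𝓢'(Eu d, ℂ)) φ) Filter.atTop (nhds (v φ))) :
    ∃ G : Lp ℂ 1 (volume : Measure (Eu d)), HasSum F G ∧ v = (G : 𝓢'(Eu d, ℂ)) ∧
      ‖G‖ ≤ ∑' j, b j := by
  have hs : Summable F := Summable.of_norm_bounded hb hF
  refine ⟨∑' j, F j, hs.hasSum, ?_, tsum_of_norm_bounded hb.hasSum hF⟩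
  ext φ
  refine tendsto_nhds_unique (hv φ) ?_
  have h1 := ((Lp.toTemperedDistributionCLM ℂ (volume : Measure (Eu d)) 1).continuous.tendsto
    _).comp hs.hasSum.tendsto_sum_nat
  have h2 := PointwiseConvergenceCLM.tendsto_iff_forall_tendsto.1 h1 φ
  refine h2.congr fun J => ?_
  simp only [Function.comp, map_sum, Lp.toTemperedDistributionCLM_apply]
  exact map_sum (PointwiseConvergenceCLM.evalCLM (RingHom.id ℂ) ℂ φ) _ _

end Layers

/-! ### Operators of negative order, derivatives and even Bessel potentials -/

section Derivatives

open Complex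
open scoped LineDeriv

variable {d : ℕ} {m : ℝ}

theorem two_pow_rpow (j : ℕ) (r : ℝ) : ((2 : ℝ) ^ j) ^ r = ((2 : ℝ) ^ r) ^ j := by
  rw [← Real.rpow_natCast, ← Real.rpow_natCast, ← Real.rpow_mul zero_le_two,
    ← Real.rpow_mul zero_le_two, mul_comm]

theorem summable_two_pow_rpow {r : ℝ} (hr : r < 0) : Summable fun j : ℕ => ((2 : ℝ) ^ j) ^ r := by
  simp_rw [two_pow_rpow]
  exact summable_geometric_of_lt_one (by positivity)
    (Real.rpow_lt_one_of_one_lt_of_neg one_lt_two hr)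

/-- An operator of negative order maps finite measures to integrable functions. -/
theorem Symbol.exists_integrable (a : Symbol d m) (hm : m < 0) :
    ∃ C : ℝ, 0 ≤ C ∧ ∀ (ν : Measure (Eu d)) [SFinite ν] (h : Eu d → ℂ) (u : 𝓢'(Eu d, ℂ)),
      HasDensity u ν h → ∃ F : Lp ℂ 1 (volume : Measure (Eu d)),
        a.op u = (F : 𝓢'(Eu d, ℂ)) ∧ ‖F‖ ≤ C * ∫ y, ‖h y‖ ∂ν := by
  obtain ⟨C, hC, H⟩ := a.exists_piece
  have hs := summable_two_pow_rpow hm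
  refine ⟨C * ∑' j : ℕ, ((2 : ℝ) ^ j) ^ m,
    mul_nonneg hC (tsum_nonneg fun j => by positivity), fun ν _ h u hu => ?_⟩
  choose F hF hF' _ using H ν h u hu
  obtain ⟨G, _, hG, hG'⟩ := exists_hasSum_of_tendsto (v := a.op u)
    ((hs.mul_left C).mul_right (∫ y, ‖h y‖ ∂ν)) hF' fun φ => by
      simp_rw [← hF]
      exact a.tendsto_sum_piece hu φ
  refine ⟨G, hG, hG'.trans (le_of_eq ?_)⟩
  rw [tsum_mul_right, tsum_mul_left]

/-- An operator depends on its symbol only through the functions `Symbol.pairing`. -/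
theorem Symbol.op_eq_of_pairing {m' : ℝ} {a : Symbol d m} {b : Symbol d m'}
    {S T : 𝓢(Eu d, ℂ) → 𝓢(Eu d, ℂ)}
    (h : ∀ φ ξ, a.pairing (S φ) ξ = b.pairing (T φ) ξ) (u : 𝓢'(Eu d, ℂ)) (φ : 𝓢(Eu d, ℂ)) :
    a.op u (S φ) = b.op u (T φ) := by
  have : a.pairingCLM (S φ) = b.pairingCLM (T φ) := by
    ext ξ
    exact h φ ξ
  change u (𝓕 (a.pairingCLM (S φ))) = u (𝓕 (b.pairingCLM (T φ)))
  rw [this]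

theorem Symbol.op_congr {m' : ℝ} {a : Symbol d m} {b : Symbol d m'} (h : ∀ x ξ, a x ξ = b x ξ)
    (u : 𝓢'(Eu d, ℂ)) : a.op u = b.op u := by
  ext φ
  refine Symbol.op_eq_of_pairing (S := id) (T := id) (fun φ ξ => ?_) u φ
  simp_rw [Symbol.pairing, h]

/-- A symbol of order `m` as a symbol of a larger order. -/
noncomputable def Symbol.mono {m' : ℝ} (h : m ≤ m') (a : Symbol d m) : Symbol d m' :=
  (a.family.mono h).toSymbol ()

/-- The symbol of `∂_i Op(a)`. -/
noncomputable def Symbol.D (a : Symbol d m) (i : Fin d) : Symbol d (m + 1) :=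
  (a.family.covD i).toSymbol ()

theorem Symbol.D_apply (a : Symbol d m) (i : Fin d) (x ξ : Eu d) :
    a.D i x ξ = covD i (Function.uncurry a) (x, ξ) := rfl

theorem Symbol.lineDeriv_op (a : Symbol d m) (i : Fin d) (u : 𝓢'(Eu d, ℂ)) :
    ∂_{(EuclideanSpace.single i 1 : Eu d)} (a.op u) = (a.D i).op u := by
  ext φ
  rw [TemperedDistribution.lineDerivOp_apply_apply]
  refine Symbol.op_eq_of_pairing (S := fun φ => -∂_{(EuclideanSpace.single i 1 : Eu d)} φ)
    (T := id) (fun φ ξ => ?_) u φ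
  set e : Eu d := EuclideanSpace.single i 1 with he
  have h := integral_bilinear_hasLineDerivAt_right_eq_neg_left_of_integrable
    (μ := (volume : Measure (Eu d))) (v := e) (B := ContinuousLinearMap.mul ℝ ℂ)
    (f := fun x => exp (2 * Real.pi * I * (inner ℝ x ξ : ℝ)) * a x ((2 * Real.pi) • ξ))
    (f' := fun x => exp (2 * Real.pi * I * (inner ℝ x ξ : ℝ)) * a.D i x ((2 * Real.pi) • ξ))
    (g := φ) (g' := (∂_{e} φ : 𝓢(Eu d, ℂ))) ((a.D i).pairing_integrable φ ξ)
        (a.pairing_integrable _ ξ)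
    (a.pairing_integrable φ ξ) (fun x _ => ?_) (fun x _ => ?_)
  · simp only [ContinuousLinearMap.mul_apply'] at h
    change _ = (a.D i).pairing φ ξ
    rw [Symbol.pairing, Symbol.pairing, ← neg_eq_iff_eq_neg.2 h, ← integral_neg]
    congr 1
    ext x
    simp
  · have := hasDerivAt_ker_integrand a.smooth x 0 e ξ 0
    simp only [sub_zero] at this
    refine this.congr_deriv ?_
    simp [he, Symbol.D_apply, apply_ite Complex.ofReal]
  · rw [SchwartzMap.lineDerivOp_apply_eq_fderiv]
    exact (φ.differentiableAt (x := x)).hasFDerivAt.hasLineDerivAt e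

/-- The Littlewood–Paley cutoffs do not depend on `x`, so they commute with `Symbol.D`. -/
theorem Symbol.D_piece (a : Symbol d m) (i : Fin d) (j : ℕ) :
    (a.piece j).D i = (a.D i).piece j := by
  ext x ξ
  have hs : ContDiff ℝ ∞ (lpPart j : Eu d → ℂ) := by
    cases j with
    | zero => exact cutoff_contDiff 0
    | succ j => exact (cutoff_contDiff (j + 1)).sub (cutoff_contDiff j)
  have e : Function.uncurry (a.piece j) = fun p => Function.uncurry a p * lpPart j p.2 := rfl
  rw [Symbol.piece_apply, Symbol.D_apply, Symbol.D_apply, covD, covD, e,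
    pd_mul (g := fun p => lpPart j p.2) a.smooth (hs.comp contDiff_snd),
    pd_inl_comp_snd (hs.differentiable (by simp))]
  simp only
  ring

theorem Symbol.exists_partialDeriv (a : Symbol d m) {n : ℕ} (w : Fin n → Fin d) :
    ∃ b : Symbol d (m + n), ∀ u, partialDeriv w (a.op u) = b.op u := by
  induction n with
  | zero =>
    refine ⟨a.mono (by simp), fun u => ?_⟩
    exact Symbol.op_congr (fun _ _ => rfl) u
  | succ n ih =>
    obtain ⟨b, hb⟩ := ih (Fin.tail w)
    refine ⟨(b.D (w 0)).mono (by push_cast; linarith),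
      fun u => ?_⟩
    have e : partialDeriv w (a.op u) = ∂_{(EuclideanSpace.single (w 0) 1 : Eu d)}
      (partialDeriv (Fin.tail w) (a.op u)) := rfl
    rw [e, hb, Symbol.lineDeriv_op]
    exact Symbol.op_congr (fun _ _ => rfl) u

theorem SymbolFamily.sum {ι κ : Type*} {f : κ → ι → Eu d × Eu d → ℂ}
    (hf : ∀ k, SymbolFamily m (f k)) (s : Finset κ) :
    SymbolFamily m fun i p => ∑ k ∈ s, f k i p := by
  classical
  induction s using Finset.induction_on with
  | empty =>
    simp only [Finset.sum_empty]
    exact ⟨fun _ => contDiff_const, fun _ => SymbolBound.const 0 (Or.inr rfl)⟩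
  | insert k s hk ih =>
    simp_rw [Finset.sum_insert hk]
    exact (hf k).add ih

theorem Symbol.op_sum {m' : ℝ} {κ : Type*} {s : Finset κ} {a : Symbol d m}
    {b : κ → Symbol d m'} {r : κ → ℂ} (h : ∀ x ξ, a x ξ = ∑ k ∈ s, r k * b k x ξ)
    (u : 𝓢'(Eu d, ℂ)) : a.op u = ∑ k ∈ s, r k • (b k).op u := by
  ext φ
  have e : a.pairingCLM φ = ∑ k ∈ s, r k • (b k).pairingCLM φ := by
    ext ξ
    rw [sum_apply]
    change a.pairing φ ξ = ∑ k ∈ s, r k * (b k).pairing φ ξ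
    simp_rw [Symbol.pairing, ← integral_const_mul]
    rw [← integral_finsetSum _ fun k _ => ((b k).pairing_integrable φ ξ).const_mul (r k)]
    congr 1
    ext x
    rw [h, Finset.mul_sum, Finset.sum_mul]
    exact Finset.sum_congr rfl fun k _ => by ring
  have e2 : a.transpose φ = ∑ k ∈ s, r k • (b k).transpose φ := by
    change fourierCLM ℂ 𝓢(Eu d, ℂ) (a.pairingCLM φ) =
      ∑ k ∈ s, r k • fourierCLM ℂ 𝓢(Eu d, ℂ) ((b k).pairingCLM φ)
    rw [e, map_sum]
    simp_rw [map_smul]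
  change u (a.transpose φ) = _
  rw [e2, map_sum]
  simp_rw [map_smul]
  exact (map_sum (PointwiseConvergenceCLM.evalCLM (RingHom.id ℂ) ℂ φ)
    (fun k => r k • (b k).op u) s).symm

/-- `J² = 1 - Δ / 4π²`. -/
theorem besselPotential_two (v : 𝓢'(Eu d, ℂ)) :
    TemperedDistribution.besselPotential (Eu d) ℂ 2 v =
      v + (-((2 * Real.pi : ℂ) ^ 2)⁻¹) • ∑ i, ∂_{(EuclideanSpace.single i 1 : Eu d)}
        (∂_{(EuclideanSpace.single i 1 : Eu d)} v) := by
  have h1 := TemperedDistribution.laplacian_eq_sum (EuclideanSpace.basisFun (Fin d) ℝ) v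
  have h2 := TemperedDistribution.laplacian_eq_fourierMultiplierCLM v
  simp only [EuclideanSpace.basisFun_apply] at h1
  rw [← h1, h2]
  have h3 : TemperedDistribution.besselPotential (Eu d) ℂ 2 v = v +
      TemperedDistribution.fourierMultiplierCLM ℂ
        (fun x : Eu d => Complex.ofReal (‖x‖ ^ 2)) v := by
    have h4 : (fun x : Eu d => (((1 + ‖x‖ ^ 2) ^ ((2 : ℝ) / 2) : ℝ) : ℂ)) =
        (fun _ => (1 : ℂ)) + fun x : Eu d => Complex.ofReal (‖x‖ ^ 2) := by
      ext x
      simp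
    have h5 : TemperedDistribution.fourierMultiplierCLM ℂ (fun _ : Eu d => (1 : ℂ)) v = v := by
      simp
    conv_rhs => rw [← h5]
    rw [TemperedDistribution.besselPotential, h4]
    simp only [TemperedDistribution.fourierMultiplierCLM_apply]
    rw [TemperedDistribution.smulLeftCLM_add (by fun_prop) (by fun_prop)]
    simp [FourierTransform.fourierInv_add]
  rw [h3]
  congr 1
  rw [← Complex.coe_smul, smul_smul]
  have : (2 * Real.pi : ℂ) ≠ 0 := by simp [Real.pi_ne_zero]
  push_cast
  rw [show -((2 * Real.pi : ℂ) ^ 2)⁻¹ * -(2 * Real.pi : ℂ) ^ 2 = 1 by field_simp, one_smul]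

/-- `(1 - Δ / 4π²) Op(a)` is the operator of a symbol of order `m + 2`, and this is compatible with
the Littlewood–Paley decomposition. -/
theorem Symbol.exists_besselPotential_two (a : Symbol d m) :
    ∃ b : Symbol d (m + 2), ∀ j u,
      TemperedDistribution.besselPotential (Eu d) ℂ 2 ((a.piece j).op u) = (b.piece j).op u := by
  let b : Option (Fin d) → Symbol d (m + 2) := fun o => o.elim
    (a.mono (by linarith))
    (fun i => ((a.D i).D i).mono (by linarith))
  let r : Option (Fin d) → ℂ := fun o => o.elim 1 (fun _ => -((2 * Real.pi : ℂ) ^ 2)⁻¹)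
  let c : Symbol d (m + 2) := (SymbolFamily.sum (fun o =>
    ((b o).family (ι := Unit)).const_mul (r o)) Finset.univ).toSymbol ()
  refine ⟨c, fun j u => ?_⟩
  have hc : (c.piece j).op u = ∑ o, r o • ((b o).piece j).op u := by
    refine Symbol.op_sum (fun x ξ => ?_) u
    simp_rw [Symbol.piece_apply, ← mul_assoc]
    rw [← Finset.sum_mul]
    rfl
  have hnone : ((b none).piece j).op u = (a.piece j).op u := Symbol.op_congr (fun _ _ => rfl) u
  have hsome : ∀ i, ((b (some i)).piece j).op u =
      ∂_{(EuclideanSpace.single i 1 : Eu d)} (∂_{(EuclideanSpace.single i 1 : Eu d)}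
        ((a.piece j).op u)) := by
    intro i
    rw [Symbol.lineDeriv_op, Symbol.lineDeriv_op, Symbol.D_piece, Symbol.D_piece]
    exact Symbol.op_congr (fun _ _ => rfl) u
  rw [hc, Fintype.sum_option, besselPotential_two, hnone]
  simp_rw [hsome]
  simp only [r, Option.elim_none, Option.elim_some, one_smul, ← Finset.smul_sum]

theorem Symbol.exists_besselPotential_even (a : Symbol d m) (n : ℕ) :
    ∃ b : Symbol d (m + 2 * n), ∀ j u,
      TemperedDistribution.besselPotential (Eu d) ℂ (2 * n) ((a.piece j).op u) =
        (b.piece j).op u := by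
  induction n with
  | zero =>
    refine ⟨a.mono (by simp), fun j u => ?_⟩
    have e : TemperedDistribution.besselPotential (Eu d) ℂ (2 * (0 : ℕ)) ((a.piece j).op u) =
        (a.piece j).op u := by
      simp
    exact e.trans (Symbol.op_congr (fun _ _ => rfl) u)
  | succ n ih =>
    obtain ⟨b, hb⟩ := ih
    obtain ⟨b', hb'⟩ := b.exists_besselPotential_two
    refine ⟨b'.mono (by push_cast; linarith), fun j u => ?_⟩
    have e : TemperedDistribution.besselPotential (Eu d) ℂ (2 * (n + 1 : ℕ)) ((a.piece j).op u) =
        (b'.piece j).op u := by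
      rw [← hb', ← hb, TemperedDistribution.besselPotential_besselPotential_apply]
      congr 2
      push_cast
      ring
    exact e.trans (Symbol.op_congr (fun _ _ => rfl) u)

end Derivatives

/-! ### Bessel potentials of real order -/

section Bessel

open Complex

variable {d : ℕ} {m : ℝ}

/-- The symbol of the Bessel potential of order `s`. -/
noncomputable def besselSymbol (d : ℕ) (s : ℝ) : Symbol d s :=
  (SymbolFamily.bessel (ι := Unit) s).toSymbol ()

/-- For a symbol that does not depend on `x`, the pairing with `φ` is a multiple of the inverse
Fourier transform of `φ`. -/
theorem pairing_mul_bessel (s : ℝ) (χ : Eu d → ℂ) {a : Symbol d m}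
    (ha : ∀ x ξ, a x ξ = besselFun s ξ * χ ξ) (φ : 𝓢(Eu d, ℂ)) (ξ : Eu d) :
    a.pairing φ ξ = (((1 + ‖ξ‖ ^ 2) ^ (s / 2) : ℝ) : ℂ) * χ ((2 * Real.pi) • ξ) * 𝓕⁻ φ ξ := by
  have h1 : besselFun s ((2 * Real.pi) • ξ) = (((1 + ‖ξ‖ ^ 2) ^ (s / 2) : ℝ) : ℂ) := by
    rw [besselFun, smul_smul, inv_mul_cancel₀ (by positivity), one_smul]
  rw [SchwartzMap.fourierInv_coe, Real.fourierInv_eq, ← integral_const_mul, Symbol.pairing]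
  congr 1
  ext x
  rw [ha, h1, Circle.smul_def, Real.fourierChar_apply, smul_eq_mul]
  have e : exp (2 * Real.pi * I * (inner ℝ x ξ : ℝ)) =
      exp (((2 * Real.pi * inner ℝ x ξ : ℝ) : ℂ) * I) := by
    congr 1
    push_cast
    ring
  rw [e]
  ring

theorem smulLeft_bessel_apply (s : ℝ) (φ : 𝓢(Eu d, ℂ)) (ξ : Eu d) :
    SchwartzMap.smulLeftCLM ℂ (fun x : Eu d => (((1 + ‖x‖ ^ 2) ^ (s / 2) : ℝ) : ℂ)) φ ξ =
      (((1 + ‖ξ‖ ^ 2) ^ (s / 2) : ℝ) : ℂ) * φ ξ := by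
  rw [SchwartzMap.smulLeftCLM_apply_apply (by fun_prop), smul_eq_mul]

/-- The Bessel potential is a pseudodifferential operator. -/
theorem besselPotential_eq_op (s : ℝ) (u : 𝓢'(Eu d, ℂ)) :
    TemperedDistribution.besselPotential (Eu d) ℂ s u = (besselSymbol d s).op u := by
  ext φ
  rw [TemperedDistribution.besselPotential,
    TemperedDistribution.fourierMultiplierCLM_apply_apply]
  change _ = u (𝓕 ((besselSymbol d s).pairingCLM φ))
  congr 2
  ext ξ
  rw [smulLeft_bessel_apply]
  change _ = (besselSymbol d s).pairing φ ξ
  rw [pairing_mul_bessel s (fun _ => 1) (fun x ξ => (mul_one _).symm)]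
  ring

/-- A Littlewood–Paley piece of `J^s` factors through `J^t`. -/
theorem besselSymbol_piece_op (s t : ℝ) (k : ℕ) (u : 𝓢'(Eu d, ℂ)) :
    ((besselSymbol d s).piece k).op u = ((besselSymbol d (s - t)).piece k).op
      (TemperedDistribution.besselPotential (Eu d) ℂ t u) := by
  ext φ
  change u (𝓕 (((besselSymbol d s).piece k).pairingCLM φ)) =
    TemperedDistribution.besselPotential (Eu d) ℂ t u
      (𝓕 (((besselSymbol d (s - t)).piece k).pairingCLM φ))
  rw [TemperedDistribution.besselPotential,
    TemperedDistribution.fourierMultiplierCLM_apply_apply, FourierTransform.fourierInv_fourier_eq]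
  congr 2
  ext ξ
  rw [smulLeft_bessel_apply]
  change ((besselSymbol d s).piece k).pairing φ ξ =
    _ * ((besselSymbol d (s - t)).piece k).pairing φ ξ
  rw [pairing_mul_bessel s (lpPart k) (fun x ξ => rfl),
    pairing_mul_bessel (s - t) (lpPart k) (fun x ξ => rfl), ← mul_assoc, ← mul_assoc,
    ← ofReal_mul, ← Real.rpow_add (by positivity)]
  congr 5
  ring

/-- A quantitative interpolation inequality in `L¹`: for `0 < s < t`, the norm of `J^s f` at the
frequency scale `2 ^ j` is controlled by those of `f` and of `J^t f`. -/
theorem exists_besselPotential_interpolation {s t : ℝ} (hs : 0 < s) (ht : s < t) :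
    ∃ C : ℝ, 0 ≤ C ∧ ∀ f f' : Lp ℂ 1 (volume : Measure (Eu d)),
      TemperedDistribution.besselPotential (Eu d) ℂ t f = (f' : 𝓢'(Eu d, ℂ)) →
      ∀ j : ℕ, ∃ G : Lp ℂ 1 (volume : Measure (Eu d)),
        TemperedDistribution.besselPotential (Eu d) ℂ s f = (G : 𝓢'(Eu d, ℂ)) ∧
        ‖G‖ ≤ C * (((2 : ℝ) ^ j) ^ s * ‖f‖ + ((2 : ℝ) ^ j) ^ (s - t) * ‖f'‖) := by
  obtain ⟨C₁, hC₁, H₁⟩ := (besselSymbol d s).exists_piece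
  obtain ⟨C₂, hC₂, H₂⟩ := (besselSymbol d (s - t)).exists_piece
  set q : ℝ := 2 ^ s with hq
  set r : ℝ := 2 ^ (s - t) with hr
  have hq1 : 1 < q := Real.one_lt_rpow one_lt_two hs
  have hr0 : 0 < r := by positivity
  have hr1 : r < 1 := Real.rpow_lt_one_of_one_lt_of_neg one_lt_two (by linarith)
  have hq1' : 0 < q - 1 := by linarith
  have hr1' : 0 < 1 - r := by linarith
  refine ⟨C₁ * (q - 1)⁻¹ + C₂ * (1 - r)⁻¹, by positivity, fun f f' hf j => ?_⟩
  -- frequencies below `2 ^ j` are estimated by `f`, the others by `J^t f`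
  let b : ℕ → ℝ := fun k => if k < j then C₁ * q ^ k * ‖f‖ else C₂ * r ^ k * ‖f'‖
  have hF : ∀ k, ∃ F : Lp ℂ 1 (volume : Measure (Eu d)),
      ((besselSymbol d s).piece k).op f = (F : 𝓢'(Eu d, ℂ)) ∧ ‖F‖ ≤ b k := by
    intro k
    by_cases hk : k < j
    · obtain ⟨F, h1, h2, -⟩ := H₁ volume f f (hasDensity_coe f) k
      refine ⟨F, h1, ?_⟩
      rw [two_pow_rpow, ← L1.norm_eq_integral_norm] at h2
      simpa [b, hk] using h2
    · obtain ⟨F, h1, h2, -⟩ := H₂ volume f' f' (hasDensity_coe f') k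
      refine ⟨F, ?_, ?_⟩
      · rw [besselSymbol_piece_op s t, hf, h1]
      · rw [two_pow_rpow, ← L1.norm_eq_integral_norm] at h2
        simpa [b, hk] using h2
  choose F hF hF' using hF
  have hbj : ∀ k, b (k + j) = C₂ * r ^ j * ‖f'‖ * r ^ k := by
    intro k
    simp only [b, if_neg (by omega : ¬ k + j < j), pow_add]
    ring
  have hsum' : Summable fun k => b (k + j) := by
    simp_rw [hbj]
    exact (summable_geometric_of_lt_one hr0.le hr1).mul_left _
  have hsum : Summable b := (summable_nat_add_iff j).1 hsum'
  obtain ⟨G, -, hG, hG'⟩ := exists_hasSum_of_tendsto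
    (v := TemperedDistribution.besselPotential (Eu d) ℂ s f) hsum hF' fun φ => by
      simp_rw [← hF, besselPotential_eq_op]
      exact (besselSymbol d s).tendsto_sum_piece (hasDensity_coe f) φ
  refine ⟨G, hG, hG'.trans ?_⟩
  rw [← hsum.sum_add_tsum_nat_add j]
  simp_rw [hbj]
  rw [tsum_mul_left, tsum_geometric_of_lt_one hr0.le hr1]
  have e1 : ∑ k ∈ Finset.range j, b k ≤ C₁ * (q - 1)⁻¹ * q ^ j * ‖f‖ := by
    have : ∑ k ∈ Finset.range j, b k = C₁ * ‖f‖ * ∑ k ∈ Finset.range j, q ^ k := by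
      rw [Finset.mul_sum]
      refine Finset.sum_congr rfl fun k hk => ?_
      simp only [b, if_pos (Finset.mem_range.1 hk)]
      ring
    rw [this, geom_sum_eq hq1.ne']
    calc _ ≤ C₁ * ‖f‖ * (q ^ j / (q - 1)) := by
          gcongr
          linarith
      _ = _ := by
          rw [div_eq_mul_inv]
          ring
  rw [two_pow_rpow, two_pow_rpow, ← hq, ← hr]
  have p1 : 0 ≤ C₁ * (q - 1)⁻¹ * (r ^ j * ‖f'‖) := by positivity
  have p2 : 0 ≤ C₂ * (1 - r)⁻¹ * (q ^ j * ‖f‖) := by positivity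
  linarith

/-- An operator of order `m` maps finite measures into the Bessel potential spaces of order less
than `-m`. -/
theorem Symbol.exists_besselPotential (a : Symbol d m) (hm : m < 0) {s : ℝ} (hs : s < -m) :
    ∃ C : ℝ, 0 ≤ C ∧ ∀ (ν : Measure (Eu d)) [SFinite ν] (h : Eu d → ℂ) (u : 𝓢'(Eu d, ℂ)),
      HasDensity u ν h → ∃ F : Lp ℂ 1 (volume : Measure (Eu d)),
        TemperedDistribution.besselPotential (Eu d) ℂ s (a.op u) = (F : 𝓢'(Eu d, ℂ)) ∧
        ‖F‖ ≤ C * ∫ y, ‖h y‖ ∂ν := by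
  have key : ∀ {s : ℝ}, 0 < s → s < -m →
      ∃ C : ℝ, 0 ≤ C ∧ ∀ (ν : Measure (Eu d)) [SFinite ν] (h : Eu d → ℂ) (u : 𝓢'(Eu d, ℂ)),
      HasDensity u ν h → ∃ F : Lp ℂ 1 (volume : Measure (Eu d)),
        TemperedDistribution.besselPotential (Eu d) ℂ s (a.op u) = (F : 𝓢'(Eu d, ℂ)) ∧
        ‖F‖ ≤ C * ∫ y, ‖h y‖ ∂ν := by
    intro s hs0 hs
    -- the order `2 n` exceeds `s`, and `J^(2n)` acts on the pieces through a symbol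
    obtain ⟨n, hn⟩ := exists_nat_gt s
    obtain ⟨b, hb⟩ := a.exists_besselPotential_even n
    obtain ⟨C₁, hC₁, H₁⟩ := a.exists_piece
    obtain ⟨C₂, hC₂, H₂⟩ := b.exists_piece
    obtain ⟨C, hC, H⟩ := exists_besselPotential_interpolation (d := d) (t := 2 * n) hs0
      (by linarith)
    have hsum := summable_two_pow_rpow (r := m + s) (by linarith)
    refine ⟨C * (C₁ + C₂) * ∑' j : ℕ, ((2 : ℝ) ^ j) ^ (m + s),
      mul_nonneg (by positivity) (tsum_nonneg fun j => by positivity), fun ν _ h u hu => ?_⟩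
    have hG : ∀ j, ∃ G : Lp ℂ 1 (volume : Measure (Eu d)),
        TemperedDistribution.besselPotential (Eu d) ℂ s ((a.piece j).op u) = (G : 𝓢'(Eu d, ℂ)) ∧
        ‖G‖ ≤ C * (C₁ + C₂) * ((2 : ℝ) ^ j) ^ (m + s) * ∫ y, ‖h y‖ ∂ν := by
      intro j
      obtain ⟨F₁, e₁, h₁, -⟩ := H₁ ν h u hu j
      obtain ⟨F₂, e₂, h₂, -⟩ := H₂ ν h u hu j
      obtain ⟨G, e, hG⟩ := H F₁ F₂ (by rw [← e₁, ← e₂, hb]) j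
      refine ⟨G, by rw [e₁, e], hG.trans ?_⟩
      have q1 : ((2 : ℝ) ^ j) ^ (m + s) = ((2 : ℝ) ^ j) ^ s * ((2 : ℝ) ^ j) ^ m := by
        rw [← Real.rpow_add (by positivity)]
        ring_nf
      have q2 : ((2 : ℝ) ^ j) ^ (m + s) =
          ((2 : ℝ) ^ j) ^ (s - 2 * n) * ((2 : ℝ) ^ j) ^ (m + 2 * n) := by
        rw [← Real.rpow_add (by positivity)]
        ring_nf
      calc _ ≤ C * (((2 : ℝ) ^ j) ^ s * (C₁ * ((2 : ℝ) ^ j) ^ m * ∫ y, ‖h y‖ ∂ν) +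
            ((2 : ℝ) ^ j) ^ (s - 2 * n) *
              (C₂ * ((2 : ℝ) ^ j) ^ (m + 2 * n) * ∫ y, ‖h y‖ ∂ν)) := by gcongr
        _ = C * (C₁ * (((2 : ℝ) ^ j) ^ s * ((2 : ℝ) ^ j) ^ m) + C₂ *
            (((2 : ℝ) ^ j) ^ (s - 2 * n) * ((2 : ℝ) ^ j) ^ (m + 2 * n))) * ∫ y, ‖h y‖ ∂ν := by
            ring
        _ = _ := by
            rw [← q1, ← q2]
            ring
    choose G hG hG' using hG
    obtain ⟨F, -, hF, hF'⟩ := exists_hasSum_of_tendsto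
      (v := TemperedDistribution.besselPotential (Eu d) ℂ s (a.op u))
      ((hsum.mul_left (C * (C₁ + C₂))).mul_right (∫ y, ‖h y‖ ∂ν)) hG' fun φ => by
        simp_rw [← hG]
        exact a.tendsto_sum_piece hu _
    refine ⟨F, hF, hF'.trans (le_of_eq ?_)⟩
    rw [tsum_mul_right, tsum_mul_left]
  rcases lt_or_ge 0 s with h | h
  · exact key h hs
  -- for `s ≤ 0`, `J^s` is `J^(-m/2)` followed by an operator of negative order
  · obtain ⟨C, hC, H⟩ := key (s := -m / 2) (by linarith) (by linarith)
    obtain ⟨C', hC', H'⟩ := (besselSymbol d (s - -m / 2)).exists_integrable (by linarith)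
    refine ⟨C' * C, by positivity, fun ν _ h u hu => ?_⟩
    obtain ⟨F, e, hF⟩ := H ν h u hu
    obtain ⟨G, e', hG⟩ := H' volume F F (hasDensity_coe F)
    refine ⟨G, ?_, ?_⟩
    · rw [← e', ← e, ← besselPotential_eq_op,
        TemperedDistribution.besselPotential_besselPotential_apply]
      congr 2
      ring
    · rw [← L1.norm_eq_integral_norm] at hG
      rw [mul_assoc]
      exact hG.trans (by gcongr)

end Bessel

/-! ### Moduli of continuity in `L¹` and the Gagliardo seminorm -/

section Gagliardo

open scoped ENNReal

variable {d : ℕ} {m : ℝ}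

/-- The translation `F ↦ F(· + z)` of `L¹(ℝᵈ)`. -/
noncomputable def translate (z : Eu d) :
    Lp ℂ 1 (volume : Measure (Eu d)) →ₗᵢ[ℂ] Lp ℂ 1 (volume : Measure (Eu d)) :=
  Lp.compMeasurePreservingₗᵢ ℂ (fun x => x + z) (measurePreserving_add_right volume z)

theorem enorm_translate_sub (z : Eu d) (F : Lp ℂ 1 (volume : Measure (Eu d))) :
    ‖translate z F - F‖ₑ = ∫⁻ x, ‖F (x + z) - F x‖ₑ := by
  rw [← ofReal_norm, L1.ofReal_norm_eq_lintegral]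
  refine lintegral_congr_ae ?_
  filter_upwards [Lp.coeFn_sub (translate z F) F,
    Lp.coeFn_compMeasurePreserving F (measurePreserving_add_right volume z)] with x h1 h2
  rw [h1, Pi.sub_apply]
  congr 2

/-- For an operator of order `m < 0`, the image of a finite measure is Hölder continuous in `L¹`, of
each exponent `θ ≤ 1` less than `-m`. -/
theorem Symbol.exists_translate_bound (a : Symbol d m) (hm : m < 0) :
    ∃ C : ℝ → ℝ, (∀ θ, 0 ≤ C θ) ∧
      ∀ (ν : Measure (Eu d)) [SFinite ν] (h : Eu d → ℂ) (u : 𝓢'(Eu d, ℂ)),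
      HasDensity u ν h → ∃ F : Lp ℂ 1 (volume : Measure (Eu d)), a.op u = (F : 𝓢'(Eu d, ℂ)) ∧
        ∀ θ, 0 ≤ θ → θ ≤ 1 → θ < -m → ∀ z, ∫⁻ x, ‖F (x + z) - F x‖ₑ ≤
          ENNReal.ofReal (C θ * ‖z‖ ^ θ * ∫ y, ‖h y‖ ∂ν) := by
  obtain ⟨C, hC, H⟩ := a.exists_piece
  refine ⟨fun θ => 2 * C * ∑' j : ℕ, ((2 : ℝ) ^ j) ^ (m + θ),
    fun θ => mul_nonneg (by positivity) (tsum_nonneg fun j => by positivity),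
    fun ν _ h u hu => ?_⟩
  have hM : 0 ≤ ∫ y, ‖h y‖ ∂ν := integral_nonneg fun y => norm_nonneg _
  choose F hF hF' hF'' using H ν h u hu
  obtain ⟨G, hsum, hG, -⟩ := exists_hasSum_of_tendsto (v := a.op u)
    (((summable_two_pow_rpow hm).mul_left C).mul_right (∫ y, ‖h y‖ ∂ν)) hF' fun φ => by
      simp_rw [← hF]
      exact a.tendsto_sum_piece hu φ
  refine ⟨G, hG, fun θ hθ0 hθ1 hθm z => ?_⟩
  have hj : ∀ j, ‖translate z (F j) - F j‖ ≤
      2 * C * ‖z‖ ^ θ * (∫ y, ‖h y‖ ∂ν) * ((2 : ℝ) ^ j) ^ (m + θ) := by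
    intro j
    have h1 : ‖translate z (F j) - F j‖ ≤ 2 * (C * ((2 : ℝ) ^ j) ^ m * ∫ y, ‖h y‖ ∂ν) := by
      refine (norm_sub_le _ _).trans ?_
      rw [LinearIsometry.norm_map]
      linarith [hF' j]
    have h2 : ‖translate z (F j) - F j‖ ≤
        C * ((2 : ℝ) ^ j) ^ m * (∫ y, ‖h y‖ ∂ν) * (2 ^ j * ‖z‖) := by
      have := hF'' j z
      rw [← enorm_translate_sub, ← ofReal_norm,
        ENNReal.ofReal_le_ofReal_iff (by positivity)] at this
      refine this.trans (le_of_eq ?_)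
      rw [Real.rpow_add (by positivity), Real.rpow_one]
      ring
    rw [Real.rpow_add (by positivity)]
    have h3 : 0 ≤ C * ((2 : ℝ) ^ j) ^ m * ∫ y, ‖h y‖ ∂ν := by positivity
    have ht : 0 ≤ 2 ^ j * ‖z‖ := by positivity
    have e : 2 * C * ‖z‖ ^ θ * (∫ y, ‖h y‖ ∂ν) * (((2 : ℝ) ^ j) ^ m * ((2 : ℝ) ^ j) ^ θ) =
        2 * ((C * ((2 : ℝ) ^ j) ^ m * ∫ y, ‖h y‖ ∂ν) * (2 ^ j * ‖z‖) ^ θ) := by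
      rw [Real.mul_rpow (by positivity) (by positivity)]
      ring
    rw [e]
    -- the bounds by `2` and by `2 ^ j |z|` interpolate to one by `2 (2 ^ j |z|) ^ θ`
    rcases le_total 1 (2 ^ j * ‖z‖) with h4 | h4
    · exact h1.trans (mul_le_mul_of_nonneg_left
        (le_mul_of_one_le_right h3 (Real.one_le_rpow h4 hθ0)) zero_le_two)
    · have h5 : 2 ^ j * ‖z‖ ≤ (2 ^ j * ‖z‖) ^ θ := Real.self_le_rpow_of_le_one ht h4 hθ1
      have h6 := mul_le_mul_of_nonneg_left h5 h3
      linarith [mul_nonneg h3 ht]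
  have hs : HasSum (fun j => translate z (F j) - F j) (translate z G - G) :=
    (hsum.mapL (translate z).toContinuousLinearMap).sub hsum
  have hb := ((summable_two_pow_rpow (r := m + θ) (by linarith)).mul_left
    (2 * C * ‖z‖ ^ θ * (∫ y, ‖h y‖ ∂ν)))
  have := tsum_of_norm_bounded hb.hasSum hj
  rw [hs.tsum_eq, tsum_mul_left] at this
  rw [← enorm_translate_sub, ← ofReal_norm]
  refine ENNReal.ofReal_le_ofReal (this.trans (le_of_eq ?_))
  ring

/-- The exponent `ρ > σ` makes the singularity at `0` integrable, and `σ > 0` the decay at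
infinity. -/
theorem integrable_min_rpow_div (hd : 0 < d) {σ ρ : ℝ} (hσ : 0 < σ) (hρ : σ < ρ) :
    Integrable fun z : Eu d => min 1 (‖z‖ ^ ρ) / ‖z‖ ^ ((d : ℝ) + σ) := by
  have hm : Measurable fun z : Eu d => min 1 (‖z‖ ^ ρ) / ‖z‖ ^ ((d : ℝ) + σ) := by fun_prop
  have hpos : ∀ z : Eu d, 0 ≤ min 1 (‖z‖ ^ ρ) / ‖z‖ ^ ((d : ℝ) + σ) := fun z => by positivity
  rw [← integrableOn_univ, ← Set.union_compl_self (Metric.ball (0 : Eu d) 1)]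
  refine IntegrableOn.union ?_ ?_
  · refine integrableOn_ball_of_norm_le_rpow (C := 1) (α := d + σ - ρ)
      (by rw [finrank_euclideanSpace_fin]; exact hd)
      (by rw [finrank_euclideanSpace_fin]; linarith)
      (Filter.Eventually.of_forall fun z => ?_) hm.aestronglyMeasurable
    rw [Real.norm_of_nonneg (hpos z), one_mul]
    rcases eq_or_ne z 0 with rfl | hz
    · rw [norm_zero, Real.zero_rpow (by linarith), min_eq_right zero_le_one, zero_div]
      positivity
    · have hz' : 0 < ‖z‖ := norm_pos_iff.2 hz
      rw [show -((d : ℝ) + σ - ρ) = ρ - (d + σ) by ring, Real.rpow_sub hz']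
      gcongr
      exact min_le_right _ _
  · have h1 : Integrable fun z : Eu d => 2 ^ ((d : ℝ) + σ) * (1 + ‖z‖) ^ (-((d : ℝ) + σ)) :=
      (integrable_one_add_norm (by rw [finrank_euclideanSpace_fin]; linarith)).const_mul _
    refine h1.integrableOn.mono' hm.aestronglyMeasurable ?_
    refine (ae_restrict_iff' Metric.isOpen_ball.measurableSet.compl).2
      (Filter.Eventually.of_forall fun z hz => ?_)
    have hz' : 1 ≤ ‖z‖ := by simpa using hz
    rw [Real.norm_of_nonneg (hpos z), Real.rpow_neg (by positivity), ← div_eq_mul_inv,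
      ← Real.div_rpow (by positivity) (by positivity)]
    calc _ ≤ 1 / ‖z‖ ^ ((d : ℝ) + σ) := by
          gcongr
          exact min_le_left _ _
      _ = (1 / ‖z‖) ^ ((d : ℝ) + σ) := by
          rw [Real.div_rpow zero_le_one (by positivity), Real.one_rpow]
      _ ≤ _ := by
          refine Real.rpow_le_rpow (by positivity) ?_ (by positivity)
          rw [div_le_div_iff₀ (by positivity) (by positivity)]
          linarith

/-- The Gagliardo seminorm as an integral of moduli of continuity in `L¹`. -/
theorem lintegral_gagliardo_eq (F : Lp ℂ 1 (volume : Measure (Eu d))) (e : ℝ) :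
    ∫⁻ x : Eu d, ∫⁻ y : Eu d, ‖F x - F y‖ₑ / ‖x - y‖ₑ ^ e =
      ∫⁻ z : Eu d, (∫⁻ x : Eu d, ‖F (x + z) - F x‖ₑ) / ‖z‖ₑ ^ e := by
  have hF : Measurable (F : Eu d → ℂ) := (Lp.stronglyMeasurable F).measurable
  calc _ = ∫⁻ x : Eu d, ∫⁻ z : Eu d, ‖F (x + z) - F x‖ₑ / ‖z‖ₑ ^ e := by
        refine lintegral_congr fun x => ?_
        rw [← lintegral_add_left_eq_self _ x]
        refine lintegral_congr fun z => ?_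
        rw [enorm_sub_rev, sub_add_cancel_left, enorm_neg]
    _ = ∫⁻ z : Eu d, ∫⁻ x : Eu d, ‖F (x + z) - F x‖ₑ / ‖z‖ₑ ^ e := by
        refine lintegral_lintegral_swap (Measurable.aemeasurable ?_)
        have h1 : Measurable fun p : Eu d × Eu d => F (p.1 + p.2) :=
          hF.comp (measurable_fst.add measurable_snd)
        have h2 : Measurable fun p : Eu d × Eu d => F p.1 := hF.comp measurable_fst
        exact (h1.sub h2).enorm.div (measurable_snd.enorm.pow_const e)
    _ = _ := by
        refine lintegral_congr fun z => ?_
        simp_rw [div_eq_mul_inv]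
        exact lintegral_mul_const _
          ((hF.comp (measurable_id.add_const z)).sub hF).enorm

/-- The modulus of continuity is used with an exponent `ρ > σ` for small `z`, and with exponent `0`
for large `z`. -/
theorem Symbol.exists_gagliardo (a : Symbol d m) {σ : ℝ} (hσ0 : 0 < σ) (hσ1 : σ < 1)
    (hσ : σ < -m) :
    ∃ C : ℝ, 0 ≤ C ∧ ∀ (ν : Measure (Eu d)) [SFinite ν] (h : Eu d → ℂ) (u : 𝓢'(Eu d, ℂ)),
      HasDensity u ν h → gagliardoSeminorm σ (a.op u) ≤ ENNReal.ofReal (C * ∫ y, ‖h y‖ ∂ν) := by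
  obtain ⟨C, hC, H⟩ := a.exists_translate_bound (by linarith)
  -- for `d = 0` all differences vanish, and the quotient `0 / 0` is `0`
  rcases Nat.eq_zero_or_pos d with rfl | hd
  · refine ⟨0, le_rfl, fun ν _ h u hu => ?_⟩
    obtain ⟨F, hF, -⟩ := H ν h u hu
    refine (iInf₂_le F hF).trans (le_of_eq ?_)
    have : ∀ x y : Eu 0, ‖F x - F y‖ₑ / ‖x - y‖ₑ ^ (((0 : ℕ) : ℝ) + σ) = 0 := fun x y => by
      rw [Subsingleton.elim x y, sub_self, enorm_zero, ENNReal.zero_div]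
    simp only [this, lintegral_zero, zero_mul, ENNReal.ofReal_zero]
  -- room for the decay near `z = 0`: `σ < ρ < min 1 (-m)`
  obtain ⟨ρ, hσρ, hρ⟩ := exists_between (lt_min hσ1 hσ)
  have hρ1 := hρ.le.trans (min_le_left _ _)
  have hρm := hρ.trans_le (min_le_right _ _)
  have hI := integrable_min_rpow_div hd hσ0 hσρ
  set I := ∫ z : Eu d, min 1 (‖z‖ ^ ρ) / ‖z‖ ^ ((d : ℝ) + σ) with hI_def
  have hI0 : 0 ≤ I := integral_nonneg fun z => by positivity
  have hC0 := hC 0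
  have hCρ := hC ρ
  refine ⟨(C 0 + C ρ) * I, by positivity, fun ν _ h u hu => ?_⟩
  obtain ⟨F, hF, hF'⟩ := H ν h u hu
  have hM : 0 ≤ ∫ y, ‖h y‖ ∂ν := integral_nonneg fun y => norm_nonneg _
  refine (iInf₂_le F hF).trans ?_
  rw [lintegral_gagliardo_eq]
  have key : ∀ z : Eu d, (∫⁻ x : Eu d, ‖F (x + z) - F x‖ₑ) / ‖z‖ₑ ^ ((d : ℝ) + σ) ≤
      ENNReal.ofReal ((C 0 + C ρ) * (∫ y, ‖h y‖ ∂ν) *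
        (min 1 (‖z‖ ^ ρ) / ‖z‖ ^ ((d : ℝ) + σ))) := by
    intro z
    rcases eq_or_ne z 0 with rfl | hz
    · simp
    have hz' : 0 < ‖z‖ := norm_pos_iff.2 hz
    rw [← ofReal_norm z, ENNReal.ofReal_rpow_of_pos hz', ← mul_div_assoc,
      ENNReal.ofReal_div_of_pos (by positivity)]
    gcongr
    rcases le_total 1 (‖z‖ ^ ρ) with h1 | h1
    · rw [min_eq_left h1]
      refine (hF' 0 le_rfl zero_le_one (by linarith) z).trans (ENNReal.ofReal_le_ofReal ?_)
      rw [Real.rpow_zero, mul_one, mul_one]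
      gcongr
      linarith
    · rw [min_eq_right h1]
      refine (hF' ρ (by linarith) hρ1 hρm z).trans (ENNReal.ofReal_le_ofReal ?_)
      rw [mul_right_comm]
      gcongr
      linarith
  refine (lintegral_mono key).trans (le_of_eq ?_)
  rw [← ofReal_integral_eq_lintegral_ofReal (hI.const_mul _)
    (Filter.Eventually.of_forall fun z => by positivity), integral_const_mul, ← hI_def]
  congr 1
  ring

end Gagliardo

/-! ### Complex measures -/

section Measures

open scoped ENNReal

variable {d : ℕ}

/-- A complex measure has a density, integrable with norm at most twice the total variation, with
respect to the sum of the Jordan parts of its real and imaginary parts. -/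
theorem exists_hasDensity (μ : ComplexMeasure (Eu d)) :
    ∃ (ν : Measure (Eu d)) (_ : IsFiniteMeasure ν) (h : Eu d → ℂ),
      HasDensity (measureDistribution μ) ν h ∧
        ENNReal.ofReal (∫ y, ‖h y‖ ∂ν) ≤ 2 * totalVariationNorm μ := by
  set P := (ComplexMeasure.re μ).toJordanDecomposition with hP
  set Q := (ComplexMeasure.im μ).toJordanDecomposition with hQ
  let ν : Measure (Eu d) := (P.posPart + P.negPart) + (Q.posPart + Q.negPart)
  have hν : IsFiniteMeasure ν := by
    dsimp only [ν]
    infer_instance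
  have a1 : P.posPart ≪ ν := Measure.absolutelyContinuous_of_le
    ((Measure.le_add_right le_rfl).trans (Measure.le_add_right le_rfl))
  have a2 : P.negPart ≪ ν := Measure.absolutelyContinuous_of_le
    ((Measure.le_add_left le_rfl).trans (Measure.le_add_right le_rfl))
  have a3 : Q.posPart ≪ ν := Measure.absolutelyContinuous_of_le
    ((Measure.le_add_right le_rfl).trans (Measure.le_add_left le_rfl))
  have a4 : Q.negPart ≪ ν := Measure.absolutelyContinuous_of_le
    ((Measure.le_add_left le_rfl).trans (Measure.le_add_left le_rfl))
  let r : Measure (Eu d) → Eu d → ℝ := fun κ y => (κ.rnDeriv ν y).toReal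
  have hr0 : ∀ κ y, 0 ≤ r κ y := fun κ y => ENNReal.toReal_nonneg
  have hr : ∀ (κ : Measure (Eu d)) [IsFiniteMeasure κ], Integrable (r κ) ν := fun κ _ =>
    Measure.integrable_toReal_rnDeriv
  have hrc : ∀ (κ : Measure (Eu d)) [IsFiniteMeasure κ], Integrable (fun y => (r κ y : ℂ)) ν :=
    fun κ _ => (hr κ).ofReal
  have hφ : ∀ (φ : 𝓢(Eu d, ℂ)) (κ : Measure (Eu d)) [IsFiniteMeasure κ],
      Integrable (fun y => φ y * (r κ y : ℂ)) ν := fun φ κ _ =>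
    (hrc κ).bdd_mul φ.continuous.aestronglyMeasurable
      (Filter.Eventually.of_forall fun y => φ.norm_le_seminorm ℂ y)
  have hint : ∀ (φ : 𝓢(Eu d, ℂ)) (κ : Measure (Eu d)) [IsFiniteMeasure κ], κ ≪ ν →
      ∫ y, φ y ∂κ = ∫ y, φ y * (r κ y : ℂ) ∂ν := by
    intro φ κ _ hκ
    have := Measure.haveLebesgueDecomposition_of_sigmaFinite κ ν
    rw [← integral_rnDeriv_smul hκ]
    congr 1
    ext y
    rw [Complex.real_smul, mul_comm]
  refine ⟨ν, hν, fun y => ((r P.posPart y : ℂ) - r P.negPart y) +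
    Complex.I * ((r Q.posPart y : ℂ) - r Q.negPart y), ⟨?_, fun φ => ?_⟩, ?_⟩
  · exact ((hrc _).sub (hrc _)).add (((hrc _).sub (hrc _)).const_mul _)
  · have e : measureDistribution μ φ = (∫ y, φ y ∂P.posPart - ∫ y, φ y ∂P.negPart) +
        Complex.I * (∫ y, φ y ∂Q.posPart - ∫ y, φ y ∂Q.negPart) := rfl
    have s1 : Integrable (fun y => φ y * (r P.posPart y : ℂ) - φ y * (r P.negPart y : ℂ)) ν :=
      (hφ φ _).sub (hφ φ _)
    have s2 : Integrable (fun y => Complex.I *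
        (φ y * (r Q.posPart y : ℂ) - φ y * (r Q.negPart y : ℂ))) ν :=
      ((hφ φ _).sub (hφ φ _)).const_mul _
    rw [e, hint φ _ a1, hint φ _ a2, hint φ _ a3, hint φ _ a4,
      ← integral_sub (hφ φ _) (hφ φ _), ← integral_sub (hφ φ _) (hφ φ _), ← integral_const_mul,
      ← integral_add s1 s2]
    congr 1
    ext y
    ring
  · have h1 : ∀ y, ‖((r P.posPart y : ℂ) - r P.negPart y) +
        Complex.I * ((r Q.posPart y : ℂ) - r Q.negPart y)‖ ≤
        (r P.posPart y + r P.negPart y) + (r Q.posPart y + r Q.negPart y) := by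
      intro y
      have h2 : ∀ κ, ‖(r κ y : ℂ)‖ = r κ y := fun κ => by
        rw [Complex.norm_real, Real.norm_of_nonneg (hr0 κ y)]
      refine (norm_add_le _ _).trans (add_le_add ((norm_sub_le _ _).trans ?_) ?_)
      · rw [h2, h2]
      · rw [norm_mul, Complex.norm_I, one_mul]
        refine (norm_sub_le _ _).trans ?_
        rw [h2, h2]
    have h3 : ∫ y, ‖((r P.posPart y : ℂ) - r P.negPart y) +
        Complex.I * ((r Q.posPart y : ℂ) - r Q.negPart y)‖ ∂ν ≤
        (P.posPart.real Set.univ + P.negPart.real Set.univ) +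
          (Q.posPart.real Set.univ + Q.negPart.real Set.univ) := by
      refine (integral_mono_of_nonneg (Filter.Eventually.of_forall fun y => norm_nonneg _)
        (((hr _).add (hr _)).add ((hr _).add (hr _))) (Filter.Eventually.of_forall h1)).trans
        (le_of_eq ?_)
      have t1 : Integrable (fun y => r P.posPart y + r P.negPart y) ν := (hr _).add (hr _)
      have t2 : Integrable (fun y => r Q.posPart y + r Q.negPart y) ν := (hr _).add (hr _)
      simp only [Pi.add_apply]
      rw [integral_add t1 t2, integral_add (hr _) (hr _),
        integral_add (hr _) (hr _)]
      simp only [r]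
      rw [Measure.integral_toReal_rnDeriv a1, Measure.integral_toReal_rnDeriv a2,
        Measure.integral_toReal_rnDeriv a3, Measure.integral_toReal_rnDeriv a4]
    -- `|re μ| ≤ |μ|` as measures, and the same for `im μ`
    have hre : P.posPart Set.univ + P.negPart Set.univ ≤ totalVariationNorm μ := by
      have : P.posPart Set.univ + P.negPart Set.univ =
          (ComplexMeasure.re μ).totalVariation Set.univ := rfl
      rw [this, SignedMeasure.totalVariation_eq_variation]
      refine VectorMeasure.variation_le_of_forall_enorm_le (fun E hE => ?_) Set.univ
      refine le_trans ?_ (VectorMeasure.enorm_measure_le_variation μ E)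
      rw [← ofReal_norm, ← ofReal_norm]
      exact ENNReal.ofReal_le_ofReal (Complex.abs_re_le_norm (μ E))
    have him : Q.posPart Set.univ + Q.negPart Set.univ ≤ totalVariationNorm μ := by
      have : Q.posPart Set.univ + Q.negPart Set.univ =
          (ComplexMeasure.im μ).totalVariation Set.univ := rfl
      rw [this, SignedMeasure.totalVariation_eq_variation]
      refine VectorMeasure.variation_le_of_forall_enorm_le (fun E hE => ?_) Set.univ
      refine le_trans ?_ (VectorMeasure.enorm_measure_le_variation μ E)
      rw [← ofReal_norm, ← ofReal_norm]
      exact ENNReal.ofReal_le_ofReal (Complex.abs_im_le_norm (μ E))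
    refine (ENNReal.ofReal_le_ofReal h3).trans ?_
    rw [ENNReal.ofReal_add (by positivity) (by positivity),
      ENNReal.ofReal_add (by positivity) (by positivity),
      ENNReal.ofReal_add (by positivity) (by positivity), two_mul]
    rw [ofReal_measureReal, ofReal_measureReal, ofReal_measureReal, ofReal_measureReal]
    exact add_le_add hre him

/-- A functional on distributions that is bounded on integrable densities is bounded on complex
measures. -/
theorem exists_bound_of_density {N : 𝓢'(Eu d, ℂ) → ℝ≥0∞}
    (hN : ∃ C : ℝ, 0 ≤ C ∧ ∀ (ν : Measure (Eu d)) [SFinite ν] (h : Eu d → ℂ) (u : 𝓢'(Eu d, ℂ)),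
      HasDensity u ν h → N u ≤ ENNReal.ofReal (C * ∫ y, ‖h y‖ ∂ν)) :
    ∃ C : NNReal, ∀ μ : ComplexMeasure (Eu d),
      N (measureDistribution μ) ≤ C * totalVariationNorm μ := by
  obtain ⟨C, hC, H⟩ := hN
  refine ⟨C.toNNReal * 2, fun μ => ?_⟩
  obtain ⟨ν, _, h, hu, hle⟩ := exists_hasDensity μ
  refine (H ν h _ hu).trans ?_
  rw [ENNReal.ofReal_mul hC, ENNReal.coe_mul, mul_assoc]
  exact mul_le_mul_right hle _

theorem l1Norm_le {u : 𝓢'(Eu d, ℂ)} {F : Lp ℂ 1 (volume : Measure (Eu d))}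
    (hF : u = (F : 𝓢'(Eu d, ℂ))) {C : ℝ} (h : ‖F‖ ≤ C) : l1Norm u ≤ ENNReal.ofReal C := by
  rw [hF, l1Norm_coe, ← ofReal_norm]
  exact ENNReal.ofReal_le_ofReal h

theorem Symbol.exists_l1Norm_le {m : ℝ} (a : Symbol d m) (hm : m < 0) :
    ∃ C : NNReal, ∀ μ : ComplexMeasure (Eu d),
      l1Norm (a.op (measureDistribution μ)) ≤ C * totalVariationNorm μ := by
  obtain ⟨C, hC, H⟩ := a.exists_integrable hm
  refine exists_bound_of_density (N := fun u => l1Norm (a.op u)) ⟨C, hC, fun ν _ h u hu => ?_⟩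
  obtain ⟨F, hF, hF'⟩ := H ν h u hu
  exact l1Norm_le hF hF'

theorem Symbol.exists_besselNorm_le {m : ℝ} (a : Symbol d m) (hm : m < 0) {s : ℝ} (hs : s < -m) :
    ∃ C : NNReal, ∀ μ : ComplexMeasure (Eu d),
      besselNorm s (a.op (measureDistribution μ)) ≤ C * totalVariationNorm μ := by
  obtain ⟨C, hC, H⟩ := a.exists_besselPotential hm hs
  refine exists_bound_of_density (N := fun u => besselNorm s (a.op u))
    ⟨C, hC, fun ν _ h u hu => ?_⟩
  obtain ⟨F, hF, hF'⟩ := H ν h u hu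
  exact l1Norm_le hF hF'

theorem Symbol.exists_slobodeckijNorm_le {m : ℝ} (a : Symbol d m) {s : ℝ} (hs0 : 0 ≤ s)
    (hs : s < -m) :
    ∃ C : NNReal, ∀ μ : ComplexMeasure (Eu d),
      slobodeckijNorm s (a.op (measureDistribution μ)) ≤ C * totalVariationNorm μ := by
  have h1 : ∀ (n : ℕ) (w : Fin n → Fin d), ∃ C : NNReal, n ∈ Finset.range (⌊s⌋₊ + 1) →
      ∀ μ : ComplexMeasure (Eu d), l1Norm (partialDeriv w (a.op (measureDistribution μ))) ≤
        C * totalVariationNorm μ := by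
    intro n w
    by_cases hn : n ∈ Finset.range (⌊s⌋₊ + 1)
    · obtain ⟨b, hb⟩ := a.exists_partialDeriv w
      have hn' : (n : ℝ) ≤ s := (Nat.le_floor_iff hs0).1 (by simpa [Nat.lt_succ_iff] using hn)
      obtain ⟨C, hC⟩ := b.exists_l1Norm_le (by linarith)
      exact ⟨C, fun _ μ => by rw [hb]; exact hC μ⟩
    · exact ⟨0, fun h => absurd h hn⟩
  have h2 : ∀ w : Fin ⌊s⌋₊ → Fin d, ∃ C : NNReal, s ≠ ⌊s⌋₊ → ∀ μ : ComplexMeasure (Eu d),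
      gagliardoSeminorm (s - ⌊s⌋₊) (partialDeriv w (a.op (measureDistribution μ))) ≤
        C * totalVariationNorm μ := by
    intro w
    by_cases hn : s = ⌊s⌋₊
    · exact ⟨0, fun h => absurd hn h⟩
    · obtain ⟨b, hb⟩ := a.exists_partialDeriv w
      have hlt : (⌊s⌋₊ : ℝ) < s := lt_of_le_of_ne (Nat.floor_le hs0) (Ne.symm hn)
      have hlt' := Nat.lt_floor_add_one s
      obtain ⟨C, hC⟩ := exists_bound_of_density
        (N := fun u => gagliardoSeminorm (s - ⌊s⌋₊) (b.op u))
        (b.exists_gagliardo (by linarith) (by linarith) (by linarith))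
      exact ⟨C, fun _ μ => by rw [hb]; exact hC μ⟩
  choose C₁ hC₁ using h1
  choose C₂ hC₂ using h2
  refine ⟨(∑ n ∈ Finset.range (⌊s⌋₊ + 1), ∑ w, C₁ n w) + ∑ w, C₂ w, fun μ => ?_⟩
  rw [slobodeckijNorm, ENNReal.coe_add, add_mul]
  refine add_le_add ?_ ?_
  · push_cast
    rw [Finset.sum_mul]
    refine Finset.sum_le_sum fun n hn => ?_
    rw [Finset.sum_mul]
    exact Finset.sum_le_sum fun w _ => hC₁ n w hn μ
  · split_ifs with h
    · exact zero_le
    · push_cast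
      rw [Finset.sum_mul]
      exact Finset.sum_le_sum fun w _ => hC₂ w h μ

end Measures

end PsiDO

theorem proposition2 (d : ℕ) (δ : ℝ) (hδ : δ < 0) (a : PsiDO.Symbol d δ) :
    (∃ C : NNReal, ∀ μ : ComplexMeasure (PsiDO.Eu d),
      PsiDO.l1Norm (a.op (PsiDO.measureDistribution μ)) ≤ C * PsiDO.totalVariationNorm μ) ∧
    ∀ ε : ℝ, 0 < ε →
      (∃ C : NNReal, ∀ μ : ComplexMeasure (PsiDO.Eu d),
        PsiDO.besselNorm (-δ - ε) (a.op (PsiDO.measureDistribution μ)) ≤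
          C * PsiDO.totalVariationNorm μ) ∧
      (ε ≤ -δ → ∃ C : NNReal, ∀ μ : ComplexMeasure (PsiDO.Eu d),
        PsiDO.slobodeckijNorm (-δ - ε) (a.op (PsiDO.measureDistribution μ)) ≤
          C * PsiDO.totalVariationNorm μ) :=
  ⟨a.exists_l1Norm_le hδ, fun _ hε => ⟨a.exists_besselNorm_le hδ (by linarith),
    fun hε' => a.exists_slobodeckijNorm_le (by linarith) (by linarith)⟩⟩
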